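/- Let $F$ be a field of characteristic $0$ (for instance $\mathbb R$ or $\mathbb C$), let $N\ge 2$ and $n\in\mathbb Z$, and let $u_{\pm1},\dots,u_{\pm N}\in F$ be constants with $u_N\ne0$ and $u_{-N}\neq 0$. Put $P_1(\lambda)=\sum_{i=1}^N u_i\lambda^i/i$ and $P_2(\lambda)=\sum_{i=1}^N u_{-i}\lambda^i/i$. For bi-infinite sequences $x=(x_k)_{k\in\mathbb Z}$, $y=(y_k)_{k\in\mathbb Z}$ let $v_k=1-x_ky_k$, let $L_1,L_2$ be the bi-infinite matrices with $$(L_1)_{ij}=\begin{cases}-x_iy_{j-1}+\delta_{i+1,j}& j-i\le 1\\ 0& j-i>1\end{cases},\qquad (L_2)_{ij}=\begin{cases}-y_jx_{i-1}+\delta_{j+1,i}& j-i\ge -1\\ 0& j-i<-1\end{cases},$$ and let $\Gamma_k(x,y;u)$, $\tilde\Gamma_k(x,y;u)$ be the polynomials $$\Gamma_k=\frac{v_k}{y_k}\Bigl(-(L_1P_1'(L_1))_{k+1,k+1}-(L_2P_2'(L_2))_{k,k}+P_1'(L_1)_{k+1,k}+P_2'(L_2)_{k,k+1}\Bigr)+kx_k,$$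 $$\tilde\Gamma_k=\frac{v_k}{x_k}\Bigl(-(L_1P_1'(L_1))_{k,k}-(L_2P_2'(L_2))_{k+1,k+1}+P_1'(L_1)_{k+1,k}+P_2'(L_2)_{k,k+1}\Bigr)+ky_k.$$ Given parameters $a_k,b_k$ ($|k-n|\ge2$), $a_{n\pm1}$, $a_\pm$, $a$ in a field $K\supseteq F$ with $a_{n+1}a_{n-1}(a_{n+1}-a_{n-1})\ne0$, and with $b_{n\pm1}:=1/a_{n\pm1}$, the associated formal Laurent solution is the solution $x_k(t),y_k(t)\in K((t))$, $k\in\mathbb Z$, of the first Toeplitz flow $$\dot x_k=(1-x_ky_k)(x_{k+1}-x_{k-1}),\qquad \dot y_k=(1-x_ky_k)(y_{k+1}-y_{k-1})\qquad(k\in\mathbb Z)$$ with leading terms $$x_k=a_k+(1-a_kb_k)(a_{k+1}-a_{k-1})t+O(t^2),\quad y_k=b_k+(1-a_kb_k)(b_{k+1}-b_{k-1})t+O(t^2)\qquad(|k-n|\ge2),$$ $$x_{n\pm1}=a_{n\pm1}+a_{n\pm1}a_\pm t+O(t^2),\qquad y_{n\pm1}=\frac1{a_{n\pm1}}-\frac{a_\pm}{a_{n\mp1}}t+O(t^2),$$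 $$x_n=\frac{a_{n-1}a_{n+1}(1+at)}{(a_{n-1}-a_{n+1})t}+O(t),\qquad y_n=\frac{1}{(a_{n-1}-a_{n+1})t}\Bigl(-1+\frac{a_{n+1}(a_++a)-a_{n-1}(a_-+a)}{a_{n+1}-a_{n-1}}\,t\Bigr)+O(t).$$ Proposition. Let the $4N-1$ parameters $a_k,b_k$ $(n-2N\le k\le n-2)$ and $a_{n-1}$ be arbitrary, that is, independent indeterminates over $F$, and let $K$ be the field of rational functions over $F$ in these indeterminates. Then all the other parameters can be chosen in $K$ (that is, as rational functions of these $4N-1$ parameters), with $a_{n+1}a_{n-1}(a_{n+1}-a_{n-1})\neq0$, in such a way that the associated formal Laurent solution satisfies, identically in $t$ and for all $k\in\mathbb Z$, $$\Gamma_k(x(t),y(t);u(t))=0\quad\text{and}\quad\tilde\Gamma_k(x(t),y(t);u(t))=0,$$ where $u(t)=(u_{-N},\dots,u_{-2},u_{-1}+t,u_1+t,u_2,\dots,u_N)$. -/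

import Mathlib

noncomputable section

/-! ### Bi-infinite matrices -/

/-- Product of two bi-infinite matrices (indexed by `ℤ × ℤ`). It is only used for factors that
both vanish above some superdiagonal, or both vanish below some subdiagonal, so that only finitely
many terms of the sum are nonzero (see `biPow_succ_eq_sum` and `biMul_biPow_eq_sum`). -/
def biMul {R : Type*} [CommRing R] (A B : ℤ → ℤ → R) : ℤ → ℤ → R :=
  fun i j => ∑ᶠ m : ℤ, A i m * B m j

/-- Powers of a bi-infinite matrix. -/
def biPow {R : Type*} [CommRing R] (A : ℤ → ℤ → R) : ℕ → ℤ → ℤ → R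
  | 0 => fun i j => if i = j then 1 else 0
  | s + 1 => biMul (biPow A s) A

/-- The Toeplitz Lax matrix `L₁`: `(L₁)ᵢⱼ = -xᵢ yⱼ₋₁ + δᵢ₊₁,ⱼ` if `j - i ≤ 1`, and `0` otherwise. -/
def toeplitzL1 {R : Type*} [CommRing R] (x y : ℤ → R) : ℤ → ℤ → R :=
  fun i j => if j ≤ i + 1 then -(x i * y (j - 1)) + (if i + 1 = j then 1 else 0) else 0

/-- The Toeplitz Lax matrix `L₂`: `(L₂)ᵢⱼ = -yⱼ xᵢ₋₁ + δⱼ₊₁,ᵢ` if `j - i ≥ -1`, and `0` otherwise. -/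
def toeplitzL2 {R : Type*} [CommRing R] (x y : ℤ → R) : ℤ → ℤ → R :=
  fun i j => if i ≤ j + 1 then -(y j * x (i - 1)) + (if j + 1 = i then 1 else 0) else 0

/-- The bi-infinite matrix `P'(A) = ∑_{i=1}^N uᵢ A^{i-1}` attached to `P(λ) = ∑_{i=1}^N uᵢ λ^i / i`. -/
def derivPoly {R : Type*} [CommRing R] (N : ℕ) (u : ℕ → R) (A : ℤ → ℤ → R) : ℤ → ℤ → R :=
  fun i j => ∑ s ∈ Finset.range N, u (s + 1) * biPow A s i j

/-! ### The recursion relations -/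

/-- `v_k = 1 - x_k y_k`. -/
def toeplitzV {R : Type*} [CommRing R] (x y : ℤ → R) (k : ℤ) : R := 1 - x k * y k

/-- The polynomial `Γ_k(x, y; u)`, where `u i` is used for `1 ≤ |i| ≤ N` only.
This is the polynomial obtained from
`(v_k / y_k) (-(L₁P₁'(L₁))_{k+1,k+1} - (L₂P₂'(L₂))_{k,k} + P₁'(L₁)_{k+1,k} + P₂'(L₂)_{k,k+1}) + k x_k`
after carrying out the exact division by `y_k`, as proved in `mul_toeplitzGamma_sub` and
`toeplitzGamma_eq_div`. -/
def toeplitzGamma {R : Type*} [CommRing R] (N : ℕ) (u : ℤ → R) (x y : ℤ → R) (k : ℤ) : R :=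
  toeplitzV x y k * ∑ s ∈ Finset.range N,
    (u (s + 1) * ∑ m ∈ Finset.Icc k (k + 1 + s), biPow (toeplitzL1 x y) s (k + 1) m * x m +
      u (-(s + 1)) * ∑ m ∈ Finset.Icc (k - s) (k + 1), biPow (toeplitzL2 x y) s k m * x (m - 1))
  + k * x k

/-- The polynomial `Γ̃_k(x, y; u)`, obtained from
`(v_k / x_k) (-(L₁P₁'(L₁))_{k,k} - (L₂P₂'(L₂))_{k+1,k+1} + P₁'(L₁)_{k+1,k} + P₂'(L₂)_{k,k+1}) + k y_k`
after carrying out the exact division by `x_k`, as proved in `mul_toeplitzGammaTilde_sub` and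
`toeplitzGammaTilde_eq_div`. -/
def toeplitzGammaTilde {R : Type*} [CommRing R] (N : ℕ) (u : ℤ → R) (x y : ℤ → R) (k : ℤ) : R :=
  toeplitzV x y k * ∑ s ∈ Finset.range N,
    (u (s + 1) * ∑ m ∈ Finset.Icc (k - s) (k + 1), y (m - 1) * biPow (toeplitzL1 x y) s m k +
      u (-(s + 1)) * ∑ m ∈ Finset.Icc k (k + 1 + s), y m * biPow (toeplitzL2 x y) s m (k + 1))
  + k * y k

/-! ### Proofs that these definitions agree with the matrix formulas -/

theorem biPow_eq_zero {R : Type*} [CommRing R] {A : ℤ → ℤ → R}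
    (hA : ∀ i j, i + 1 < j → A i j = 0) (s : ℕ) (i j : ℤ) (h : i + s < j) :
    biPow A s i j = 0 := by
  induction s generalizing i j with
  | zero =>
    have : i ≠ j := by push_cast at h; omega
    simp [biPow, this]
  | succ s ih =>
    simp only [biPow, biMul]
    rw [← finsum_zero (α := ℤ)]
    congr 1
    funext m
    push_cast at h
    by_cases hm : i + s < m
    · rw [ih i m hm, zero_mul]
    · rw [hA m j (by omega), mul_zero]

/-- A product of a power of a matrix without entries above the first superdiagonal with the matrix
itself is a finite sum. -/
theorem biPow_succ_eq_sum {R : Type*} [CommRing R] {A : ℤ → ℤ → R}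
    (hA : ∀ i j, i + 1 < j → A i j = 0) (s : ℕ) (i j : ℤ) :
    biPow A (s + 1) i j = ∑ m ∈ Finset.Icc (j - 1) (i + s), biPow A s i m * A m j := by
  simp only [biPow, biMul]
  apply finsum_eq_sum_of_support_subset
  intro m hm
  rw [Function.mem_support] at hm
  rw [Finset.coe_Icc, Set.mem_Icc]
  by_contra hc
  apply hm
  by_cases h : i + s < m
  · rw [biPow_eq_zero hA s i m h, zero_mul]
  · rw [hA m j (by omega), mul_zero]

theorem biMul_biPow_eq_sum {R : Type*} [CommRing R] {A : ℤ → ℤ → R}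
    (hA : ∀ i j, i + 1 < j → A i j = 0) (s : ℕ) (i j : ℤ) :
    biMul A (biPow A s) i j = ∑ m ∈ Finset.Icc (j - s) (i + 1), A i m * biPow A s m j := by
  simp only [biMul]
  apply finsum_eq_sum_of_support_subset
  intro m hm
  rw [Function.mem_support] at hm
  rw [Finset.coe_Icc, Set.mem_Icc]
  by_contra hc
  apply hm
  by_cases h : i + 1 < m
  · rw [hA i m h, zero_mul]
  · rw [biPow_eq_zero hA s m j (by omega), mul_zero]

theorem biPow_succ_eq_biMul {R : Type*} [CommRing R] {A : ℤ → ℤ → R}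
    (hA : ∀ i j, i + 1 < j → A i j = 0) (s : ℕ) (i j : ℤ) :
    biPow A (s + 1) i j = biMul A (biPow A s) i j := by
  induction s generalizing i j with
  | zero =>
    simp only [biPow, biMul]
    rw [finsum_eq_single _ i (fun m hm => by simp [Ne.symm hm]),
      finsum_eq_single _ j (fun m hm => by simp [hm])]
    simp
  | succ s ih =>
    rw [biPow_succ_eq_sum hA (s + 1), biMul_biPow_eq_sum hA (s + 1)]
    have h1 : ∀ m ∈ Finset.Icc (j - 1) (i + (s + 1 : ℕ)), biPow A (s + 1) i m * A m j =
        ∑ l ∈ Finset.Icc (j - (s + 1 : ℕ)) (i + 1), A i l * biPow A s l m * A m j := by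
      intro m hm
      rw [ih, biMul_biPow_eq_sum hA, Finset.sum_mul]
      rw [Finset.mem_Icc] at hm
      apply Finset.sum_subset_zero_on_sdiff
      · intro l hl
        rw [Finset.mem_Icc] at hl ⊢
        push_cast
        omega
      · intro l hl
        rw [Finset.mem_sdiff, Finset.mem_Icc, Finset.mem_Icc] at hl
        rw [biPow_eq_zero hA s l m (by omega), mul_zero, zero_mul]
      · intro l _
        rfl
    rw [Finset.sum_congr rfl h1, Finset.sum_comm]
    apply Finset.sum_congr rfl
    intro l hl
    rw [Finset.mem_Icc] at hl
    rw [biPow_succ_eq_sum hA, Finset.mul_sum]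
    symm
    apply Finset.sum_subset_zero_on_sdiff
    · intro m hm
      rw [Finset.mem_Icc] at hm ⊢
      push_cast
      omega
    · intro m hm
      rw [Finset.mem_sdiff, Finset.mem_Icc, Finset.mem_Icc] at hm
      rw [biPow_eq_zero hA s l m (by omega), mul_zero, zero_mul]
    · intro m _
      ring

/-- The same finite sum for matrices without entries below the first subdiagonal, through
transposition. -/
theorem biPow_transpose {R : Type*} [CommRing R] {A : ℤ → ℤ → R}
    (hA : ∀ i j, i + 1 < j → A i j = 0) (s : ℕ) (i j : ℤ) :
    biPow (fun i j => A j i) s i j = biPow A s j i := by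
  induction s generalizing i j with
  | zero => simp [biPow, eq_comm]
  | succ s ih =>
    rw [biPow_succ_eq_biMul hA]
    simp only [biPow, biMul]
    congr 1
    funext m
    rw [ih, mul_comm]

theorem toeplitzL1_eq_zero {R : Type*} [CommRing R] (x y : ℤ → R) (i j : ℤ) (h : i + 1 < j) :
    toeplitzL1 x y i j = 0 := by
  simp [toeplitzL1, not_le.mpr h]

theorem toeplitzL2_eq_transpose {R : Type*} [CommRing R] (x y : ℤ → R) :
    toeplitzL2 x y = fun i j => toeplitzL1 y x j i := rfl

theorem biPow_toeplitzL2 {R : Type*} [CommRing R] (x y : ℤ → R) (s : ℕ) (i j : ℤ) :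
    biPow (toeplitzL2 x y) s i j = biPow (toeplitzL1 y x) s j i := by
  rw [toeplitzL2_eq_transpose, biPow_transpose (toeplitzL1_eq_zero y x)]

/-- Right multiplication by `L₁` on the diagonal. -/
theorem biPow_succ_toeplitzL1_diag {R : Type*} [CommRing R] (x y : ℤ → R) (s : ℕ) (k : ℤ) :
    biPow (toeplitzL1 x y) (s + 1) (k + 1) (k + 1) = biPow (toeplitzL1 x y) s (k + 1) k -
      y k * ∑ m ∈ Finset.Icc k (k + 1 + s), biPow (toeplitzL1 x y) s (k + 1) m * x m := by
  rw [biPow_succ_eq_sum (toeplitzL1_eq_zero x y), show k + 1 - 1 = k by ring]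
  have h : ∀ m ∈ Finset.Icc k (k + 1 + s), biPow (toeplitzL1 x y) s (k + 1) m *
      toeplitzL1 x y m (k + 1) = (if m = k then biPow (toeplitzL1 x y) s (k + 1) m else 0) -
        y k * (biPow (toeplitzL1 x y) s (k + 1) m * x m) := by
    intro m hm
    rw [Finset.mem_Icc] at hm
    by_cases hmk : m = k
    · subst hmk
      simp [toeplitzL1]
      ring
    · simp [toeplitzL1, hmk, hm.1]
      ring
  rw [Finset.sum_congr rfl h, Finset.sum_sub_distrib, Finset.mul_sum, Finset.sum_ite_eq',
    if_pos (by rw [Finset.mem_Icc]; omega)]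

/-- Left multiplication by `L₁` on the diagonal. -/
theorem biPow_succ_toeplitzL1_diag' {R : Type*} [CommRing R] (x y : ℤ → R) (s : ℕ) (k : ℤ) :
    biPow (toeplitzL1 x y) (s + 1) k k = biPow (toeplitzL1 x y) s (k + 1) k -
      x k * ∑ m ∈ Finset.Icc (k - s) (k + 1), y (m - 1) * biPow (toeplitzL1 x y) s m k := by
  rw [biPow_succ_eq_biMul (toeplitzL1_eq_zero x y), biMul_biPow_eq_sum (toeplitzL1_eq_zero x y)]
  have h : ∀ m ∈ Finset.Icc (k - s) (k + 1), toeplitzL1 x y k m * biPow (toeplitzL1 x y) s m k =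
      (if m = k + 1 then biPow (toeplitzL1 x y) s m k else 0) -
        x k * (y (m - 1) * biPow (toeplitzL1 x y) s m k) := by
    intro m hm
    rw [Finset.mem_Icc] at hm
    by_cases hmk : m = k + 1
    · subst hmk
      simp [toeplitzL1]
      ring
    · simp [toeplitzL1, hmk, hm.2, Ne.symm hmk]
      ring
  rw [Finset.sum_congr rfl h, Finset.sum_sub_distrib, Finset.mul_sum, Finset.sum_ite_eq',
    if_pos (by rw [Finset.mem_Icc]; omega)]

theorem biMul_derivPoly_toeplitzL1 {R : Type*} [CommRing R] (N : ℕ) (u : ℕ → R) (x y : ℤ → R)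
    (i j : ℤ) : biMul (toeplitzL1 x y) (derivPoly N u (toeplitzL1 x y)) i j =
      ∑ s ∈ Finset.range N, u (s + 1) * biPow (toeplitzL1 x y) (s + 1) i j := by
  have hA := toeplitzL1_eq_zero x y
  have h : biMul (toeplitzL1 x y) (derivPoly N u (toeplitzL1 x y)) i j =
      ∑ m ∈ Finset.Icc (j - N) (i + 1),
        toeplitzL1 x y i m * derivPoly N u (toeplitzL1 x y) m j := by
    simp only [biMul]
    apply finsum_eq_sum_of_support_subset
    intro m hm
    rw [Function.mem_support] at hm
    rw [Finset.coe_Icc, Set.mem_Icc]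
    by_contra hc
    apply hm
    by_cases h : i + 1 < m
    · rw [hA i m h, zero_mul]
    · have : derivPoly N u (toeplitzL1 x y) m j = 0 := by
        apply Finset.sum_eq_zero
        intro s hs
        rw [Finset.mem_range] at hs
        rw [biPow_eq_zero hA s m j (by omega), mul_zero]
      rw [this, mul_zero]
  rw [h]
  simp only [derivPoly, Finset.mul_sum]
  rw [Finset.sum_comm]
  apply Finset.sum_congr rfl
  intro s hs
  rw [Finset.mem_range] at hs
  rw [biPow_succ_eq_biMul hA, biMul_biPow_eq_sum hA, Finset.mul_sum]
  symm
  apply Finset.sum_subset_zero_on_sdiff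
  · intro m hm
    rw [Finset.mem_Icc] at hm ⊢
    omega
  · intro m hm
    rw [Finset.mem_sdiff, Finset.mem_Icc, Finset.mem_Icc] at hm
    rw [biPow_eq_zero hA s m j (by omega)]
    ring
  · intro m _
    ring

theorem derivPoly_toeplitzL2 {R : Type*} [CommRing R] (N : ℕ) (u : ℕ → R) (x y : ℤ → R)
    (i j : ℤ) : derivPoly N u (toeplitzL2 x y) i j = derivPoly N u (toeplitzL1 y x) j i := by
  simp only [derivPoly, biPow_toeplitzL2]

theorem biMul_derivPoly_toeplitzL2 {R : Type*} [CommRing R] (N : ℕ) (u : ℕ → R) (x y : ℤ → R)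
    (i j : ℤ) : biMul (toeplitzL2 x y) (derivPoly N u (toeplitzL2 x y)) i j =
      ∑ s ∈ Finset.range N, u (s + 1) * biPow (toeplitzL1 y x) (s + 1) j i := by
  have hA := toeplitzL1_eq_zero y x
  have h : biMul (toeplitzL2 x y) (derivPoly N u (toeplitzL2 x y)) i j =
      ∑ m ∈ Finset.Icc (i - 1) (j + N),
        toeplitzL1 y x m i * derivPoly N u (toeplitzL1 y x) j m := by
    simp only [biMul, derivPoly_toeplitzL2]
    change ∑ᶠ m : ℤ, toeplitzL1 y x m i * derivPoly N u (toeplitzL1 y x) j m = _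
    apply finsum_eq_sum_of_support_subset
    intro m hm
    rw [Function.mem_support] at hm
    rw [Finset.coe_Icc, Set.mem_Icc]
    by_contra hc
    apply hm
    by_cases h : m + 1 < i
    · rw [hA m i h, zero_mul]
    · have : derivPoly N u (toeplitzL1 y x) j m = 0 := by
        apply Finset.sum_eq_zero
        intro s hs
        rw [Finset.mem_range] at hs
        rw [biPow_eq_zero hA s j m (by omega), mul_zero]
      rw [this, mul_zero]
  rw [h]
  simp only [derivPoly, Finset.mul_sum]
  rw [Finset.sum_comm]
  apply Finset.sum_congr rfl
  intro s hs
  rw [Finset.mem_range] at hs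
  rw [biPow_succ_eq_sum hA, Finset.mul_sum]
  symm
  apply Finset.sum_subset_zero_on_sdiff
  · intro m hm
    rw [Finset.mem_Icc] at hm ⊢
    omega
  · intro m hm
    rw [Finset.mem_sdiff, Finset.mem_Icc, Finset.mem_Icc] at hm
    rw [biPow_eq_zero hA s j m (by omega)]
    ring
  · intro m _
    ring

/-- The bracket in the definition of `Γ_k`. -/
def gammaBracket {R : Type*} [CommRing R] (N : ℕ) (u : ℤ → R) (x y : ℤ → R) (k : ℤ) : R :=
  -(biMul (toeplitzL1 x y) (derivPoly N (fun i => u i) (toeplitzL1 x y)) (k + 1) (k + 1))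
  - biMul (toeplitzL2 x y) (derivPoly N (fun i => u (-i)) (toeplitzL2 x y)) k k
  + derivPoly N (fun i => u i) (toeplitzL1 x y) (k + 1) k
  + derivPoly N (fun i => u (-i)) (toeplitzL2 x y) k (k + 1)

/-- The bracket in the definition of `Γ̃_k`. -/
def gammaTildeBracket {R : Type*} [CommRing R] (N : ℕ) (u : ℤ → R) (x y : ℤ → R) (k : ℤ) : R :=
  -(biMul (toeplitzL1 x y) (derivPoly N (fun i => u i) (toeplitzL1 x y)) k k)
  - biMul (toeplitzL2 x y) (derivPoly N (fun i => u (-i)) (toeplitzL2 x y)) (k + 1) (k + 1)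
  + derivPoly N (fun i => u i) (toeplitzL1 x y) (k + 1) k
  + derivPoly N (fun i => u (-i)) (toeplitzL2 x y) k (k + 1)

theorem mul_toeplitzGamma_sub {R : Type*} [CommRing R] (N : ℕ) (u : ℤ → R) (x y : ℤ → R) (k : ℤ) :
    y k * (toeplitzGamma N u x y k - k * x k) = toeplitzV x y k * gammaBracket N u x y k := by
  simp only [toeplitzGamma, gammaBracket, biMul_derivPoly_toeplitzL1, biMul_derivPoly_toeplitzL2,
    derivPoly, biPow_toeplitzL2, add_sub_cancel_right]
  rw [mul_left_comm]
  congr 1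
  rw [Finset.mul_sum, ← Finset.sum_neg_distrib, ← Finset.sum_sub_distrib,
    ← Finset.sum_add_distrib, ← Finset.sum_add_distrib]
  apply Finset.sum_congr rfl
  intro s _
  rw [biPow_succ_toeplitzL1_diag x y s k, biPow_succ_toeplitzL1_diag' y x s k]
  simp only [mul_comm (x _)]
  push_cast
  ring

theorem mul_toeplitzGammaTilde_sub {R : Type*} [CommRing R] (N : ℕ) (u : ℤ → R) (x y : ℤ → R)
    (k : ℤ) : x k * (toeplitzGammaTilde N u x y k - k * y k) =
      toeplitzV x y k * gammaTildeBracket N u x y k := by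
  simp only [toeplitzGammaTilde, gammaTildeBracket, biMul_derivPoly_toeplitzL1,
    biMul_derivPoly_toeplitzL2, derivPoly, biPow_toeplitzL2, add_sub_cancel_right]
  rw [mul_left_comm]
  congr 1
  rw [Finset.mul_sum, ← Finset.sum_neg_distrib, ← Finset.sum_sub_distrib,
    ← Finset.sum_add_distrib, ← Finset.sum_add_distrib]
  apply Finset.sum_congr rfl
  intro s _
  rw [biPow_succ_toeplitzL1_diag' x y s k, biPow_succ_toeplitzL1_diag y x s k]
  simp only [mul_comm (y _)]
  push_cast
  ring

theorem toeplitzGamma_eq_div {K : Type*} [Field K] (N : ℕ) (u : ℤ → K) (x y : ℤ → K) (k : ℤ)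
    (hy : y k ≠ 0) : toeplitzGamma N u x y k =
      toeplitzV x y k / y k * gammaBracket N u x y k + k * x k := by
  have h := mul_toeplitzGamma_sub N u x y k
  field_simp
  linear_combination h

theorem toeplitzGammaTilde_eq_div {K : Type*} [Field K] (N : ℕ) (u : ℤ → K) (x y : ℤ → K) (k : ℤ)
    (hx : x k ≠ 0) : toeplitzGammaTilde N u x y k =
      toeplitzV x y k / x k * gammaTildeBracket N u x y k + k * y k := by
  have h := mul_toeplitzGammaTilde_sub N u x y k
  field_simp
  linear_combination h

/-! ### The formal Laurent solutions of the first Toeplitz flow -/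

/-- The parameters of the formal Laurent solution whose pole sits at the index `n`:
`c_k = (a k, b k)` for `k ≠ n`, together with `a₋ = aMinus`, `a₊ = aPlus` and `a = a₀`.
The values `a n` and `b n` are never used. -/
structure LaurentParams (K : Type*) where
  a : ℤ → K
  b : ℤ → K
  aMinus : K
  aPlus : K
  a₀ : K

/-- `f = c₀ t^d + c₁ t^(d+1) + O(t^(d+2))`. -/
def HasExpansion {K : Type*} [Field K] (f : LaurentSeries K) (d : ℤ) (c₀ c₁ : K) : Prop :=
  (∀ i < d, f.coeff i = 0) ∧ f.coeff d = c₀ ∧ f.coeff (d + 1) = c₁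

/-- `(x(t), y(t))` is the formal Laurent solution of the first Toeplitz vector field with pole at
index `n` and parameters `p`: all `x_k`, `y_k` satisfy the Toeplitz equations, and their first two
coefficients are the prescribed ones (these determine all further coefficients). -/
structure IsLaurentSolution {K : Type*} [Field K] (n : ℤ) (p : LaurentParams K)
    (x y : ℤ → LaurentSeries K) : Prop where
  /-- the restrictions on the parameters `a_{n-1}`, `a_{n+1}`, and `b_{n±1} = 1 / a_{n±1}` -/
  a_left_ne : p.a (n - 1) ≠ 0
  a_right_ne : p.a (n + 1) ≠ 0
  a_ne : p.a (n + 1) ≠ p.a (n - 1)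
  b_left : p.b (n - 1) = 1 / p.a (n - 1)
  b_right : p.b (n + 1) = 1 / p.a (n + 1)
  /-- the first Toeplitz vector field -/
  deriv_x : ∀ k, LaurentSeries.derivative K (x k) = (1 - x k * y k) * (x (k + 1) - x (k - 1))
  deriv_y : ∀ k, LaurentSeries.derivative K (y k) = (1 - x k * y k) * (y (k + 1) - y (k - 1))
  /-- the leading terms for `|k - n| ≥ 2` -/
  x_far : ∀ k, 2 ≤ |k - n| →
    HasExpansion (x k) 0 (p.a k) ((1 - p.a k * p.b k) * (p.a (k + 1) - p.a (k - 1)))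
  y_far : ∀ k, 2 ≤ |k - n| →
    HasExpansion (y k) 0 (p.b k) ((1 - p.a k * p.b k) * (p.b (k + 1) - p.b (k - 1)))
  /-- the leading terms for `k = n ± 1` -/
  x_right : HasExpansion (x (n + 1)) 0 (p.a (n + 1)) (p.a (n + 1) * p.aPlus)
  y_right : HasExpansion (y (n + 1)) 0 (1 / p.a (n + 1)) (-p.aPlus / p.a (n - 1))
  x_left : HasExpansion (x (n - 1)) 0 (p.a (n - 1)) (p.a (n - 1) * p.aMinus)
  y_left : HasExpansion (y (n - 1)) 0 (1 / p.a (n - 1)) (-p.aMinus / p.a (n + 1))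
  /-- the leading terms for `k = n`, where there is a simple pole -/
  x_pole : HasExpansion (x n) (-1)
    (1 / (p.a (n - 1) - p.a (n + 1)) * (p.a (n - 1) * p.a (n + 1)))
    (1 / (p.a (n - 1) - p.a (n + 1)) * (p.a (n - 1) * p.a (n + 1) * p.a₀))
  y_pole : HasExpansion (y n) (-1)
    (1 / (p.a (n - 1) - p.a (n + 1)) * (-1))
    (1 / (p.a (n - 1) - p.a (n + 1)) *
      ((p.a (n + 1) * (p.aPlus + p.a₀) - p.a (n - 1) * (p.aMinus + p.a₀)) /
        (p.a (n + 1) - p.a (n - 1))))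

/-- `u(t) = (u_{-N}, …, u_{-2}, u_{-1} + t, u_1 + t, u_2, …, u_N)`. -/
def timeU {K : Type*} [Field K] (u : ℤ → K) (i : ℤ) : LaurentSeries K :=
  HahnSeries.C (u i) + if i = 1 ∨ i = -1 then HahnSeries.single 1 1 else 0

/-! ### Rational functions of the free parameters -/

/-- Names for the `4N - 1` free parameters `a_k, b_k` (`n - 2N ≤ k ≤ n - 2`) and `a_{n-1}`. -/
inductive FreeParam (n : ℤ) (N : ℕ) : Type
  | a (k : ℤ) (h : n - 2 * N ≤ k ∧ k ≤ n - 2) : FreeParam n N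
  | b (k : ℤ) (h : n - 2 * N ≤ k ∧ k ≤ n - 2) : FreeParam n N
  | aLeft : FreeParam n N

/-- The field of rational functions over `F` in the `4N - 1` free parameters. -/
abbrev RatParam (F : Type*) [Field F] (n : ℤ) (N : ℕ) : Type _ :=
  FractionRing (MvPolynomial (FreeParam n N) F)

/-- A free parameter, as an indeterminate of the field of rational functions. -/
def RatParam.var (F : Type*) [Field F] {n : ℤ} {N : ℕ} (i : FreeParam n N) : RatParam F n N :=
  algebraMap (MvPolynomial (FreeParam n N) F) (RatParam F n N) (MvPolynomial.X i)

end

/-! The Laurent solutions are obtained by specialising generic power series solutions to a divisor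
on which they acquire a pole.

Generic solutions. At the bond between the sites k-1 and k there are row, column and diagonal
moments of the powers of L₁ and, with x and y exchanged, of L₂. The diagonal moments are polynomials
in the other ones (`bondD_eq_quadD`). Since u_N and u_{-N} do not vanish, the relations Γ = Γ̃ = 0
at k-1 and k express the moments of order N through those of lower order (`bondGamma_eq_zero_iff`),
so the flow becomes a polynomial differential equation in 4N unknowns
(`deriv_bondMoment_eq_bondField`). Conversely, an integral curve of this equation whose entries of
order zero extend to a solution of the flow satisfies the relations at the two sites
(`bondMoment_eq_of_integral`), hence everywhere, because (Γ, -Γ̃) solves the linearised flow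
(`linAt_gamma`, `gamma_eq_zero_of_bond`). Initial values at the sites n-2N, …, n-1 that are 4N
independent variables thus give a solution in power series over their fraction field L
(`exists_isGammaSolution`).

Specialisation. The pole at n appears on the divisor v_{n-1}(0) = 0, that is b_{n-1} = 1/a_{n-1}.
Let O be the discrete valuation ring of L obtained by localising there. If every site other than n
has coefficients in O, these can be mapped to the field of the remaining 4N-1 parameters. The
products v_{n-1} x_n and v_{n-1} y_n have coefficients in O as well, and v_{n-1} becomes t times a
unit, so x_n and y_n become Laurent series with a simple pole. Comparing coefficients in the flow
gives the prescribed leading terms (`exists_isLaurentSolution`).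

Regularity. Two things could fail. At the pole itself, an explicit computation (singularity
confinement, `confinement`) gives v_{n+1} = v_{n-1} w and shows that the sites n+1 and n+2 are
regular, provided that certain elements are units of O; this is verified at a single point of the
divisor (`IsGenericSolution.exists_pole_eval`). Farther away, another v_j might vanish on the
divisor. Here it is used that the 4N initial moments at any bond are algebraically independent
generators of L, so that each bond carries a polynomial ring in which the v of an adjacent site is
prime. If a second pole occurred along O, a weighted product of the v_j in between would be a unit
at all primes of one of these rings, hence a constant, and yet a nonunit of O
(`isUnitIn_poleRing_right`). -/

namespace ToeplitzFlow

/-! ### Powers of the Lax matrix and their moments -/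

section Algebra

variable {R : Type*} [CommRing R] (x y : ℤ → R)

/-- Entries of the powers of the Lax matrix `L₁`. -/
noncomputable def lax (s : ℕ) (i j : ℤ) : R := biPow (toeplitzL1 x y) s i j

/-- The row `i` of a power of `L₁`, cut at the column `j`, applied to `x`. -/
noncomputable def rowMoment (s : ℕ) (i j : ℤ) : R :=
  ∑ m ∈ Finset.Icc j (i + s), lax x y s i m * x m

/-- The column `j` of a power of `L₁`, cut at the row `i + 1`, applied to the shifted `y`. -/
noncomputable def colMoment (s : ℕ) (i j : ℤ) : R :=
  ∑ m ∈ Finset.Icc (j - s) (i + 1), y (m - 1) * lax x y s m j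

/-- The corner of a power of `L₁` applied to `x` and to the shifted `y`. -/
noncomputable def cornerMoment (s : ℕ) (i j : ℤ) : R :=
  ∑ m ∈ Finset.Icc j (i + 1 + s), colMoment x y s i m * x m

theorem lax_zero (i j : ℤ) : lax x y 0 i j = if i = j then 1 else 0 := rfl

theorem lax_eq_zero {s : ℕ} {i j : ℤ} (h : i + s < j) : lax x y s i j = 0 :=
  biPow_eq_zero (toeplitzL1_eq_zero x y) s i j h

theorem rowMoment_eq_zero {s : ℕ} {i j : ℤ} (h : i + s < j) : rowMoment x y s i j = 0 := by
  rw [rowMoment, Finset.Icc_eq_empty (by omega), Finset.sum_empty]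

theorem colMoment_eq_zero {s : ℕ} {i j : ℤ} (h : i + 1 + s < j) : colMoment x y s i j = 0 := by
  rw [colMoment, Finset.Icc_eq_empty (by omega), Finset.sum_empty]

theorem cornerMoment_eq_zero {s : ℕ} {i j : ℤ} (h : i + 1 + s < j) :
    cornerMoment x y s i j = 0 := by
  rw [cornerMoment, Finset.Icc_eq_empty (by omega), Finset.sum_empty]

theorem Icc_eq_insert_left {a b : ℤ} (h : a ≤ b) :
    Finset.Icc a b = insert a (Finset.Icc (a + 1) b) := by
  ext m; simp only [Finset.mem_Icc, Finset.mem_insert]; omega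

theorem Icc_eq_insert_right {a b : ℤ} (h : a ≤ b + 1) :
    Finset.Icc a (b + 1) = insert (b + 1) (Finset.Icc a b) := by
  ext m; simp only [Finset.mem_Icc, Finset.mem_insert]; omega

theorem lax_succ_right (s : ℕ) (i j : ℤ) :
    lax x y (s + 1) i (j + 1) = lax x y s i j - y j * rowMoment x y s i j := by
  simp only [lax, rowMoment]
  rw [biPow_succ_eq_sum (toeplitzL1_eq_zero x y), show j + 1 - 1 = j by ring]
  have h : ∀ m ∈ Finset.Icc j (i + s), biPow (toeplitzL1 x y) s i m *
      toeplitzL1 x y m (j + 1) = (if m = j then biPow (toeplitzL1 x y) s i m else 0) -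
        y j * (biPow (toeplitzL1 x y) s i m * x m) := by
    intro m hm
    rw [Finset.mem_Icc] at hm
    by_cases hmk : m = j
    · subst hmk
      simp [toeplitzL1]
      ring
    · simp [toeplitzL1, hmk, hm.1]
      ring
  rw [Finset.sum_congr rfl h, Finset.sum_sub_distrib, Finset.mul_sum, Finset.sum_ite_eq']
  congr 1
  split_ifs with hj
  · rfl
  · rw [biPow_eq_zero (toeplitzL1_eq_zero x y)]
    rw [Finset.mem_Icc] at hj
    omega

theorem lax_succ_left (s : ℕ) (i j : ℤ) :
    lax x y (s + 1) i j = lax x y s (i + 1) j - x i * colMoment x y s i j := by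
  simp only [lax, colMoment]
  rw [biPow_succ_eq_biMul (toeplitzL1_eq_zero x y), biMul_biPow_eq_sum (toeplitzL1_eq_zero x y)]
  have h : ∀ m ∈ Finset.Icc (j - s) (i + 1), toeplitzL1 x y i m * biPow (toeplitzL1 x y) s m j =
      (if m = i + 1 then biPow (toeplitzL1 x y) s m j else 0) -
        x i * (y (m - 1) * biPow (toeplitzL1 x y) s m j) := by
    intro m hm
    rw [Finset.mem_Icc] at hm
    by_cases hmk : m = i + 1
    · subst hmk
      simp [toeplitzL1]
      ring
    · simp [toeplitzL1, hmk, hm.2, Ne.symm hmk]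
      ring
  rw [Finset.sum_congr rfl h, Finset.sum_sub_distrib, Finset.mul_sum, Finset.sum_ite_eq']
  congr 1
  split_ifs with hj
  · rfl
  · rw [biPow_eq_zero (toeplitzL1_eq_zero x y)]
    rw [Finset.mem_Icc] at hj
    omega

theorem rowMoment_step (s : ℕ) (i j : ℤ) :
    rowMoment x y s i j = rowMoment x y s i (j + 1) + lax x y s i j * x j := by
  by_cases h : j ≤ i + s
  · rw [rowMoment, Icc_eq_insert_left h, Finset.sum_insert (by simp), rowMoment, add_comm]
  · rw [rowMoment_eq_zero x y (by omega), rowMoment_eq_zero x y (by omega),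
      lax_eq_zero x y (by omega)]
    simp

theorem colMoment_step (s : ℕ) (i j : ℤ) :
    colMoment x y s i j = colMoment x y s (i - 1) j + y i * lax x y s (i + 1) j := by
  by_cases h : j - s ≤ i + 1
  · rw [colMoment, Icc_eq_insert_right h, Finset.sum_insert (by simp), colMoment, add_comm]
    simp
  · rw [colMoment_eq_zero x y (by omega), colMoment_eq_zero x y (by omega),
      lax_eq_zero x y (by omega)]
    simp

theorem cornerMoment_step_right (s : ℕ) (i j : ℤ) :
    cornerMoment x y s i j = cornerMoment x y s i (j + 1) + colMoment x y s i j * x j := by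
  by_cases h : j ≤ i + 1 + s
  · rw [cornerMoment, Icc_eq_insert_left h, Finset.sum_insert (by simp), cornerMoment, add_comm]
  · rw [cornerMoment_eq_zero x y (by omega), cornerMoment_eq_zero x y (by omega),
      colMoment_eq_zero x y (by omega)]
    simp

theorem cornerMoment_step_left (s : ℕ) (i j : ℤ) :
    cornerMoment x y s i j = cornerMoment x y s (i - 1) j + y i * rowMoment x y s (i + 1) j := by
  have h1 : cornerMoment x y s (i - 1) j =
      ∑ m ∈ Finset.Icc j (i + 1 + s), colMoment x y s (i - 1) m * x m := by
    rw [cornerMoment]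
    refine Finset.sum_subset_zero_on_sdiff ?_ ?_ (fun _ _ => rfl)
    · intro m; simp only [Finset.mem_Icc]; omega
    · intro m hm
      simp only [Finset.mem_sdiff, Finset.mem_Icc] at hm
      rw [colMoment_eq_zero x y (by omega), zero_mul]
  rw [h1, cornerMoment, rowMoment, Finset.mul_sum, ← Finset.sum_add_distrib]
  refine Finset.sum_congr rfl fun m _ => ?_
  rw [colMoment_step]
  ring

/-- Interchange of the two summations, proved by peeling off one row at a time. The recursion
`colMoment_succ` needs the corner in this form. -/
theorem cornerMoment_eq_sum_rowMoment (s : ℕ) (i j : ℤ) :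
    cornerMoment x y s i j =
      ∑ m ∈ Finset.Icc (j - s) (i + 1), y (m - 1) * rowMoment x y s m j := by
  have key : ∀ (d : ℕ) (i : ℤ), i + 1 - (j - s) + 1 = d → cornerMoment x y s i j =
      ∑ m ∈ Finset.Icc (j - s) (i + 1), y (m - 1) * rowMoment x y s m j := by
    intro d
    induction d with
    | zero =>
      intro i hi
      rw [cornerMoment_eq_zero x y (by push_cast at hi; omega),
        Finset.Icc_eq_empty (by push_cast at hi; omega), Finset.sum_empty]
    | succ d ih =>
      intro i hi
      rw [cornerMoment_step_left, ih (i - 1) (by push_cast at hi ⊢; omega),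
        Icc_eq_insert_right (a := j - s) (b := i) (by push_cast at hi; omega),
        Finset.sum_insert (by simp)]
      simp [add_comm]
  by_cases h : j - s ≤ i + 1
  · exact key (i + 1 - (j - s) + 1).toNat i (by omega)
  · rw [cornerMoment_eq_zero x y (by omega), Finset.Icc_eq_empty (by omega), Finset.sum_empty]

theorem rowMoment_succ (s : ℕ) (i j : ℤ) :
    rowMoment x y (s + 1) i j = rowMoment x y s (i + 1) j - x i * cornerMoment x y s i j := by
  rw [rowMoment, rowMoment, cornerMoment, Finset.mul_sum, ← Finset.sum_sub_distrib]
  push_cast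
  rw [show i + (s + 1 : ℤ) = i + 1 + s by ring]
  refine Finset.sum_congr rfl fun m _ => ?_
  rw [lax_succ_left]
  ring

theorem colMoment_succ (s : ℕ) (i j : ℤ) :
    colMoment x y (s + 1) i (j + 1) = colMoment x y s i j - y j * cornerMoment x y s i j := by
  rw [colMoment, colMoment, cornerMoment_eq_sum_rowMoment, Finset.mul_sum,
    ← Finset.sum_sub_distrib]
  push_cast
  rw [show j + 1 - (s + 1 : ℤ) = j - s by ring]
  refine Finset.sum_congr rfl fun m _ => ?_
  rw [lax_succ_right]
  ring

theorem rowMoment_zero (k : ℤ) : rowMoment x y 0 k k = x k := by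
  simp [rowMoment, lax_zero]

theorem colMoment_zero (k : ℤ) : colMoment x y 0 (k - 1) k = y (k - 1) := by
  simp [colMoment, lax_zero]

/-! #### Truncation -/

variable {x y} {x' : ℤ → R}

/-- Locality: row `i` of the `s`-th power only involves `x` at the indices `i, …, i + s - 1`. This
is what allows `x` to be truncated far to the right. -/
theorem lax_congr {M : ℤ} (h : ∀ i < M, x' i = x i) (s : ℕ) (i j : ℤ) (hi : i + s ≤ M) :
    lax x' y s i j = lax x y s i j := by
  induction s generalizing i j with
  | zero => rfl
  | succ s ih =>
    push_cast at hi
    rw [lax_succ_left, lax_succ_left, ih (i + 1) j (by omega), h i (by omega), colMoment, colMoment]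
    congr 2
    refine Finset.sum_congr rfl fun m hm => ?_
    rw [Finset.mem_Icc] at hm
    rw [ih m j (by omega)]

theorem rowMoment_congr {M : ℤ} (h : ∀ i < M, x' i = x i) (s : ℕ) (i j : ℤ) (hi : i + s < M) :
    rowMoment x' y s i j = rowMoment x y s i j := by
  refine Finset.sum_congr rfl fun m hm => ?_
  rw [Finset.mem_Icc] at hm
  rw [lax_congr h s i m (by omega), h m (by omega)]

theorem colMoment_congr {M : ℤ} (h : ∀ i < M, x' i = x i) (s : ℕ) (i j : ℤ) (hi : i + s < M) :
    colMoment x' y s i j = colMoment x y s i j := by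
  refine Finset.sum_congr rfl fun m hm => ?_
  rw [Finset.mem_Icc] at hm
  rw [lax_congr h s m j (by omega)]

theorem cornerMoment_congr {M : ℤ} (h : ∀ i < M, x' i = x i) (s : ℕ) (i j : ℤ)
    (hi : i + s + 1 < M) : cornerMoment x' y s i j = cornerMoment x y s i j := by
  refine Finset.sum_congr rfl fun m hm => ?_
  rw [Finset.mem_Icc] at hm
  rw [colMoment_congr h s i m (by omega), h m (by omega)]

theorem lax_of_tail_zero {M : ℤ} (h : ∀ i, M ≤ i → x i = 0) (s : ℕ) (i j : ℤ) (hi : M ≤ i) :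
    lax x y s i j = if i + s = j then 1 else 0 := by
  induction s generalizing i with
  | zero => simp [lax_zero]
  | succ s ih =>
    rw [lax_succ_left, h i hi, ih (i + 1) (by omega)]
    push_cast
    rw [show i + (s + 1 : ℤ) = i + 1 + s by ring]
    simp

theorem rowMoment_of_tail_zero {M : ℤ} (h : ∀ i, M ≤ i → x i = 0) (s : ℕ) (i j : ℤ) (hj : M ≤ j) :
    rowMoment x y s i j = 0 := by
  refine Finset.sum_eq_zero fun m hm => ?_
  rw [Finset.mem_Icc] at hm
  rw [h m (by omega), mul_zero]

theorem cornerMoment_of_tail_zero {M : ℤ} (h : ∀ i, M ≤ i → x i = 0) (s : ℕ) (i j : ℤ)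
    (hj : M ≤ j) : cornerMoment x y s i j = 0 := by
  refine Finset.sum_eq_zero fun m hm => ?_
  rw [Finset.mem_Icc] at hm
  rw [h m (by omega), mul_zero]

variable (x y)

/-- Both corners are one step away from the corner at `(k - 1, k + 1)`, by a row and by a column.
Writing the next power as `L₁^s L₁` and as `L₁ L₁^s` turns these two steps into the change of the
diagonal entry. -/
theorem flux_const (s : ℕ) (k : ℤ) :
    cornerMoment x y s k (k + 1) + lax x y (s + 1) (k + 1) (k + 1) =
      cornerMoment x y s (k - 1) k + lax x y (s + 1) k k := by
  have h1 := cornerMoment_step_left x y s k (k + 1)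
  have h2 := cornerMoment_step_right x y s (k - 1) k
  have h3 := lax_succ_right x y s (k + 1) k
  have h4 := lax_succ_left x y s k k
  have h5 := rowMoment_step x y s (k + 1) k
  have h6 := colMoment_step x y s k k
  linear_combination h1 - h2 + h3 - h4 - y k * h5 + x k * h6

/-- The sequence `x` replaced by zero from the index `M` on. -/
def truncate (M : ℤ) (i : ℤ) : R := if i < M then x i else 0

theorem truncate_of_lt {M i : ℤ} (h : i < M) : truncate x M i = x i := if_pos h

theorem truncate_of_le {M i : ℤ} (h : M ≤ i) : truncate x M i = 0 := if_neg (not_lt.mpr h)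

/-- By `flux_const` the sum of the corner and the diagonal entry does not depend on the bond. It
involves finitely many `x`, so `x` may be truncated; beyond the truncation the corner is zero and
the power is a pure shift of positive degree, with zero diagonal. -/
theorem cornerMoment_bond (s : ℕ) (k : ℤ) :
    cornerMoment x y s (k - 1) k = -lax x y (s + 1) k k := by
  -- `M` exceeds every index of `x` that enters the two terms at the bond `k`.
  set M : ℤ := k + s + 2 with hM
  have hlt : ∀ i < M, truncate x M i = x i := fun i hi => truncate_of_lt x hi
  have hge : ∀ i, M ≤ i → truncate x M i = 0 := fun i hi => truncate_of_le x hi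
  have hconst : ∀ d : ℕ, cornerMoment (truncate x M) y s (k + d - 1) (k + d) +
      lax (truncate x M) y (s + 1) (k + d) (k + d) =
      cornerMoment (truncate x M) y s (k - 1) k + lax (truncate x M) y (s + 1) k k := by
    intro d
    induction d with
    | zero => simp
    | succ d ih =>
      rw [← ih, ← flux_const _ _ s (k + d)]
      push_cast
      simp only [← add_assoc, add_sub_cancel_right]
  have h1 := hconst (s + 2)
  rw [cornerMoment_of_tail_zero hge s _ _ (by push_cast; omega),
    lax_of_tail_zero hge (s + 1) _ _ (by push_cast; omega), if_neg (by push_cast; omega),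
    cornerMoment_congr hlt s _ _ (by omega), lax_congr hlt (s + 1) _ _ (by push_cast; omega)] at h1
  linear_combination -h1

local notation "v" => toeplitzV x y

/-- The left side is what one power of `L₁` contributes to `Γ_k`. The corner produced by the
recursion for row moments is removed by `cornerMoment_bond`, which leaves moments at the bond to the
left of the site only. -/
theorem v_mul_rowMoment (s : ℕ) (k : ℤ) : v k * rowMoment x y s (k + 1) k =
    rowMoment x y (s + 1) k k - x k * lax x y (s + 1) k k := by
  have h1 := rowMoment_succ x y s k k
  have h2 := cornerMoment_step_left x y s k k
  have h3 := cornerMoment_bond x y s k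
  simp only [toeplitzV]
  linear_combination -h1 + x k * h2 + x k * h3

theorem v_mul_colMoment (s : ℕ) (k : ℤ) : v k * colMoment x y s k k =
    colMoment x y s (k - 1) k + y k * lax x y (s + 1) k k := by
  have h1 := colMoment_step x y s k k
  have h2 := lax_succ_left x y s k k
  simp only [toeplitzV]
  linear_combination h1 - y k * h2

theorem v_mul_rowMoment_left (s : ℕ) (k : ℤ) : v (k - 1) * rowMoment x y s k (k - 1) =
    rowMoment x y s k k + x (k - 1) * lax x y (s + 1) k k := by
  have h1 := rowMoment_step x y s k (k - 1)
  have h2 := lax_succ_right x y s k (k - 1)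
  rw [sub_add_cancel] at h1 h2
  simp only [toeplitzV]
  linear_combination h1 - x (k - 1) * h2

theorem v_mul_colMoment_left (s : ℕ) (k : ℤ) :
    v (k - 1) * colMoment x y s (k - 1) (k - 1) =
    colMoment x y (s + 1) (k - 1) k - y (k - 1) * lax x y (s + 1) k k := by
  have h1 := colMoment_succ x y s (k - 1) (k - 1)
  have h2 := cornerMoment_step_right x y s (k - 1) (k - 1)
  have h3 := cornerMoment_bond x y s k
  rw [sub_add_cancel] at h1 h2
  simp only [toeplitzV]
  linear_combination -h1 + y (k - 1) * h2 + y (k - 1) * h3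

theorem v_mul_lax (s : ℕ) (k : ℤ) : v k * lax x y s (k + 1) k =
    lax x y (s + 1) k k + x k * colMoment x y s (k - 1) k := by
  have h1 := v_mul_colMoment x y s k
  have h2 := lax_succ_left x y s k k
  have h3 := colMoment_step x y s k k
  simp only [toeplitzV]
  linear_combination -h2 + x k * h3

theorem v_mul_lax_left (s : ℕ) (k : ℤ) : v (k - 1) * lax x y s k (k - 1) =
    lax x y (s + 1) k k + y (k - 1) * rowMoment x y s k k := by
  have h2 := lax_succ_right x y s k (k - 1)
  have h3 := rowMoment_step x y s k (k - 1)
  rw [sub_add_cancel] at h2 h3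
  simp only [toeplitzV]
  linear_combination -h2 + y (k - 1) * h3

/-! #### Moments at a bond -/

/-- The row moments at the bond between `k - 1` and `k`. -/
noncomputable def bondA (k : ℤ) (s : ℕ) : R := rowMoment x y s k k
/-- The column moments at the bond between `k - 1` and `k`. -/
noncomputable def bondB (k : ℤ) (s : ℕ) : R := colMoment x y s (k - 1) k
/-- The mixed moments at the bond between `k - 1` and `k`. -/
noncomputable def bondD (k : ℤ) (s : ℕ) : R := lax x y s k k

theorem bondA_zero (k : ℤ) : bondA x y k 0 = x k := rowMoment_zero x y k
theorem bondB_zero (k : ℤ) : bondB x y k 0 = y (k - 1) := colMoment_zero x y k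
theorem bondD_zero (k : ℤ) : bondD x y k 0 = 1 := by simp [bondD, lax_zero]
theorem bondB_succ_zero (k : ℤ) : bondB x y (k + 1) 0 = y k := by simp [bondB_zero]

theorem v_mul_bondA_succ (k : ℤ) (s : ℕ) : v k * bondA x y (k + 1) s =
    bondA x y k (s + 1) - 2 * x k * bondD x y k (s + 1) - x k ^ 2 * bondB x y k s := by
  have h1 := v_mul_rowMoment x y s k
  have h2 := rowMoment_step x y s (k + 1) k
  have h3 := v_mul_lax x y s k
  simp only [bondA, bondB, bondD]
  linear_combination h1 - v k * h2 - x k * h3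

theorem v_mul_bondB_succ (k : ℤ) (s : ℕ) : v k * bondB x y (k + 1) (s + 1) =
    bondB x y k s + 2 * y k * bondD x y k (s + 1) - y k ^ 2 * bondA x y k (s + 1) := by
  have h1 := colMoment_succ x y s k k
  have h2 := v_mul_colMoment x y s k
  have h3 := cornerMoment_step_left x y s k k
  have h4 := cornerMoment_bond x y s k
  have h5 := v_mul_rowMoment x y s k
  simp only [bondA, bondB, bondD, add_sub_cancel_right]
  rw [h1, h3, h4]
  simp only [toeplitzV] at *
  linear_combination h2 - y k ^ 2 * h5

theorem v_mul_bondD_succ (k : ℤ) (s : ℕ) : v k * bondD x y (k + 1) (s + 1) =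
    (1 + x k * y k) * bondD x y k (s + 1) + x k * bondB x y k s - y k * bondA x y k (s + 1) := by
  have h1 := lax_succ_right x y s (k + 1) k
  have h3 := v_mul_lax x y s k
  have h5 := v_mul_rowMoment x y s k
  simp only [bondA, bondB, bondD]
  rw [h1]
  simp only [toeplitzV] at *
  linear_combination h3 - y k * h5

theorem v_mul_bondA_pred (k : ℤ) (s : ℕ) : v (k - 1) * bondA x y (k - 1) (s + 1) =
    bondA x y k s + 2 * x (k - 1) * bondD x y k (s + 1) - x (k - 1) ^ 2 * bondB x y k (s + 1) := by
  have h1 := rowMoment_succ x y s (k - 1) (k - 1)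
  have h2 := v_mul_rowMoment_left x y s k
  have h3 := cornerMoment_step_right x y s (k - 1) (k - 1)
  have h4 := cornerMoment_bond x y s k
  have h5 := v_mul_colMoment_left x y s k
  rw [sub_add_cancel] at h1 h3
  simp only [bondA, bondB, bondD]
  rw [h1, h3, h4]
  simp only [toeplitzV] at *
  linear_combination h2 - x (k - 1) ^ 2 * h5

theorem v_mul_bondB_pred (k : ℤ) (s : ℕ) : v (k - 1) * bondB x y (k - 1) s =
    bondB x y k (s + 1) - 2 * y (k - 1) * bondD x y k (s + 1) -
      y (k - 1) ^ 2 * bondA x y k s := by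
  have h1 := colMoment_step x y s (k - 1) (k - 1)
  have h2 := v_mul_lax_left x y s k
  have h5 := v_mul_colMoment_left x y s k
  rw [sub_add_cancel] at h1
  simp only [bondA, bondB, bondD]
  linear_combination -v (k - 1) * h1 + h5 - y (k - 1) * h2

/-! #### The quadratic relation -/

open PowerSeries in
/-- The failure of the quadratic relation between the generating functions of the moments. -/
noncomputable def bondQuad (k : ℤ) : R⟦X⟧ :=
  mk (bondD x y k) ^ 2 - mk (bondD x y k) + X * mk (bondA x y k) * mk (bondB x y k)

-- The matrix with rows `(D, A)` and `(X B, 1 - D)` has determinant `-bondQuad`. Crossing the site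
-- `k` conjugates it by the matrix with rows `(1, x k)` and `(y k, 1)`, of determinant `v k`, and
-- moves the factor `X` from `B` to `A`; the determinant is unchanged. The factors `C (v k) ^ 2` and
-- `X` clear denominators.
open PowerSeries in
theorem bondQuad_succ (k : ℤ) :
    C (v k) ^ 2 * X * bondQuad x y (k + 1) = C (v k) ^ 2 * X * bondQuad x y k := by
  have hA : C (v k) * (X * mk (bondA x y (k + 1))) = mk (bondA x y k) -
      C (x k) * (2 * mk (bondD x y k) - 1) - C (x k) ^ 2 * (X * mk (bondB x y k)) := by
    have e : (2 : R⟦X⟧) = C (2 : R) := (map_ofNat C 2).symm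
    ext s
    rw [e, ← map_pow]
    cases s with
    | zero =>
      simp only [map_sub, coeff_C_mul, coeff_zero_X_mul, coeff_mk, bondA_zero,
        bondD_zero, coeff_zero_one]
      ring
    | succ s =>
      simp only [mul_sub, map_sub, coeff_C_mul, coeff_succ_X_mul, coeff_mk, coeff_one,
        v_mul_bondA_succ]
      simp
      ring
  have hB : C (v k) * mk (bondB x y (k + 1)) = X * mk (bondB x y k) +
      C (y k) * (2 * mk (bondD x y k) - 1) - C (y k) ^ 2 * mk (bondA x y k) := by
    have e : (2 : R⟦X⟧) = C (2 : R) := (map_ofNat C 2).symm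
    ext s
    rw [e, ← map_pow]
    cases s with
    | zero =>
      simp only [map_sub, map_add, coeff_C_mul, coeff_zero_X_mul, coeff_mk, bondA_zero,
        bondD_zero, coeff_zero_one, bondB_succ_zero]
      rw [toeplitzV]
      ring
    | succ s =>
      simp only [mul_sub, map_sub, map_add, coeff_C_mul, coeff_succ_X_mul, coeff_mk, coeff_one,
        v_mul_bondB_succ]
      simp
      ring
  have hD : C (v k) * mk (bondD x y (k + 1)) = C (1 + x k * y k) * mk (bondD x y k) +
      C (x k) * (X * mk (bondB x y k)) - C (y k) * mk (bondA x y k) - C (x k * y k) := by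
    ext s
    cases s with
    | zero =>
      rw [map_sub, map_sub, map_add]
      simp only [coeff_C_mul, coeff_zero_X_mul, coeff_mk, bondA_zero,
        bondD_zero, coeff_zero_C]
      rw [toeplitzV]
      ring
    | succ s =>
      rw [map_sub, map_sub, map_add]
      simp only [coeff_C_mul, coeff_succ_X_mul, coeff_mk, coeff_C, v_mul_bondD_succ]
      simp
  have hv : C (v k) = 1 - C (x k) * C (y k) := by simp [toeplitzV]
  simp only [map_add, map_mul, map_one] at hD
  simp only [bondQuad]
  set D := mk (bondD x y k)
  set A := mk (bondA x y k)
  set B := mk (bondB x y k)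
  set D' := mk (bondD x y (k + 1))
  set A' := mk (bondA x y (k + 1))
  set B' := mk (bondB x y (k + 1))
  have e : C (v k) ^ 2 * X * (D' ^ 2 - D' + X * A' * B') =
      X * ((C (v k) * D') ^ 2 - C (v k) * (C (v k) * D') +
        (C (v k) * (X * A')) * (C (v k) * B')) := by ring
  rw [e, hA, hB, hD, hv]
  ring

theorem bondA_congr {M : ℤ} {x' : ℤ → R} (h : ∀ i < M, x' i = x i) (k : ℤ) (s : ℕ)
    (hk : k + s < M) : bondA x' y k s = bondA x y k s := rowMoment_congr h s k k hk

theorem bondB_congr {M : ℤ} {x' : ℤ → R} (h : ∀ i < M, x' i = x i) (k : ℤ) (s : ℕ)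
    (hk : k + s < M) : bondB x' y k s = bondB x y k s := colMoment_congr h s _ k (by omega)

theorem bondD_congr {M : ℤ} {x' : ℤ → R} (h : ∀ i < M, x' i = x i) (k : ℤ) (s : ℕ)
    (hk : k + s < M) : bondD x' y k s = bondD x y k s := lax_congr h s k k hk.le

-- The same argument as for `cornerMoment_bond`: the quantity is independent of the bond, each of
-- its coefficients involves finitely many `x`, and to the right of a truncation `A = 0` and `D =
-- 1`.
open PowerSeries in
theorem bondQuad_eq_zero [IsDomain R] (hv : ∀ k, v k ≠ 0) (k : ℤ) : bondQuad x y k = 0 := by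
  ext s
  set M : ℤ := k + s + 1 with hM
  have hlt : ∀ i < M, truncate x M i = x i := fun i hi => truncate_of_lt x hi
  have hge : ∀ i, M ≤ i → truncate x M i = 0 := fun i hi => truncate_of_le x hi
  have hv' : ∀ k, toeplitzV (truncate x M) y k ≠ 0 := by
    intro j
    by_cases hj : j < M
    · rw [toeplitzV, hlt j hj]; exact hv j
    · rw [toeplitzV, hge j (by omega)]; simp
  have hconst : ∀ d : ℕ, bondQuad (truncate x M) y (k + d) = bondQuad (truncate x M) y k := by
    intro d
    induction d with
    | zero => simp
    | succ d ih =>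
      have hne : C (toeplitzV (truncate x M) y (k + d)) ^ 2 * X ≠ 0 :=
        mul_ne_zero (pow_ne_zero _ (by
          rw [Ne, map_eq_zero_iff _ C_injective]; exact hv' _)) X_ne_zero
      rw [← ih, ← mul_left_cancel₀ hne (bondQuad_succ (truncate x M) y (k + d))]
      push_cast
      rw [add_assoc]
  have hfar : bondQuad (truncate x M) y k = 0 := by
    rw [← hconst (s + 1)]
    have hk : M ≤ k + (s + 1 : ℕ) := by push_cast; omega
    have e1 : (mk (bondA (truncate x M) y (k + (s + 1 : ℕ))) : R⟦X⟧) = 0 := by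
      ext i
      rw [coeff_mk, bondA, rowMoment_of_tail_zero hge i _ _ hk, map_zero]
    have e2 : (mk (bondD (truncate x M) y (k + (s + 1 : ℕ))) : R⟦X⟧) = 1 := by
      ext i
      rw [coeff_mk, bondD, lax_of_tail_zero hge i _ _ hk, coeff_one]
      simp
    rw [bondQuad, e1, e2]
    ring
  rw [← hfar]
  simp only [bondQuad, map_add, map_sub, pow_two, coeff_mul, coeff_mk, mul_assoc]
  congr 1
  · congr 1
    · refine Finset.sum_congr rfl fun p hp => ?_
      rw [Finset.HasAntidiagonal.mem_antidiagonal] at hp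
      rw [bondD_congr x y hlt _ _ (by omega), bondD_congr x y hlt _ _ (by omega)]
    · rw [bondD_congr x y hlt _ _ (by omega)]
  · cases s with
    | zero => simp
    | succ s =>
      refine Finset.sum_congr rfl fun p hp => ?_
      rw [Finset.HasAntidiagonal.mem_antidiagonal] at hp
      congr 1
      refine Finset.sum_congr rfl fun q hq => ?_
      rw [Finset.HasAntidiagonal.mem_antidiagonal] at hq
      rw [bondA_congr x y hlt _ _ (by omega), bondB_congr x y hlt _ _ (by omega)]

/-- The solution `d` of the quadratic relation `d² - d + z a b = 0` with constant term `1`. -/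
noncomputable def quadD (a b : ℕ → R) : ℕ → R
  | 0 => 1
  | s + 1 => -∑ i : Fin (s + 1), a i * b (s - i) -
      ∑ i : Fin s, quadD a b (i + 1) * quadD a b (s - i)
  termination_by s => s
  decreasing_by all_goals omega

theorem quadD_zero (a b : ℕ → R) : quadD a b 0 = 1 := by rw [quadD]

theorem quadD_succ (a b : ℕ → R) (s : ℕ) : quadD a b (s + 1) =
    -∑ i ∈ Finset.range (s + 1), a i * b (s - i) -
      ∑ i ∈ Finset.range s, quadD a b (i + 1) * quadD a b (s - i) := by
  rw [quadD, Finset.sum_range, Finset.sum_range]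

theorem quadD_congr {a b a' b' : ℕ → R} {n : ℕ} (ha : ∀ i < n, a i = a' i)
    (hb : ∀ i < n, b i = b' i) : ∀ s ≤ n, quadD a b s = quadD a' b' s := by
  intro s
  induction s using Nat.strong_induction_on with
  | _ s ih =>
    intro hs
    cases s with
    | zero => rw [quadD_zero, quadD_zero]
    | succ s =>
      rw [quadD_succ, quadD_succ]
      congr 1
      · congr 1
        refine Finset.sum_congr rfl fun i hi => ?_
        rw [Finset.mem_range] at hi
        rw [ha i (by omega), hb (s - i) (by omega)]
      · refine Finset.sum_congr rfl fun i hi => ?_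
        rw [Finset.mem_range] at hi
        rw [ih (i + 1) (by omega) (by omega), ih (s - i) (by omega) (by omega)]

theorem map_quadD {S G : Type*} [CommRing S] [FunLike G R S] [RingHomClass G R S] (f : G)
    (a b : ℕ → R) (s : ℕ) :
    f (quadD a b s) = quadD (fun i => f (a i)) (fun i => f (b i)) s := by
  induction s using Nat.strong_induction_on with
  | _ s ih =>
    cases s with
    | zero => rw [quadD_zero, quadD_zero, map_one]
    | succ s =>
      rw [quadD_succ, quadD_succ, map_sub, map_neg, map_sum, map_sum]
      congr 1
      · simp
      · refine Finset.sum_congr rfl fun i hi => ?_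
        rw [Finset.mem_range] at hi
        rw [map_mul, ih (i + 1) (by omega), ih (s - i) (by omega)]

-- In the coefficient of `X^(s+1)` of the quadratic relation, the square contributes `2 d_{s+1}`
-- because `d_0 = 1`, and the linear term `-d_{s+1}`. Hence the relation can be solved recursively.
open PowerSeries in
theorem bondD_eq_quadD [IsDomain R] (hv : ∀ k, v k ≠ 0) (k : ℤ) (s : ℕ) :
    bondD x y k s = quadD (bondA x y k) (bondB x y k) s := by
  induction s using Nat.strong_induction_on with
  | _ s ih =>
    cases s with
    | zero => rw [quadD_zero, bondD_zero]
    | succ s =>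
      have h := congrArg (coeff (s + 1)) (bondQuad_eq_zero x y hv k)
      rw [bondQuad, map_add, map_sub, pow_two, mul_assoc X, coeff_succ_X_mul, map_zero] at h
      simp only [coeff_mul, coeff_mk, Finset.Nat.sum_antidiagonal_eq_sum_range_succ_mk] at h
      rw [Finset.sum_range_succ, Finset.sum_range_succ'] at h
      simp only [bondD_zero, Nat.sub_self, Nat.sub_zero, Nat.add_sub_add_right] at h
      rw [quadD_succ]
      have e : ∑ i ∈ Finset.range s, bondD x y k (i + 1) * bondD x y k (s - i) =
          ∑ i ∈ Finset.range s, quadD (bondA x y k) (bondB x y k) (i + 1) *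
            quadD (bondA x y k) (bondB x y k) (s - i) := by
        refine Finset.sum_congr rfl fun i hi => ?_
        rw [Finset.mem_range] at hi
        rw [ih (i + 1) (by omega), ih (s - i) (by omega)]
      rw [e] at h
      linear_combination h

/-! #### Reflection -/

/-- The sequence read from right to left. -/
def refl (x : ℤ → R) (k : ℤ) : R := x (-k)

theorem biPow_reindex (A : ℤ → ℤ → R) (s : ℕ) (i j : ℤ) :
    biPow (fun i j => A (1 - i) (1 - j)) s i j = biPow A s (1 - i) (1 - j) := by
  induction s generalizing i j with
  | zero => simp [biPow]
  | succ s ih =>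
    simp only [biPow, biMul, ih]
    exact finsum_comp_equiv (Equiv.subLeft (1 : ℤ)) (f := fun m => biPow A s (1 - i) m * A m (1 - j))

/-- Reading the lattice backwards and exchanging `x` and `y` transposes `L₁`, up to the reindexing
`i ↦ 1 - i`. Sites go to `-k`, whereas the bond numbered `k` goes to the one numbered `1 - k`.
Statements about rows thereby yield statements about columns. -/
theorem lax_refl (s : ℕ) (i j : ℤ) : lax (refl y) (refl x) s i j = lax x y s (1 - j) (1 - i) := by
  have h : toeplitzL1 (refl y) (refl x) =
      fun i j => (fun i j => toeplitzL1 x y j i) (1 - i) (1 - j) := by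
    funext i j
    simp only [toeplitzL1, refl]
    rw [show -(j - 1) = 1 - j by ring, show 1 - i - 1 = -i by ring]
    have e1 : (1 - i ≤ 1 - j + 1) ↔ (j ≤ i + 1) := by omega
    have e2 : (1 - j + 1 = 1 - i) ↔ (i + 1 = j) := by omega
    simp only [e1, e2, mul_comm]
  rw [lax, h, biPow_reindex (fun i j => toeplitzL1 x y j i),
    biPow_transpose (toeplitzL1_eq_zero x y), lax]

theorem rowMoment_refl (s : ℕ) (i j : ℤ) :
    rowMoment (refl y) (refl x) s i j = colMoment x y s (-j) (1 - i) := by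
  simp only [rowMoment, colMoment]
  refine Finset.sum_nbij' (fun m => 1 - m) (fun m => 1 - m) ?_ ?_ ?_ ?_ ?_
  · intro m; simp only [Finset.mem_Icc]; omega
  · intro m; simp only [Finset.mem_Icc]; omega
  · intro m _; ring
  · intro m _; ring
  · intro m _
    rw [lax_refl, refl, mul_comm, show 1 - m - 1 = -m by ring]

theorem colMoment_refl (s : ℕ) (i j : ℤ) :
    colMoment (refl y) (refl x) s i j = rowMoment x y s (1 - j) (-i) := by
  have h := rowMoment_refl (refl y) (refl x) s (1 - j) (-i)
  simp only [neg_neg, sub_sub_cancel] at h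
  rw [← h]
  congr 1 <;> funext k <;> simp [refl]

theorem bondA_refl (k : ℤ) (s : ℕ) : bondA (refl y) (refl x) k s = bondB x y (1 - k) s := by
  rw [bondA, rowMoment_refl, bondB]
  congr 1; ring

theorem bondD_refl (k : ℤ) (s : ℕ) : bondD (refl y) (refl x) k s = bondD x y (1 - k) s := by
  rw [bondD, lax_refl, bondD]

theorem toeplitzV_swap (k : ℤ) : toeplitzV y x k = toeplitzV x y k := by
  rw [toeplitzV, toeplitzV, mul_comm]

end Algebra

/-! ### The first Toeplitz flow, moments, and the linearised flow -/

section Flow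

variable {R : Type*} [CommRing R] {x y : ℤ → R} {δ : Derivation ℤ R R}

/-- The first Toeplitz flow with respect to a derivation, at the site `k`. -/
def FlowAt (δ : Derivation ℤ R R) (x y : ℤ → R) (k : ℤ) : Prop :=
  δ (x k) = toeplitzV x y k * (x (k + 1) - x (k - 1)) ∧
    δ (y k) = toeplitzV x y k * (y (k + 1) - y (k - 1))

theorem FlowAt.swap {k : ℤ} (h : FlowAt δ x y k) : FlowAt δ y x k := by
  rw [FlowAt, toeplitzV_swap]
  exact ⟨h.2, h.1⟩

theorem toeplitzV_refl (k : ℤ) : toeplitzV (refl y) (refl x) k = toeplitzV x y (-k) := by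
  simp only [toeplitzV, refl]; ring

theorem FlowAt.refl {k : ℤ} (h : FlowAt δ x y (-k)) : FlowAt (-δ) (refl y) (refl x) k := by
  rw [FlowAt, toeplitzV_refl]
  simp only [ToeplitzFlow.refl, Derivation.neg_apply]
  rw [h.1, h.2, show -(k + 1) = -k - 1 by ring, show -(k - 1) = -k + 1 by ring]
  constructor <;> ring

theorem downward_induction {p : ℤ → Prop} (M : ℤ) (h0 : ∀ j, M < j → p j)
    (hs : ∀ j, p (j + 1) → p j) : ∀ j, p j := by
  intro j
  have key : ∀ (d : ℕ) (j : ℤ), M - j < d → p j := by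
    intro d
    induction d with
    | zero => intro j hj; exact h0 j (by push_cast at hj; omega)
    | succ d ih => intro j hj; exact hs j (ih (j + 1) (by push_cast at hj; omega))
  exact key (M - j + 1).toNat j (by omega)

/-- Induction on the column from the far right, where all terms vanish. Only the derivative of one
row of one power is assumed, since this feeds the induction step of `deriv_lax`. -/
theorem deriv_rowMoment_of_deriv_lax (hf : ∀ k, FlowAt δ x y k) (s : ℕ) (i : ℤ)
    (hP : ∀ j, δ (lax x y s i j) = toeplitzV x y i * lax x y s (i + 1) j +
      x (i - 1) * y i * lax x y s i j - lax x y s (i - 1) j -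
      toeplitzV x y (j - 1) * lax x y s i (j - 1) - x (j - 1) * y j * lax x y s i j +
      lax x y s i (j + 1)) (j : ℤ) :
    δ (rowMoment x y s i j) = toeplitzV x y i * rowMoment x y s (i + 1) j +
      x (i - 1) * y i * rowMoment x y s i j - rowMoment x y s (i - 1) j -
      lax x y s i j * x (j - 1) - toeplitzV x y (j - 1) * lax x y s i (j - 1) * x j := by
  revert j
  refine downward_induction (i + 1 + s) (fun j hj => ?_) (fun j ih => ?_)
  · rw [rowMoment_eq_zero x y (by omega), rowMoment_eq_zero x y (by omega),
      rowMoment_eq_zero x y (by omega), lax_eq_zero x y (by omega), lax_eq_zero x y (by omega)]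
    simp
  · have h1 := rowMoment_step x y s i j
    have h2 := rowMoment_step x y s (i + 1) j
    have h3 := rowMoment_step x y s (i - 1) j
    rw [add_sub_cancel_right] at ih
    rw [h1, map_add, Derivation.leibniz, ih, hP, (hf j).1, smul_eq_mul, smul_eq_mul, h2, h3]
    simp only [toeplitzV]
    ring

/-- The Lax equation `δ(L^s) = M L^s - L^s M`, where row `i` of the tridiagonal matrix `M` has the
entries `-1`, `x (i-1) * y i`, `v i`. The next power involves a row moment (`lax_succ_right`), whose
derivative has to be carried along. -/
theorem deriv_lax (hf : ∀ k, FlowAt δ x y k) (s : ℕ) (i j : ℤ) :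
    δ (lax x y s i j) = toeplitzV x y i * lax x y s (i + 1) j +
      x (i - 1) * y i * lax x y s i j - lax x y s (i - 1) j -
      toeplitzV x y (j - 1) * lax x y s i (j - 1) - x (j - 1) * y j * lax x y s i j +
      lax x y s i (j + 1) := by
  induction s generalizing i j with
  | zero =>
    simp only [lax_zero]
    have h0 : δ (if i = j then 1 else 0) = 0 := by split_ifs <;> simp
    rw [h0]
    rcases eq_or_ne i j with h | h
    · subst h
      rw [if_neg (by omega : ¬i + 1 = i), if_neg (by omega : ¬i - 1 = i),
        if_neg (by omega : ¬i = i - 1), if_neg (by omega : ¬i = i + 1)]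
      ring
    · have e1 : (i = j - 1) ↔ (i + 1 = j) := by omega
      have e2 : (i = j + 1) ↔ (i - 1 = j) := by omega
      simp only [e1, e2, h, if_false]
      split_ifs with h1 h2 h2
      · omega
      · rw [show j - 1 = i by omega]; ring
      · ring
      · ring
  | succ s ih =>
    obtain ⟨j, rfl⟩ : ∃ j', j = j' + 1 := ⟨j - 1, by ring⟩
    have hA := deriv_rowMoment_of_deriv_lax hf s i (fun j => ih i j) j
    rw [lax_succ_right, map_sub, Derivation.leibniz, ih, hA, (hf j).2, lax_succ_right,
      lax_succ_right, lax_succ_right, add_sub_cancel_right]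
    have h1 := lax_succ_right x y s i (j - 1)
    rw [sub_add_cancel] at h1
    have h2 := rowMoment_step x y s i (j - 1)
    rw [sub_add_cancel] at h2
    have h3 := rowMoment_step x y s i j
    rw [h1, h2, h3, smul_eq_mul, smul_eq_mul]
    simp only [toeplitzV]
    ring

theorem deriv_rowMoment (hf : ∀ k, FlowAt δ x y k) (s : ℕ) (i j : ℤ) :
    δ (rowMoment x y s i j) = toeplitzV x y i * rowMoment x y s (i + 1) j +
      x (i - 1) * y i * rowMoment x y s i j - rowMoment x y s (i - 1) j -
      lax x y s i j * x (j - 1) - toeplitzV x y (j - 1) * lax x y s i (j - 1) * x j :=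
  deriv_rowMoment_of_deriv_lax hf s i (deriv_lax hf s i) j

/-- The polynomial in the moments that gives the derivative of the `a`-moments. -/
def momentField (xk yk xp yp : R) (a d : ℕ → R) : ℕ → R
  | 0 => a 1 - 2 * xk * d 1 + (xp * yk - xk * yp) * a 0 - xp * d 0
  | s + 1 => a (s + 2) - 2 * xk * d (s + 2) + (xp * yk - xk * yp) * a (s + 1) - xp * d (s + 1) -
      (a s + xp * d (s + 1))

/-- The Lax equation involves moments off the bond; the crossing relations for the two adjacent
sites bring them back. What remains involves this bond only, with the order raised by at most one.
In order zero the term coming from row `k - 1` is absent. -/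
theorem deriv_bondA (hf : ∀ k, FlowAt δ x y k) (k : ℤ) (s : ℕ) : δ (bondA x y k s) =
    momentField (x k) (y k) (x (k - 1)) (y (k - 1)) (bondA x y k) (bondD x y k) s := by
  have h0 := deriv_rowMoment hf s k k
  have h1 := v_mul_rowMoment x y s k
  have h2 := v_mul_lax_left x y s k
  cases s with
  | zero =>
    have h3 : rowMoment x y 0 (k - 1) k = 0 := rowMoment_eq_zero x y (by simp)
    simp only [bondA, momentField, bondD]
    linear_combination h0 + h1 - x k * h2 - h3
  | succ s =>
    have h3 := rowMoment_succ x y s (k - 1) k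
    have h4 := cornerMoment_bond x y s k
    rw [sub_add_cancel] at h3
    simp only [bondA, momentField, bondD]
    linear_combination h0 + h1 - x k * h2 - h3 + x (k - 1) * h4

theorem deriv_bondB (hf : ∀ k, FlowAt δ x y k) (k : ℤ) (s : ℕ) : δ (bondB x y k s) =
    -momentField (y (k - 1)) (x (k - 1)) (y k) (x k) (bondB x y k) (bondD x y k) s := by
  have h := deriv_bondA (δ := -δ) (x := refl y) (y := refl x) (fun k => (hf (-k)).refl) (1 - k) s
  have e1 : bondA (refl y) (refl x) (1 - k) = bondB x y k := by
    funext i; rw [bondA_refl, sub_sub_cancel]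
  have e2 : bondD (refl y) (refl x) (1 - k) = bondD x y k := by
    funext i; rw [bondD_refl, sub_sub_cancel]
  rw [e1, e2] at h
  simp only [refl, Derivation.neg_apply, neg_sub, sub_sub_cancel] at h
  rw [← h, neg_neg]

theorem deriv_bondD_succ (hf : ∀ k, FlowAt δ x y k) (k : ℤ) (s : ℕ) : δ (bondD x y k (s + 1)) =
    x k * bondB x y k (s + 1) - y (k - 1) * bondA x y k (s + 1) - y k * bondA x y k s +
      x (k - 1) * bondB x y k s := by
  have h0 := deriv_lax hf (s + 1) k k
  have h1 := v_mul_lax x y (s + 1) k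
  have h2 := v_mul_lax_left x y (s + 1) k
  have h3 := lax_succ_left x y s (k - 1) k
  have h4 := lax_succ_right x y s k k
  rw [sub_add_cancel] at h3
  simp only [bondA, bondB, bondD]
  linear_combination h0 + h1 - h2 - h3 + h4

/-! #### The linear system satisfied by the recursion polynomials -/

/-- The linearised Toeplitz flow. -/
def LinAt (δ : Derivation ℤ R R) (x y X Y : ℤ → R) (k : ℤ) : Prop :=
  δ (X k) = toeplitzV x y k * (X (k + 1) - X (k - 1)) -
      (y k * X k + x k * Y k) * (x (k + 1) - x (k - 1)) ∧
    δ (Y k) = toeplitzV x y k * (Y (k + 1) - Y (k - 1)) -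
      (y k * X k + x k * Y k) * (y (k + 1) - y (k - 1))

/-- The contribution of one power of `L₁` to `Γ`. -/
noncomputable def gammaPart (x y : ℤ → R) (s : ℕ) (k : ℤ) : R :=
  toeplitzV x y k * rowMoment x y s (k + 1) k

/-- The contribution of one power of `L₁` to `Γ̃`. -/
noncomputable def gammaTildePart (x y : ℤ → R) (s : ℕ) (k : ℤ) : R :=
  toeplitzV x y k * colMoment x y s k k

theorem gammaPart_eq (s : ℕ) (k : ℤ) : gammaPart x y s k =
    bondA x y k (s + 1) - x k * bondD x y k (s + 1) := v_mul_rowMoment x y s k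

theorem gammaPart_pred (s : ℕ) (k : ℤ) : gammaPart x y s (k - 1) =
    bondA x y k s + x (k - 1) * bondD x y k (s + 1) := by
  rw [gammaPart, sub_add_cancel]
  exact v_mul_rowMoment_left x y s k

theorem gammaTildePart_eq (s : ℕ) (k : ℤ) : gammaTildePart x y s k =
    bondB x y k s + y k * bondD x y k (s + 1) := v_mul_colMoment x y s k

theorem gammaTildePart_pred (s : ℕ) (k : ℤ) : gammaTildePart x y s (k - 1) =
    bondB x y k (s + 1) - y (k - 1) * bondD x y k (s + 1) := v_mul_colMoment_left x y s k

theorem deriv_gammaPart (hf : ∀ k, FlowAt δ x y k) (s : ℕ) (k : ℤ) :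
    δ (gammaPart x y s k) =
      toeplitzV x y k * (gammaPart x y s (k + 1) - gammaPart x y s (k - 1)) -
      (y k * gammaPart x y s k - x k * gammaTildePart x y s k) * (x (k + 1) - x (k - 1)) := by
  have hA := deriv_bondA hf k (s + 1)
  have hD := deriv_bondD_succ hf k s
  have h1 := v_mul_bondA_succ x y k (s + 1)
  have h2 := v_mul_bondD_succ x y k s
  rw [gammaPart_eq, gammaPart_eq, gammaPart_pred, gammaTildePart_eq, map_sub, Derivation.leibniz,
    smul_eq_mul, smul_eq_mul, hA, hD, (hf k).1]
  simp only [momentField, toeplitzV] at h1 h2 ⊢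
  linear_combination -h1 + x (k + 1) * h2

theorem gammaPart_refl (s : ℕ) (k : ℤ) :
    gammaPart (refl y) (refl x) s k = gammaTildePart x y s (-k) := by
  rw [gammaPart, gammaTildePart, toeplitzV_refl, rowMoment_refl]
  congr 2; ring

theorem gammaTildePart_refl (s : ℕ) (k : ℤ) :
    gammaTildePart (refl y) (refl x) s k = gammaPart x y s (-k) := by
  rw [gammaPart, gammaTildePart, toeplitzV_refl, colMoment_refl]
  congr 2; ring

theorem deriv_gammaTildePart (hf : ∀ k, FlowAt δ x y k) (s : ℕ) (k : ℤ) :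
    δ (gammaTildePart x y s k) =
      toeplitzV x y k * (gammaTildePart x y s (k + 1) - gammaTildePart x y s (k - 1)) +
      (y k * gammaPart x y s k - x k * gammaTildePart x y s k) * (y (k + 1) - y (k - 1)) := by
  have h := deriv_gammaPart (δ := -δ) (x := refl y) (y := refl x) (fun k => (hf (-k)).refl) s (-k)
  simp only [gammaPart_refl, gammaTildePart_refl, toeplitzV_refl, refl, neg_neg,
    Derivation.neg_apply] at h
  rw [show -(-k + 1) = k - 1 by ring, show -(-k - 1) = k + 1 by ring] at h
  linear_combination -h

theorem toeplitzGamma_eq (N : ℕ) (u : ℤ → R) (k : ℤ) : toeplitzGamma N u x y k =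
    ∑ s ∈ Finset.range N, (u (s + 1) * gammaPart x y s k +
      u (-(s + 1)) * gammaTildePart y x s k) + k * x k := by
  simp only [toeplitzGamma, biPow_toeplitzL2, gammaPart, gammaTildePart, rowMoment, colMoment, lax,
    Finset.mul_sum (s := Finset.range N), toeplitzV_swap (x := x) (y := y)]
  congr 1
  refine Finset.sum_congr rfl fun s _ => ?_
  simp only [mul_comm (x _)]
  ring

theorem toeplitzGammaTilde_eq (N : ℕ) (u : ℤ → R) (k : ℤ) : toeplitzGammaTilde N u x y k =
    ∑ s ∈ Finset.range N, (u (s + 1) * gammaTildePart x y s k +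
      u (-(s + 1)) * gammaPart y x s k) + k * y k := by
  simp only [toeplitzGammaTilde, biPow_toeplitzL2, gammaPart, gammaTildePart, rowMoment, colMoment,
    lax, Finset.mul_sum (s := Finset.range N), toeplitzV_swap (x := x) (y := y)]
  congr 1
  refine Finset.sum_congr rfl fun s _ => ?_
  simp only [mul_comm (y _)]
  ring

theorem sum_deriv_coeff {N : ℕ} (hN : 0 < N) {u : ℤ → R}
    (hu : ∀ i, δ (u i) = if i = 1 ∨ i = -1 then 1 else 0) (f g : ℕ → R) :
    ∑ s ∈ Finset.range N, (f s * δ (u (s + 1)) + g s * δ (u (-(s + 1)))) = f 0 + g 0 := by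
  rw [Finset.sum_eq_single_of_mem 0 (Finset.mem_range.mpr hN)]
  · simp [hu]
  · intro s _ hs
    rw [hu, hu, if_neg (by omega), if_neg (by omega)]
    simp

/-- Each power of `L₁` and `L₂` contributes a solution of the linearised flow. The term `k x_k` does
not: it misses `v_k (x_{k+1} + x_{k-1})`. This is supplied by the explicit time dependence of `u_1 +
t` and `u_{-1} + t`, whose derivative picks out the parts with `s = 0`. The argument for `k y_k` is
the same. -/
theorem linAt_gamma {N : ℕ} (hN : 0 < N) {u : ℤ → R}
    (hu : ∀ i, δ (u i) = if i = 1 ∨ i = -1 then 1 else 0) (hf : ∀ k, FlowAt δ x y k) (k : ℤ) :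
    LinAt δ x y (toeplitzGamma N u x y) (fun k => -toeplitzGammaTilde N u x y k) k := by
  have hf' : ∀ k, FlowAt δ y x k := fun k => (hf k).swap
  have hr0 : ∀ (x y : ℤ → R), gammaPart x y 0 k = toeplitzV x y k * x (k + 1) := by
    intro x y
    rw [gammaPart, rowMoment_step, lax_zero, if_neg (by omega), rowMoment_zero]
    ring
  have hc0 : ∀ (x y : ℤ → R), gammaTildePart x y 0 k = toeplitzV x y k * y (k - 1) := by
    intro x y
    rw [gammaTildePart, colMoment_step, lax_zero, if_neg (by omega), colMoment_zero]
    ring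
  constructor
  · have hs := sum_deriv_coeff hN hu (fun s => gammaPart x y s k) (fun s => gammaTildePart y x s k)
    have e : ∑ s ∈ Finset.range N, δ (u (s + 1) * gammaPart x y s k +
          u (-(s + 1)) * gammaTildePart y x s k) =
        ∑ s ∈ Finset.range N, (gammaPart x y s k * δ (u (s + 1)) +
          gammaTildePart y x s k * δ (u (-(s + 1)))) +
        (toeplitzV x y k * (∑ s ∈ Finset.range N, (u (s + 1) * gammaPart x y s (k + 1) +
            u (-(s + 1)) * gammaTildePart y x s (k + 1)) -
          ∑ s ∈ Finset.range N, (u (s + 1) * gammaPart x y s (k - 1) +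
            u (-(s + 1)) * gammaTildePart y x s (k - 1))) -
        (y k * ∑ s ∈ Finset.range N, (u (s + 1) * gammaPart x y s k +
            u (-(s + 1)) * gammaTildePart y x s k) -
          x k * ∑ s ∈ Finset.range N, (u (s + 1) * gammaTildePart x y s k +
            u (-(s + 1)) * gammaPart y x s k)) * (x (k + 1) - x (k - 1))) := by
      simp only [Finset.mul_sum, Finset.sum_mul, ← Finset.sum_sub_distrib, ← Finset.sum_add_distrib]
      refine Finset.sum_congr rfl fun s _ => ?_
      rw [map_add, Derivation.leibniz, Derivation.leibniz, deriv_gammaPart hf,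
        deriv_gammaTildePart hf', toeplitzV_swap]
      simp only [smul_eq_mul]
      ring
    have hk : δ (k * x k) = k * δ (x k) := by
      rw [Derivation.leibniz, Derivation.map_intCast]; simp
    simp only [toeplitzGamma_eq, toeplitzGammaTilde_eq]
    rw [map_add, map_sum, e, hs, hr0, hc0, hk, (hf k).1, toeplitzV_swap (x := x) (y := y)]
    push_cast
    ring
  · have hs := sum_deriv_coeff hN hu (fun s => gammaTildePart x y s k) (fun s => gammaPart y x s k)
    have e : ∑ s ∈ Finset.range N, δ (u (s + 1) * gammaTildePart x y s k +
          u (-(s + 1)) * gammaPart y x s k) =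
        ∑ s ∈ Finset.range N, (gammaTildePart x y s k * δ (u (s + 1)) +
          gammaPart y x s k * δ (u (-(s + 1)))) +
        (toeplitzV x y k * (∑ s ∈ Finset.range N, (u (s + 1) * gammaTildePart x y s (k + 1) +
            u (-(s + 1)) * gammaPart y x s (k + 1)) -
          ∑ s ∈ Finset.range N, (u (s + 1) * gammaTildePart x y s (k - 1) +
            u (-(s + 1)) * gammaPart y x s (k - 1))) +
        (y k * ∑ s ∈ Finset.range N, (u (s + 1) * gammaPart x y s k +
            u (-(s + 1)) * gammaTildePart y x s k) -
          x k * ∑ s ∈ Finset.range N, (u (s + 1) * gammaTildePart x y s k +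
            u (-(s + 1)) * gammaPart y x s k)) * (y (k + 1) - y (k - 1))) := by
      simp only [Finset.mul_sum, Finset.sum_mul, ← Finset.sum_sub_distrib, ← Finset.sum_add_distrib]
      refine Finset.sum_congr rfl fun s _ => ?_
      rw [map_add, Derivation.leibniz, Derivation.leibniz, deriv_gammaPart hf',
        deriv_gammaTildePart hf, toeplitzV_swap (x := x) (y := y)]
      simp only [smul_eq_mul]
      ring
    have hk : δ (k * y k) = k * δ (y k) := by
      rw [Derivation.leibniz, Derivation.map_intCast]; simp
    simp only [toeplitzGamma_eq, toeplitzGammaTilde_eq]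
    rw [map_neg, map_add, map_sum, e, hs, hr0, hc0, hk, (hf k).2, toeplitzV_swap (x := x) (y := y)]
    push_cast
    ring

/-- The recursion relations propagate from two neighbouring sites to all sites. -/
theorem gamma_eq_zero_of_bond [IsDomain R] {N : ℕ} (hN : 0 < N) {u : ℤ → R}
    (hu : ∀ i, δ (u i) = if i = 1 ∨ i = -1 then 1 else 0) (hf : ∀ k, FlowAt δ x y k)
    (hv : ∀ k, toeplitzV x y k ≠ 0) {k₀ : ℤ}
    (h0 : toeplitzGamma N u x y (k₀ - 1) = 0 ∧ toeplitzGammaTilde N u x y (k₀ - 1) = 0)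
    (h1 : toeplitzGamma N u x y k₀ = 0 ∧ toeplitzGammaTilde N u x y k₀ = 0) (k : ℤ) :
    toeplitzGamma N u x y k = 0 ∧ toeplitzGammaTilde N u x y k = 0 := by
  set p : ℤ → Prop := fun k => toeplitzGamma N u x y k = 0 ∧ toeplitzGammaTilde N u x y k = 0
  -- At a site where both polynomials vanish the linearised flow reduces to `v k` times the
  -- difference of the values at `k + 1` and `k - 1`.
  have key : ∀ k, p k → (p (k + 1) ↔ p (k - 1)) := by
    intro k hk
    obtain ⟨e1, e2⟩ := linAt_gamma hN hu hf k
    simp only [hk.1, hk.2, map_zero, neg_zero, mul_zero, add_zero, zero_mul, sub_zero] at e1 e2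
    have e1' := sub_eq_zero.mp ((mul_eq_zero.mp e1.symm).resolve_left (hv k))
    have e2' := sub_eq_zero.mp ((mul_eq_zero.mp e2.symm).resolve_left (hv k))
    simp only [p, e1', neg_injective e2']
  have hp : ∀ d : ℕ, p (k₀ + d) ∧ p (k₀ + d - 1) := by
    intro d
    induction d with
    | zero => simpa using ⟨h1, h0⟩
    | succ d ih =>
      push_cast
      rw [← add_assoc, add_sub_cancel_right]
      exact ⟨(key _ ih.1).mpr ih.2, ih.1⟩
  have hm : ∀ d : ℕ, p (k₀ - d) ∧ p (k₀ - d - 1) := by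
    intro d
    induction d with
    | zero => simpa using ⟨h1, h0⟩
    | succ d ih =>
      push_cast
      rw [← sub_sub]
      refine ⟨ih.2, (key _ ih.2).mp ?_⟩
      rw [sub_add_cancel]
      exact ih.1
  rcases le_total k₀ k with h | h
  · have := (hp (k - k₀).toNat).1
    rwa [show k₀ + ((k - k₀).toNat : ℤ) = k by omega] at this
  · have := (hm (k₀ - k).toNat).1
    rwa [show k₀ - ((k₀ - k).toNat : ℤ) = k by omega] at this

end Flow

open PowerSeries

/-! ### Formal ordinary differential equations -/

section Picard

variable {F S : Type*} [Field F] [CommRing S] [Algebra F S] {ι : Type*}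

/-- An additive map satisfying the Leibniz rule, as a derivation over `ℤ`. -/
def derivationOfAddHom {R : Type*} [CommRing R] (D : R →+ R)
    (h : ∀ a b, D (a * b) = a * D b + b * D a) : Derivation ℤ R R :=
  Derivation.mk' D.toIntLinearMap h

/-- The derivation `d/dt` of power series, as a derivation over `ℤ`. -/
noncomputable def ddt (S : Type*) [CommRing S] :=
  derivationOfAddHom (R := S⟦X⟧) (PowerSeries.derivative S).toLinearMap.toAddMonoidHom
    fun a b => (PowerSeries.derivative S).leibniz a b

theorem coeff_ddt (f : S⟦X⟧) (m : ℕ) : coeff m (ddt S f) = coeff (m + 1) f * (m + 1) := by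
  change coeff m (PowerSeries.derivative S f) = _
  rw [coeff_derivative]

theorem ddt_map {S' : Type*} [CommRing S'] (g : S →+* S') (f : S⟦X⟧) :
    ddt S' (PowerSeries.map g f) = PowerSeries.map g (ddt S f) := by
  ext m
  simp [coeff_ddt]

/-- The Picard iteration for `dz/dt = V z` with initial value `z₀`. -/
noncomputable def picard (F : Type*) [Field F] {S : Type*} [CommRing S] [Algebra F S] {ι : Type*}
    (V : (ι → S⟦X⟧) → ι → S⟦X⟧) (z₀ : ι → S) : ℕ → ι → S⟦X⟧
  | 0 => fun i => C (z₀ i)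
  | m + 1 => fun i => PowerSeries.mk fun j => match j with
    | 0 => z₀ i
    | j + 1 => ((j + 1 : F)⁻¹) • coeff j (V (picard F V z₀ m) i)

theorem coeff_picard_zero (V : (ι → S⟦X⟧) → ι → S⟦X⟧) (z₀ : ι → S) (m : ℕ) (i : ι) :
    coeff 0 (picard F V z₀ m i) = z₀ i := by
  cases m <;> simp [picard]

theorem coeff_picard_succ (V : (ι → S⟦X⟧) → ι → S⟦X⟧) (z₀ : ι → S) (m j : ℕ) (i : ι) :
    coeff (j + 1) (picard F V z₀ (m + 1) i) =
      ((j + 1 : F)⁻¹) • coeff j (V (picard F V z₀ m) i) := by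
  rw [picard, coeff_mk]

/-- The hypothesis says that `V` respects truncation, as every polynomial vector field does; each
integration then gains one order. -/
theorem picard_congr {V : (ι → S⟦X⟧) → ι → S⟦X⟧}
    (hV : ∀ m z z', (∀ i, X ^ m ∣ z i - z' i) → ∀ i, X ^ m ∣ V z i - V z' i) (z₀ : ι → S)
    (m : ℕ) (i : ι) : X ^ (m + 1) ∣ picard F V z₀ (m + 1) i - picard F V z₀ m i := by
  induction m generalizing i with
  | zero =>
    rw [X_pow_dvd_iff]
    intro j hj
    obtain rfl : j = 0 := by omega
    simp [picard]
  | succ m ih =>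
    rw [X_pow_dvd_iff]
    intro j hj
    cases j with
    | zero => rw [map_sub, coeff_picard_zero, coeff_picard_zero, sub_self]
    | succ j =>
      have h := X_pow_dvd_iff.mp (hV _ _ _ ih i) j (by omega)
      rw [map_sub, sub_eq_zero] at h
      rw [map_sub, coeff_picard_succ, coeff_picard_succ, h, sub_self]

/-- The coefficient of `t^m` is stationary from the `m`-th iterate on. Only integers are inverted,
so the coefficients stay in any `F`-algebra that contains the initial values; this is used below for
subalgebras of a field. -/
theorem exists_ode_solution (F : Type*) [Field F] [CharZero F] [Algebra F S]
    {V : (ι → S⟦X⟧) → ι → S⟦X⟧}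
    (hV : ∀ m z z', (∀ i, X ^ m ∣ z i - z' i) → ∀ i, X ^ m ∣ V z i - V z' i) (z₀ : ι → S) :
    ∃ z : ι → S⟦X⟧, (∀ i, constantCoeff (z i) = z₀ i) ∧ ∀ i, ddt S (z i) = V z i := by
  set z : ι → S⟦X⟧ := fun i => PowerSeries.mk fun m => coeff m (picard F V z₀ m i) with hz
  have hstep : ∀ m d i, X ^ (m + 1) ∣ picard F V z₀ (m + d) i - picard F V z₀ m i := by
    intro m d i
    induction d with
    | zero => simp
    | succ d ih =>
      have h := picard_congr (F := F) hV z₀ (m + d) i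
      have := dvd_add ((pow_dvd_pow X (by omega : m + 1 ≤ m + d + 1)).trans h) ih
      rwa [sub_add_sub_cancel] at this
  have hlim : ∀ m i, X ^ (m + 1) ∣ z i - picard F V z₀ m i := by
    intro m i
    rw [X_pow_dvd_iff]
    intro j hj
    rw [map_sub, hz, coeff_mk]
    have h := X_pow_dvd_iff.mp (hstep j (m - j) i) j (by omega)
    rw [show j + (m - j) = m by omega, map_sub] at h
    linear_combination -h
  refine ⟨z, fun i => ?_, fun i => ?_⟩
  · rw [← coeff_zero_eq_constantCoeff_apply, hz, coeff_mk]
    rw [coeff_picard_zero]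
  · ext m
    have h := X_pow_dvd_iff.mp (hV _ _ _ (hlim m) i) m (by omega)
    rw [map_sub, sub_eq_zero] at h
    rw [coeff_ddt, h, hz, coeff_mk, coeff_picard_succ, Algebra.smul_def, mul_comm, ← mul_assoc]
    have hne : ((m : F) + 1) ≠ 0 := by exact_mod_cast Nat.succ_ne_zero m
    have : ((m : S) + 1) = algebraMap F S (m + 1) := by simp
    rw [this, ← map_mul, mul_inv_cancel₀ hne, map_one, one_mul]

theorem ode_unique [IsDomain S] [CharZero S] {V : (ι → S⟦X⟧) → ι → S⟦X⟧}
    (hV : ∀ m z z', (∀ i, X ^ m ∣ z i - z' i) → ∀ i, X ^ m ∣ V z i - V z' i) {z z' : ι → S⟦X⟧}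
    (h0 : ∀ i, constantCoeff (z i) = constantCoeff (z' i)) (hz : ∀ i, ddt S (z i) = V z i)
    (hz' : ∀ i, ddt S (z' i) = V z' i) : z = z' := by
  have key : ∀ m i, X ^ (m + 1) ∣ z i - z' i := by
    intro m
    induction m with
    | zero =>
      intro i
      rw [X_pow_dvd_iff]
      intro j hj
      obtain rfl : j = 0 := by omega
      simp [h0]
    | succ m ih =>
      intro i
      rw [X_pow_dvd_iff]
      intro j hj
      cases j with
      | zero => simp [h0]
      | succ j =>
        have h := X_pow_dvd_iff.mp (hV _ _ _ ih i) j (by omega)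
        rw [← hz, ← hz', map_sub, coeff_ddt, coeff_ddt, ← sub_mul, ← map_sub] at h
        exact (mul_eq_zero.mp h).resolve_right (by exact_mod_cast Nat.succ_ne_zero j)
  funext i
  ext m
  have := X_pow_dvd_iff.mp (key m i) m (by omega)
  rwa [map_sub, sub_eq_zero] at this

end Picard

/-! ### The closed differential equation for the moments at a bond -/

section BondField

variable {T T' : Type*} [CommRing T] [CommRing T']

theorem quadD_comm (a b : ℕ → T) (s : ℕ) : quadD a b s = quadD b a s := by
  induction s using Nat.strong_induction_on with
  | _ s ih =>
    cases s with
    | zero => rw [quadD_zero, quadD_zero]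
    | succ s =>
      rw [quadD_succ, quadD_succ]
      congr 1
      · congr 1
        rw [← Finset.sum_range_reflect]
        refine Finset.sum_congr rfl fun i hi => ?_
        rw [Finset.mem_range] at hi
        rw [mul_comm]
        congr 2
        omega
      · refine Finset.sum_congr rfl fun i hi => ?_
        rw [Finset.mem_range] at hi
        rw [ih (i + 1) (by omega), ih (s - i) (by omega)]

/-- The value of the moment of order `N` imposed by a recursion relation at the bond. -/
noncomputable def topMoment (N : ℕ) (c : Bool → T) (w : Bool → ℕ → T) (k : ℤ)
    (z : Bool → Bool → ℕ → T) (e f : Bool) : T :=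
  -c e * (∑ s ∈ Finset.range (N - 1), w e s * z e f (s + 1) +
    (∑ s ∈ Finset.range N, (w (!e) s *
      (z (!e) (!f) s + z e f 0 * quadD (z (!e) f) (z (!e) (!f)) (s + 1)) -
      w e s * (z e f 0 * quadD (z e f) (z e (!f)) (s + 1))) +
    -- A column moment at this bond belongs to the relation at the site `k - 1`.
    ((k - if f then 1 else 0 : ℤ) : T) * z e f 0))

/-- The vector field of the moments of order less than `N` at a bond. The first Boolean records
whether the moment is one of `(y, x)` instead of `(x, y)`, the second one whether it is a column
moment instead of a row moment. -/
noncomputable def bondField (N : ℕ) (c : Bool → T) (w : Bool → ℕ → T) (k : ℤ)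
    (z : Bool → Bool → ℕ → T) (e f : Bool) (s : ℕ) : T :=
  if s < N then (if f then -1 else 1) *
    momentField (z e f 0) (z (!e) f 0) (z (!e) (!f) 0) (z e (!f) 0)
      (fun i => if i = N then topMoment N c w k z e f else z e f i)
      (quadD (z e f) (z e (!f))) s
  else 0

theorem map_topMoment (g : T →+* T') (N : ℕ) (c : Bool → T) (w : Bool → ℕ → T) (k : ℤ)
    (z : Bool → Bool → ℕ → T) (e f : Bool) : g (topMoment N c w k z e f) =
      topMoment N (fun e => g (c e)) (fun e s => g (w e s)) k (fun e f s => g (z e f s)) e f := by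
  simp only [topMoment, map_mul, map_neg, map_add, map_sum, map_sub, map_quadD, map_intCast]

theorem map_momentField (g : T →+* T') (xk yk xp yp : T) (a d : ℕ → T) (s : ℕ) :
    g (momentField xk yk xp yp a d s) =
      momentField (g xk) (g yk) (g xp) (g yp) (fun i => g (a i)) (fun i => g (d i)) s := by
  cases s <;> simp [momentField, map_ofNat]

theorem momentField_congr {xk yk xp yp : T} {a a' d d' : ℕ → T} {s : ℕ}
    (ha : ∀ i ≤ s + 1, a i = a' i) (hd : ∀ i ≤ s + 1, d i = d' i) :
    momentField xk yk xp yp a d s = momentField xk yk xp yp a' d' s := by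
  cases s with
  | zero => simp only [momentField, ha 0 (by omega), ha 1 (by omega), hd 0 (by omega), hd 1 (by omega)]
  | succ s =>
    simp only [momentField, ha s (by omega), ha (s + 1) (by omega), ha (s + 2) (by omega),
      hd (s + 1) (by omega), hd (s + 2) (by omega)]

theorem map_bondField (g : T →+* T') (N : ℕ) (c : Bool → T) (w : Bool → ℕ → T) (k : ℤ)
    (z : Bool → Bool → ℕ → T) (e f : Bool) (s : ℕ) : g (bondField N c w k z e f s) =
      bondField N (fun e => g (c e)) (fun e s => g (w e s)) k
        (fun e f s => g (z e f s)) e f s := by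
  simp only [bondField]
  split_ifs
  · simp only [map_mul, map_momentField, map_quadD, map_neg, map_one]
    congr 2
    funext i
    split_ifs
    · rw [map_topMoment]
    · rfl
  · simp only [map_mul, map_momentField, map_quadD, map_one]
    congr 2
    funext i
    split_ifs
    · rw [map_topMoment]
    · rfl
  · simp

/-- The vector field is polynomial, so it commutes with ring homomorphisms (`map_bondField`), in
particular with reduction modulo `X ^ m`. -/
theorem bondField_congr {S : Type*} [CommRing S] (N : ℕ) (c : Bool → S⟦X⟧) (w : Bool → ℕ → S⟦X⟧)
    (k : ℤ) (m : ℕ) (z z' : Bool × Bool × ℕ → S⟦X⟧) (h : ∀ i, X ^ m ∣ z i - z' i)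
    (i : Bool × Bool × ℕ) :
    X ^ m ∣ bondField N c w k (fun e f s => z (e, f, s)) i.1 i.2.1 i.2.2 -
      bondField N c w k (fun e f s => z' (e, f, s)) i.1 i.2.1 i.2.2 := by
  rw [← Ideal.mem_span_singleton, ← Ideal.Quotient.eq, map_bondField, map_bondField]
  have e : ∀ i, Ideal.Quotient.mk (Ideal.span {X ^ m}) (z i) =
      Ideal.Quotient.mk (Ideal.span {X ^ m}) (z' i) := fun i => by
    rw [Ideal.Quotient.eq, Ideal.mem_span_singleton]
    exact h i
  simp only [e]

/-- The moments of a sequence at a bond. -/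
noncomputable def bondMoment (x y : ℤ → T) (k : ℤ) : Bool → Bool → ℕ → T
  | false, false => bondA x y k
  | false, true => bondB x y k
  | true, false => bondA y x k
  | true, true => bondB y x k

/-- The coefficients of the recursion relations, indexed like the moments. -/
def signedU (u : ℤ → T) (e : Bool) (s : ℕ) : T := if e then u (-(s + 1)) else u (s + 1)

/-- The recursion polynomial whose top moment at the bond between `k - 1` and `k` is indexed by the
given Booleans. -/
noncomputable def bondGamma (N : ℕ) (u : ℤ → T) (x y : ℤ → T) (k : ℤ) : Bool → Bool → T
  | false, false => toeplitzGamma N u x y k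
  | false, true => toeplitzGammaTilde N u x y (k - 1)
  | true, false => toeplitzGammaTilde N u x y k
  | true, true => toeplitzGamma N u x y (k - 1)

variable [IsDomain T] {x y : ℤ → T}

/-- The moment of order `N` enters linearly, with coefficient `u_N` or `u_{-N}`, which `c` inverts.
Everything else has order less than `N`: the diagonal moment of order `N` is, by `bondD_eq_quadD`, a
polynomial in row and column moments of lower order. -/
theorem bondGamma_eq_zero_iff {N : ℕ} (hN : 0 < N) {u : ℤ → T} {c : Bool → T}
    (hc : ∀ e, c e * signedU u e (N - 1) = 1) (hv : ∀ k, toeplitzV x y k ≠ 0) (k : ℤ) (e f : Bool) :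
    bondGamma N u x y k e f = 0 ↔
      bondMoment x y k e f N = topMoment N c (signedU u) k (bondMoment x y k) e f := by
  have hv' : ∀ k, toeplitzV y x k ≠ 0 := fun k => by rw [toeplitzV_swap]; exact hv k
  obtain ⟨M, rfl⟩ : ∃ M, N = M + 1 := ⟨N - 1, by omega⟩
  rw [Nat.add_sub_cancel] at hc
  set rest : T := ∑ s ∈ Finset.range M, signedU u e s * bondMoment x y k e f (s + 1) +
    (∑ s ∈ Finset.range (M + 1), (signedU u (!e) s *
      (bondMoment x y k (!e) (!f) s + bondMoment x y k e f 0 *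
        quadD (bondMoment x y k (!e) f) (bondMoment x y k (!e) (!f)) (s + 1)) -
      signedU u e s * (bondMoment x y k e f 0 *
        quadD (bondMoment x y k e f) (bondMoment x y k e (!f)) (s + 1))) +
    ((k - if f then 1 else 0 : ℤ) : T) * bondMoment x y k e f 0) with hrest
  have key : bondGamma (M + 1) u x y k e f =
      signedU u e M * bondMoment x y k e f (M + 1) + rest := by
    have hsplit : signedU u e M * bondMoment x y k e f (M + 1) + rest =
        ∑ s ∈ Finset.range (M + 1), (signedU u e s * (bondMoment x y k e f (s + 1) -
          bondMoment x y k e f 0 *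
            quadD (bondMoment x y k e f) (bondMoment x y k e (!f)) (s + 1)) +
          signedU u (!e) s * (bondMoment x y k (!e) (!f) s + bondMoment x y k e f 0 *
            quadD (bondMoment x y k (!e) f) (bondMoment x y k (!e) (!f)) (s + 1))) +
        ((k - if f then 1 else 0 : ℤ) : T) * bondMoment x y k e f 0 := by
      have e2 : ∑ s ∈ Finset.range (M + 1), signedU u e s * bondMoment x y k e f (s + 1) =
          ∑ s ∈ Finset.range M, signedU u e s * bondMoment x y k e f (s + 1) +
          signedU u e M * bondMoment x y k e f (M + 1) := Finset.sum_range_succ _ _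
      rw [hrest, ← add_assoc, add_comm (signedU u e M * _), ← e2, ← add_assoc,
        ← Finset.sum_add_distrib]
      congr 1
      refine Finset.sum_congr rfl fun s _ => ?_
      ring
    rw [hsplit]
    have e1 := quadD_comm (bondB x y k)
    have e2 := quadD_comm (bondB y x k)
    cases f
    · cases e <;>
        simp only [bondGamma, bondMoment, toeplitzGamma_eq, toeplitzGammaTilde_eq, signedU,
          gammaPart_eq, gammaTildePart_eq, bondA_zero, Bool.not_false, Bool.not_true, if_true,
          if_false, Bool.false_eq_true, ← bondD_eq_quadD x y hv, ← bondD_eq_quadD y x hv', sub_zero]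
      refine congrArg₂ (· + ·) (Finset.sum_congr rfl fun s _ => ?_) rfl
      ring
    · cases e <;>
        simp only [bondGamma, bondMoment, toeplitzGamma_eq, toeplitzGammaTilde_eq, signedU,
          gammaPart_pred, gammaTildePart_pred, bondB_zero, Bool.not_false, Bool.not_true, if_true,
          if_false, Bool.false_eq_true, e1, e2, ← bondD_eq_quadD x y hv, ← bondD_eq_quadD y x hv']
      refine congrArg₂ (· + ·) (Finset.sum_congr rfl fun s _ => ?_) rfl
      ring
  have htop : topMoment (M + 1) c (signedU u) k (bondMoment x y k) e f = -c e * rest := rfl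
  rw [key, htop]
  constructor
  · intro h
    linear_combination c e * h - bondMoment x y k e f (M + 1) * hc e
  · intro h
    rw [h]
    linear_combination -rest * hc e

theorem deriv_bondMoment {δ : Derivation ℤ T T} (hf : ∀ k, FlowAt δ x y k)
    (hv : ∀ k, toeplitzV x y k ≠ 0) (k : ℤ) (e f : Bool) (s : ℕ) :
    δ (bondMoment x y k e f s) = (if f then -1 else 1) *
      momentField (bondMoment x y k e f 0) (bondMoment x y k (!e) f 0)
        (bondMoment x y k (!e) (!f) 0) (bondMoment x y k e (!f) 0) (bondMoment x y k e f)
        (quadD (bondMoment x y k e f) (bondMoment x y k e (!f))) s := by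
  have hv' : ∀ k, toeplitzV y x k ≠ 0 := fun k => by rw [toeplitzV_swap]; exact hv k
  have hf' : ∀ k, FlowAt δ y x k := fun k => (hf k).swap
  have q1 : bondD x y k = quadD (bondA x y k) (bondB x y k) := funext (bondD_eq_quadD x y hv k)
  have q2 : bondD y x k = quadD (bondA y x k) (bondB y x k) := funext (bondD_eq_quadD y x hv' k)
  have q1' : bondD x y k = quadD (bondB x y k) (bondA x y k) := by
    rw [q1]; exact funext (quadD_comm _ _)
  have q2' : bondD y x k = quadD (bondB y x k) (bondA y x k) := by
    rw [q2]; exact funext (quadD_comm _ _)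
  cases e <;> cases f <;>
    simp only [bondMoment, bondA_zero, bondB_zero, Bool.not_false, Bool.not_true, if_true, if_false,
      Bool.false_eq_true, one_mul, neg_one_mul]
  · rw [deriv_bondA hf, q1]
  · rw [deriv_bondB hf, q1']
  · rw [deriv_bondA hf', q2]
  · rw [deriv_bondB hf', q2']

/-- The moments of a solution of the flow and of the recursion relations form an integral curve of
the vector field of moments. -/
theorem deriv_bondMoment_eq_bondField {δ : Derivation ℤ T T} (hf : ∀ k, FlowAt δ x y k)
    (hv : ∀ k, toeplitzV x y k ≠ 0) {N : ℕ} (hN : 0 < N) {u : ℤ → T} {c : Bool → T}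
    (hc : ∀ e, c e * signedU u e (N - 1) = 1) {k : ℤ} (hG : ∀ e f, bondGamma N u x y k e f = 0)
    (z : Bool → Bool → ℕ → T) (hz : z = fun e f s => if s < N then bondMoment x y k e f s else 0)
    (e f : Bool) (s : ℕ) : δ (z e f s) = bondField N c (signedU u) k z e f s := by
  have hzs : ∀ e f, ∀ s < N, z e f s = bondMoment x y k e f s := by
    intro e f s hs
    rw [hz]
    simp only [hs, if_true]
  by_cases h : s < N
  · rw [bondField, if_pos h, hzs e f s h, deriv_bondMoment hf hv, hzs e f 0 hN, hzs _ f 0 hN,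
      hzs _ _ 0 hN, hzs e _ 0 hN]
    congr 1
    refine momentField_congr (fun i hi => ?_) (fun i hi => ?_)
    · split_ifs with hiN
      · rw [hiN, (bondGamma_eq_zero_iff hN hc hv k e f).mp (hG e f)]
        have q : ∀ e f e' f' s, s < N → quadD (bondMoment x y k e f) (bondMoment x y k e' f')
            (s + 1) = quadD (z e f) (z e' f') (s + 1) := fun e f e' f' s hs =>
          quadD_congr (fun i hi => (hzs e f i (by omega)).symm)
            (fun i hi => (hzs e' f' i (by omega)).symm) _ le_rfl
        simp only [topMoment]
        congr 2
        · refine Finset.sum_congr rfl fun s hs => ?_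
          rw [Finset.mem_range] at hs
          rw [hzs e f _ (by omega)]
        · rw [hzs e f 0 hN]
          congr 1
          refine Finset.sum_congr rfl fun s hs => ?_
          rw [Finset.mem_range] at hs
          rw [q _ _ _ _ s hs, q _ _ _ _ s hs, hzs _ _ s hs]
      · rw [hzs e f i (by omega)]
    · exact quadD_congr (fun i hi => (hzs _ _ i (by omega)).symm)
        (fun i hi => (hzs _ _ i (by omega)).symm) _ hi
  · rw [bondField, if_neg h, hz]
    simp only [h, if_false, map_zero]

/-- An integral curve of the vector field of moments whose sites satisfy the flow consists of the
moments of these sites, and the recursion relations hold at the bond. -/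
theorem bondMoment_eq_of_integral {δ : Derivation ℤ T T} (hf : ∀ k, FlowAt δ x y k)
    (hv : ∀ k, toeplitzV x y k ≠ 0) {N : ℕ} (hN : 0 < N) {u : ℤ → T} {c : Bool → T}
    (hc : ∀ e, c e * signedU u e (N - 1) = 1) {k : ℤ} {z : Bool → Bool → ℕ → T}
    (hz : ∀ e f, ∀ s < N, δ (z e f s) = bondField N c (signedU u) k z e f s)
    (h0 : ∀ e f, z e f 0 = bondMoment x y k e f 0) :
    (∀ e f, ∀ s < N, bondMoment x y k e f s = z e f s) ∧
      ∀ e f, bondGamma N u x y k e f = 0 := by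
  -- The derivative of the moment of order `s` contains the one of order `s + 1` with coefficient
  -- one, and the diagonal moments in it only involve orders up to `s`. Equating the two expressions
  -- for the derivative identifies the moments one order at a time; at order `N` this identification
  -- is the recursion relation.
  have key : ∀ s ≤ N, ∀ e f, bondMoment x y k e f s =
      if s = N then topMoment N c (signedU u) k z e f else z e f s := by
    intro s
    induction s using Nat.strong_induction_on with
    | _ s ih =>
      intro hs e f
      cases s with
      | zero => rw [if_neg (by omega), h0]
      | succ s =>
        have hlt : ∀ e f, ∀ i ≤ s, bondMoment x y k e f i = z e f i := by
          intro e f i hi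
          rw [ih i (by omega) (by omega) e f, if_neg (by omega)]
        have hq : ∀ e f f', ∀ i ≤ s + 1, quadD (bondMoment x y k e f) (bondMoment x y k e f') i =
            quadD (z e f) (z e f') i := fun e f f' i hi =>
          quadD_congr (fun i hi => hlt e f i (by omega)) (fun i hi => hlt e f' i (by omega)) _ hi
        have h1 := hz e f s (by omega)
        have h2 := deriv_bondMoment hf hv k e f s
        rw [hlt e f s le_rfl, h1, bondField, if_pos (by omega)] at h2
        have h3 := mul_left_cancel₀ (by split_ifs <;> simp) h2
        have q := hq e f (!f)
        rw [← h0 e f, ← h0 _ f, ← h0 _ _, ← h0 e _] at h3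
        cases s with
        | zero =>
          simp only [momentField] at h3
          rw [q 0 (by omega), q 1 (by omega), hlt e f 0 le_rfl, if_neg (by omega : ¬0 = N)] at h3
          linear_combination -h3
        | succ s =>
          simp only [momentField] at h3
          rw [q (s + 1) (by omega), q (s + 2) (by omega), hlt e f (s + 1) le_rfl,
            hlt e f s (by omega), if_neg (by omega : ¬s = N), if_neg (by omega : ¬s + 1 = N)] at h3
          linear_combination -h3
  have hlt : ∀ e f, ∀ s < N, bondMoment x y k e f s = z e f s := by
    intro e f s hs
    rw [key s hs.le, if_neg (by omega)]
  refine ⟨hlt, fun e f => ?_⟩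
  rw [bondGamma_eq_zero_iff hN hc hv, key N le_rfl, if_pos rfl]
  have q : ∀ e f e' f' s, s < N → quadD (bondMoment x y k e f) (bondMoment x y k e' f')
      (s + 1) = quadD (z e f) (z e' f') (s + 1) := fun e f e' f' s hs =>
    quadD_congr (fun i hi => hlt e f i hi) (fun i hi => hlt e' f' i hi) _ (by omega)
  simp only [topMoment]
  congr 2
  · refine Finset.sum_congr rfl fun s hs => ?_
    rw [Finset.mem_range] at hs
    rw [hlt e f _ (by omega)]
  · rw [hlt e f 0 hN]
    congr 1
    refine Finset.sum_congr rfl fun s hs => ?_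
    rw [Finset.mem_range] at hs
    rw [q _ _ _ _ s hs, q _ _ _ _ s hs, hlt _ _ s hs]

end BondField

/-! ### Compatibility with ring homomorphisms -/

section Maps

variable {R R' : Type*} [CommRing R] [CommRing R'] (g : R →+* R') (x y : ℤ → R)

theorem map_lax (s : ℕ) (i j : ℤ) :
    g (lax x y s i j) = lax (fun k => g (x k)) (fun k => g (y k)) s i j := by
  induction s generalizing i j with
  | zero => simp only [lax_zero]; split_ifs <;> simp
  | succ s ih =>
    rw [lax_succ_left, lax_succ_left, map_sub, map_mul, ih, colMoment, colMoment, map_sum]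
    congr 2
    refine Finset.sum_congr rfl fun m _ => ?_
    rw [map_mul, ih]

theorem map_bondA (k : ℤ) (s : ℕ) :
    g (bondA x y k s) = bondA (fun k => g (x k)) (fun k => g (y k)) k s := by
  simp only [bondA, rowMoment, map_sum, map_mul, map_lax]

theorem map_bondB (k : ℤ) (s : ℕ) :
    g (bondB x y k s) = bondB (fun k => g (x k)) (fun k => g (y k)) k s := by
  simp only [bondB, colMoment, map_sum, map_mul, map_lax]

theorem map_bondMoment (k : ℤ) (e f : Bool) (s : ℕ) :
    g (bondMoment x y k e f s) =
      bondMoment (fun k => g (x k)) (fun k => g (y k)) k e f s := by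
  cases e <;> cases f <;> simp only [bondMoment, map_bondA, map_bondB]

theorem map_toeplitzV (k : ℤ) :
    g (toeplitzV x y k) = toeplitzV (fun k => g (x k)) (fun k => g (y k)) k := by
  simp [toeplitzV]

theorem map_toeplitzGamma (N : ℕ) (u : ℤ → R) (k : ℤ) : g (toeplitzGamma N u x y k) =
    toeplitzGamma N (fun i => g (u i)) (fun k => g (x k)) (fun k => g (y k)) k := by
  simp only [toeplitzGamma_eq, gammaPart, gammaTildePart, rowMoment, colMoment, map_add, map_sum,
    map_mul, map_toeplitzV, map_lax, map_intCast]

theorem map_toeplitzGammaTilde (N : ℕ) (u : ℤ → R) (k : ℤ) : g (toeplitzGammaTilde N u x y k) =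
    toeplitzGammaTilde N (fun i => g (u i)) (fun k => g (x k)) (fun k => g (y k)) k := by
  simp only [toeplitzGammaTilde_eq, gammaPart, gammaTildePart, rowMoment, colMoment, map_add,
    map_sum, map_mul, map_toeplitzV, map_lax, map_intCast]

theorem bondMoment_zero (k : ℤ) (e f : Bool) (s : ℕ) :
    bondMoment (fun _ => (0 : R)) (fun _ => 0) k e f s = 0 := by
  cases e <;> cases f <;> simp [bondMoment, bondA, bondB, rowMoment, colMoment]

theorem bondField_zero (N : ℕ) (c : Bool → R) (w : Bool → ℕ → R) (k : ℤ) (e f : Bool) (s : ℕ) :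
    bondField N c w k (fun _ _ _ => 0) e f s = 0 := by
  have ht : topMoment N c w k (fun _ _ _ => 0) e f = 0 := by simp [topMoment]
  rw [bondField, ht]
  cases s <;> simp [momentField]

end Maps

/-! ### Recovering the sites from the moments at a bond -/

section Sites

variable {R : Type*} [CommRing R] [IsDomain R] {x y x' y' : ℤ → R}

/-- The crossing formulas need one order more than they produce, so each site crossed costs one
order. -/
theorem bondAB_succ_congr (hv : ∀ k, toeplitzV x y k ≠ 0) (hv' : ∀ k, toeplitzV x' y' k ≠ 0)
    {k : ℤ} {m : ℕ} (hx : x k = x' k) (hy : y k = y' k)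
    (hA : ∀ s < m + 1, bondA x y k s = bondA x' y' k s)
    (hB : ∀ s < m + 1, bondB x y k s = bondB x' y' k s) :
    (∀ s < m, bondA x y (k + 1) s = bondA x' y' (k + 1) s) ∧
      ∀ s < m, bondB x y (k + 1) s = bondB x' y' (k + 1) s := by
  have hvk : toeplitzV x y k = toeplitzV x' y' k := by rw [toeplitzV, toeplitzV, hx, hy]
  have hD : ∀ s ≤ m + 1, bondD x y k s = bondD x' y' k s := fun s hs => by
    rw [bondD_eq_quadD x y hv, bondD_eq_quadD x' y' hv', quadD_congr hA hB s hs]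
  constructor
  · intro s hs
    refine mul_left_cancel₀ (hv k) ?_
    have h := v_mul_bondA_succ x' y' k s
    rw [← hvk] at h
    rw [h, v_mul_bondA_succ, hA _ (by omega), hD _ (by omega), hB _ (by omega), hx]
  · intro s hs
    cases s with
    | zero => rw [bondB_succ_zero, bondB_succ_zero, hy]
    | succ s =>
      refine mul_left_cancel₀ (hv k) ?_
      have h := v_mul_bondB_succ x' y' k s
      rw [← hvk] at h
      rw [h, v_mul_bondB_succ, hA _ (by omega), hD _ (by omega), hB _ (by omega), hy]

theorem bondAB_pred_congr (hv : ∀ k, toeplitzV x y k ≠ 0) (hv' : ∀ k, toeplitzV x' y' k ≠ 0)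
    {k : ℤ} {m : ℕ} (hx : x (k - 1) = x' (k - 1)) (hy : y (k - 1) = y' (k - 1))
    (hA : ∀ s < m + 1, bondA x y k s = bondA x' y' k s)
    (hB : ∀ s < m + 1, bondB x y k s = bondB x' y' k s) :
    (∀ s < m, bondA x y (k - 1) s = bondA x' y' (k - 1) s) ∧
      ∀ s < m, bondB x y (k - 1) s = bondB x' y' (k - 1) s := by
  have hvk : toeplitzV x y (k - 1) = toeplitzV x' y' (k - 1) := by
    rw [toeplitzV, toeplitzV, hx, hy]
  have hD : ∀ s ≤ m + 1, bondD x y k s = bondD x' y' k s := fun s hs => by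
    rw [bondD_eq_quadD x y hv, bondD_eq_quadD x' y' hv', quadD_congr hA hB s hs]
  constructor
  · intro s hs
    cases s with
    | zero => rw [bondA_zero, bondA_zero, hx]
    | succ s =>
      refine mul_left_cancel₀ (hv (k - 1)) ?_
      have h := v_mul_bondA_pred x' y' k s
      rw [← hvk] at h
      rw [h, v_mul_bondA_pred, hA _ (by omega), hD _ (by omega), hB _ (by omega), hx]
  · intro s hs
    refine mul_left_cancel₀ (hv (k - 1)) ?_
    have h := v_mul_bondB_pred x' y' k s
    rw [← hvk] at h
    rw [h, v_mul_bondB_pred, hA _ (by omega), hD _ (by omega), hB _ (by omega), hy]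

theorem bondMoment_shift_congr (hv : ∀ k, toeplitzV x y k ≠ 0)
    (hv' : ∀ k, toeplitzV x' y' k ≠ 0) {k : ℤ} {m : ℕ}
    (h : ∀ e f, ∀ s < m + 1, bondMoment x y k e f s = bondMoment x' y' k e f s) :
    (∀ e f, ∀ s < m, bondMoment x y (k + 1) e f s = bondMoment x' y' (k + 1) e f s) ∧
      ∀ e f, ∀ s < m, bondMoment x y (k - 1) e f s = bondMoment x' y' (k - 1) e f s := by
  have hs : ∀ k, toeplitzV y x k ≠ 0 := fun k => by rw [toeplitzV_swap]; exact hv k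
  have hs' : ∀ k, toeplitzV y' x' k ≠ 0 := fun k => by rw [toeplitzV_swap]; exact hv' k
  have h1 := h false false 0 (by omega)
  have h2 := h true false 0 (by omega)
  have h3 := h false true 0 (by omega)
  have h4 := h true true 0 (by omega)
  simp only [bondMoment, bondA_zero, bondB_zero] at h1 h2 h3 h4
  obtain ⟨a1, a2⟩ := bondAB_succ_congr hv hv' h1 h2 (h false false) (h false true)
  obtain ⟨a3, a4⟩ := bondAB_succ_congr hs hs' h2 h1 (h true false) (h true true)
  obtain ⟨b1, b2⟩ := bondAB_pred_congr hv hv' h4 h3 (h false false) (h false true)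
  obtain ⟨b3, b4⟩ := bondAB_pred_congr hs hs' h3 h4 (h true false) (h true true)
  constructor <;> intro e f <;> cases e <;> cases f <;> assumption

/-- The moments at a bond determine the `2N` neighbouring sites. -/
theorem site_eq_of_bondMoment (hv : ∀ k, toeplitzV x y k ≠ 0) (hv' : ∀ k, toeplitzV x' y' k ≠ 0)
    {k : ℤ} {N : ℕ}
    (h : ∀ e f, ∀ s < N, bondMoment x y k e f s = bondMoment x' y' k e f s) (j : ℤ)
    (hj : k - N ≤ j ∧ j ≤ k + N - 1) : x j = x' j ∧ y j = y' j := by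
  -- After crossing `r` sites the orders below `N - r` are still known, and order zero is the site
  -- itself.
  have hr : ∀ r : ℕ, ∀ e f, ∀ s < N - r,
      bondMoment x y (k + r) e f s = bondMoment x' y' (k + r) e f s := by
    intro r
    induction r with
    | zero => simpa using h
    | succ r ih =>
      intro e f s hs
      have := (bondMoment_shift_congr hv hv' (m := N - (r + 1))
        (fun e f s hs => ih e f s (by omega))).1 e f s hs
      push_cast
      rwa [← add_assoc]
  have hl : ∀ r : ℕ, ∀ e f, ∀ s < N - r,
      bondMoment x y (k - r) e f s = bondMoment x' y' (k - r) e f s := by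
    intro r
    induction r with
    | zero => simpa using h
    | succ r ih =>
      intro e f s hs
      have := (bondMoment_shift_congr hv hv' (m := N - (r + 1))
        (fun e f s hs => ih e f s (by omega))).2 e f s hs
      push_cast
      rwa [← sub_sub]
  rcases le_or_gt k j with hk | hk
  · have e := hr (j - k).toNat
    rw [show k + ((j - k).toNat : ℤ) = j by omega] at e
    have e1 := e false false 0 (by omega)
    have e2 := e true false 0 (by omega)
    simp only [bondMoment, bondA_zero] at e1 e2
    exact ⟨e1, e2⟩
  · have e := hl (k - 1 - j).toNat
    rw [show k - ((k - 1 - j).toNat : ℤ) = j + 1 by omega] at e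
    have e1 := e false true 0 (by omega)
    have e2 := e true true 0 (by omega)
    simp only [bondMoment, bondB_succ_zero] at e1 e2
    exact ⟨e2, e1⟩

end Sites

/-! ### Solutions of the flow generated by two neighbouring sites -/

section Extension

variable {L : Type*} [Field L]

/-- A second order recursion on sites, driven by the Toeplitz flow. -/
noncomputable def siteOrbit (ε : L⟦X⟧) (p q : L⟦X⟧ × L⟦X⟧) :
    ℕ → (L⟦X⟧ × L⟦X⟧) × (L⟦X⟧ × L⟦X⟧)
  | 0 => (p, q)
  | m + 1 => let r := siteOrbit ε p q m
    (r.2, (r.1.1 + ε * (ddt L r.2.1 * (1 - r.2.1 * r.2.2)⁻¹),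
      r.1.2 + ε * (ddt L r.2.2 * (1 - r.2.1 * r.2.2)⁻¹)))

/-- Two neighbouring sites extend to a solution of the flow, as long as no `v` vanishes at the
origin. Smallness of the sites is any property that persists and that prevents this. -/
theorem exists_flow_extension {P : L⟦X⟧ → Prop}
    (hv : ∀ a b, P a → P b → constantCoeff (1 - a * b) ≠ 0)
    (hstep : ∀ a b c, P a → P b → P c →
      P (c + ddt L a * (1 - a * b)⁻¹) ∧ P (c - ddt L a * (1 - a * b)⁻¹))
    (k : ℤ) (p q : L⟦X⟧ × L⟦X⟧) (hp : P p.1 ∧ P p.2) (hq : P q.1 ∧ P q.2) :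
    ∃ x y : ℤ → L⟦X⟧, (∀ j, FlowAt (ddt L) x y j) ∧ (∀ j, P (x j) ∧ P (y j)) ∧
      (x (k - 1) = p.1 ∧ y (k - 1) = p.2) ∧ (x k = q.1 ∧ y k = q.2) := by
  have hP : ∀ ε : L⟦X⟧, ε = 1 ∨ ε = -1 → ∀ p q : L⟦X⟧ × L⟦X⟧, (P p.1 ∧ P p.2) → (P q.1 ∧ P q.2) →
      ∀ m, (P (siteOrbit ε p q m).1.1 ∧ P (siteOrbit ε p q m).1.2) ∧
        (P (siteOrbit ε p q m).2.1 ∧ P (siteOrbit ε p q m).2.2) := by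
    intro ε hε p q hp hq m
    induction m with
    | zero => exact ⟨hp, hq⟩
    | succ m ih =>
      refine ⟨ih.2, ?_⟩
      obtain ⟨⟨h1, h2⟩, h3, h4⟩ := ih
      have a1 := hstep _ _ _ h3 h4 h1
      have a2 := hstep _ _ _ h4 h3 h2
      rw [mul_comm (siteOrbit ε p q m).2.2] at a2
      rcases hε with h | h
      · simp only [siteOrbit]
        simp only [h, one_mul] at a1 a2 ⊢
        exact ⟨a1.1, a2.1⟩
      · simp only [siteOrbit]
        simp only [h, neg_one_mul, ← sub_eq_add_neg] at a1 a2 ⊢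
        exact ⟨a1.2, a2.2⟩
  -- `s` starts at the site `k - 1` and runs to the right, `t` starts at the site `k` and runs to
  -- the left; they share these two sites.
  set s : ℕ → L⟦X⟧ × L⟦X⟧ := fun m => (siteOrbit 1 p q m).1 with hs
  set t : ℕ → L⟦X⟧ × L⟦X⟧ := fun m => (siteOrbit (-1) q p m).1 with ht
  have hs1 : ∀ m, s (m + 1) = (siteOrbit 1 p q m).2 := fun m => rfl
  have ht1 : ∀ m, t (m + 1) = (siteOrbit (-1) q p m).2 := fun m => rfl
  have s0 : s 0 = p := rfl
  have s1 : s 1 = q := rfl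
  have t0 : t 0 = q := rfl
  have t1 : t 1 = p := rfl
  have sP : ∀ m, P (s m).1 ∧ P (s m).2 := fun m => (hP 1 (Or.inl rfl) p q hp hq m).1
  have tP : ∀ m, P (t m).1 ∧ P (t m).2 := fun m => (hP (-1) (Or.inr rfl) q p hq hp m).1
  have sstep : ∀ m, s (m + 2) =
      ((s m).1 + ddt L (s (m + 1)).1 * (1 - (s (m + 1)).1 * (s (m + 1)).2)⁻¹,
        (s m).2 + ddt L (s (m + 1)).2 * (1 - (s (m + 1)).1 * (s (m + 1)).2)⁻¹) := by
    intro m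
    rw [hs1 (m + 1), siteOrbit]
    simp only [one_mul]
    rfl
  have tstep : ∀ m, t (m + 2) =
      ((t m).1 - ddt L (t (m + 1)).1 * (1 - (t (m + 1)).1 * (t (m + 1)).2)⁻¹,
        (t m).2 - ddt L (t (m + 1)).2 * (1 - (t (m + 1)).1 * (t (m + 1)).2)⁻¹) := by
    intro m
    rw [ht1 (m + 1), siteOrbit]
    simp only [neg_one_mul, ← sub_eq_add_neg]
    rfl
  set w : ℤ → L⟦X⟧ × L⟦X⟧ := fun j =>
    if k - 1 ≤ j then s (j - k + 1).toNat else t (k - j).toNat with hw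
  have ws : ∀ m : ℕ, w (k - 1 + m) = s m := by
    intro m
    simp only [hw]
    rw [if_pos (by omega)]
    congr 1
    omega
  have wt : ∀ m : ℕ, w (k - m) = t m := by
    intro m
    simp only [hw]
    split_ifs with h
    · rcases (by omega : m = 0 ∨ m = 1) with rfl | rfl
      · rw [t0, ← s1]; congr 1; omega
      · rw [t1, ← s0]; congr 1; omega
    · congr 1
      omega
  have cancel : ∀ a b d : L⟦X⟧, P a → P b → d = (1 - a * b) * (d * (1 - a * b)⁻¹) := by
    intro a b d ha hb
    rw [mul_left_comm, PowerSeries.mul_inv_cancel _ (hv a b ha hb), mul_one]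
  refine ⟨fun j => (w j).1, fun j => (w j).2, fun j => ?_, fun j => ?_, ?_, ?_⟩
  · simp only [FlowAt, toeplitzV]
    rcases le_or_gt k j with h | h
    · obtain ⟨m, rfl⟩ : ∃ m : ℕ, j = k - 1 + (m + 1 : ℕ) := ⟨(j - k).toNat, by omega⟩
      have e1 : k - 1 + ((m + 1 : ℕ) : ℤ) + 1 = k - 1 + (m + 2 : ℕ) := by push_cast; ring
      have e2 : k - 1 + ((m + 1 : ℕ) : ℤ) - 1 = k - 1 + m := by push_cast; ring
      rw [e1, e2, ws, ws, ws, sstep]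
      simp only [add_sub_cancel_left]
      exact ⟨cancel _ _ _ (sP _).1 (sP _).2, cancel _ _ _ (sP _).1 (sP _).2⟩
    · obtain ⟨m, rfl⟩ : ∃ m : ℕ, j = k - (m + 1 : ℕ) := ⟨(k - 1 - j).toNat, by omega⟩
      have e1 : k - ((m + 1 : ℕ) : ℤ) + 1 = k - m := by push_cast; ring
      have e2 : k - ((m + 1 : ℕ) : ℤ) - 1 = k - (m + 2 : ℕ) := by push_cast; ring
      rw [e1, e2, wt, wt, wt, tstep]
      simp only [sub_sub_cancel]
      exact ⟨cancel _ _ _ (tP _).1 (tP _).2, cancel _ _ _ (tP _).1 (tP _).2⟩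
  · simp only [hw]
    split_ifs
    · exact sP _
    · exact tP _
  · have := ws 0
    simp only [Nat.cast_zero, add_zero] at this
    simp only [this, s0, and_self]
  · have := wt 0
    simp only [Nat.cast_zero, sub_zero] at this
    simp only [this, t0, and_self]

end Extension

/-! ### Small fractions -/

section Small

variable {A L : Type*} [CommRing A] [Field L] [Algebra A L]
  {F : Type*} [Field F]

/-- Fractions whose numerator, but not the denominator, is killed by a homomorphism. -/
def IsSmall (L : Type*) [Field L] [Algebra A L] (ε : A →+* F) (z : L) : Prop :=
  ∃ a b : A, ε a = 0 ∧ ε b ≠ 0 ∧ z * algebraMap A L b = algebraMap A L a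

variable {ε : A →+* F}

theorem IsSmall.of_ker {a : A} (h : ε a = 0) : IsSmall L ε (algebraMap A L a) :=
  ⟨a, 1, h, by simp, by simp⟩

theorem IsSmall.add {z w : L} (hz : IsSmall L ε z) (hw : IsSmall L ε w) : IsSmall L ε (z + w) := by
  obtain ⟨a, b, ha, hb, h⟩ := hz
  obtain ⟨a', b', ha', hb', h'⟩ := hw
  refine ⟨a * b' + a' * b, b * b', by simp [ha, ha'], by simp [hb, hb'], ?_⟩
  simp only [map_mul, map_add]
  linear_combination (algebraMap A L b') * h + (algebraMap A L b) * h'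

theorem IsSmall.mul {z w : L} (hz : IsSmall L ε z) (hw : IsSmall L ε w) : IsSmall L ε (z * w) := by
  obtain ⟨a, b, ha, hb, h⟩ := hz
  obtain ⟨a', b', ha', hb', h'⟩ := hw
  refine ⟨a * a', b * b', by simp [ha], by simp [hb, hb'], ?_⟩
  simp only [map_mul]
  rw [← h, ← h']
  ring

theorem IsSmall.map_mul {z : L} (hz : IsSmall L ε z) (c : A) :
    IsSmall L ε (z * algebraMap A L c) := by
  obtain ⟨a, b, ha, hb, h⟩ := hz
  refine ⟨a * c, b, by simp [ha], hb, ?_⟩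
  rw [_root_.map_mul, ← h]
  ring

theorem IsSmall.neg {z : L} (hz : IsSmall L ε z) : IsSmall L ε (-z) := by
  have := hz.map_mul (-1)
  simpa using this

theorem IsSmall.zero : IsSmall L ε (0 : L) := ⟨0, 1, by simp, by simp, by simp⟩

theorem IsSmall.sum {ι : Type*} {s : Finset ι} {f : ι → L} (h : ∀ i ∈ s, IsSmall L ε (f i)) :
    IsSmall L ε (∑ i ∈ s, f i) := by
  classical
  induction s using Finset.induction_on with
  | empty => simpa using IsSmall.zero
  | insert i s hi ih =>
    rw [Finset.sum_insert hi]
    exact (h i (Finset.mem_insert_self i s)).add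
      (ih fun j hj => h j (Finset.mem_insert_of_mem hj))

/-- This is the purpose of smallness: `1 - x y` cannot vanish at small sites. -/
theorem IsSmall.one_sub_ne_zero [IsFractionRing A L] {z : L} (hz : IsSmall L ε z) : 1 - z ≠ 0 := by
  obtain ⟨a, b, ha, hb, h⟩ := hz
  intro h1
  rw [← sub_eq_zero.mp h1, one_mul] at h
  rw [IsFractionRing.injective A L h] at hb
  exact hb ha

theorem IsSmall.of_mul_one_sub {z w : L} (hz : IsSmall L ε z) (h : IsSmall L ε (w * (1 - z))) :
    IsSmall L ε w := by
  obtain ⟨a, b, ha, hb, h0⟩ := hz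
  obtain ⟨a', b', ha', hb', h'⟩ := h
  refine ⟨a' * b, b' * (b - a), by simp [ha'], ?_, ?_⟩
  · rw [_root_.map_mul, map_sub, ha, sub_zero]
    exact mul_ne_zero hb' hb
  · rw [_root_.map_mul, _root_.map_mul, ← h', map_sub, ← h0]
    ring

/-- Let `w` be the quotient. In the coefficient of `t^m` of `w (1 - a b) = a'`, the unknown
coefficient of `w` is multiplied by one minus a small element, which `IsSmall.of_mul_one_sub`
removes; the other terms are small by induction. -/
theorem isSmall_extension_step [IsFractionRing A L] {a b c : L⟦X⟧} (ha : ∀ m, IsSmall L ε (coeff m a))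
    (hb : ∀ m, IsSmall L ε (coeff m b)) (hc : ∀ m, IsSmall L ε (coeff m c)) :
    (∀ m, IsSmall L ε (coeff m (c + ddt L a * (1 - a * b)⁻¹))) ∧
      ∀ m, IsSmall L ε (coeff m (c - ddt L a * (1 - a * b)⁻¹)) := by
  have hmul : ∀ f g : L⟦X⟧, (∀ m, IsSmall L ε (coeff m f)) → (∀ m, IsSmall L ε (coeff m g)) →
      ∀ m, IsSmall L ε (coeff m (f * g)) := by
    intro f g hf hg m
    rw [coeff_mul]
    exact IsSmall.sum fun i _ => (hf _).mul (hg _)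
  have hab := hmul a b ha hb
  have h0 : constantCoeff (1 - a * b) ≠ 0 := by
    rw [map_sub, map_one, ← coeff_zero_eq_constantCoeff_apply]
    exact (hab 0).one_sub_ne_zero
  set w := ddt L a * (1 - a * b)⁻¹ with hw
  have hwm : w * (1 - a * b) = ddt L a := by
    rw [hw, mul_assoc, PowerSeries.inv_mul_cancel _ h0, mul_one]
  clear_value w
  have hsm : ∀ m, IsSmall L ε (coeff m w) := by
    intro m
    induction m using Nat.strong_induction_on with
    | _ m ih =>
      refine (hab 0).of_mul_one_sub ?_
      have h := congrArg (coeff m) hwm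
      rw [mul_sub, mul_one, map_sub, coeff_mul, coeff_ddt, ← Finset.sum_erase_add _ _
        (show (m, 0) ∈ Finset.HasAntidiagonal.antidiagonal m by simp)] at h
      have hd : IsSmall L ε (coeff (m + 1) a * ((m : L) + 1)) := by
        simpa using (ha (m + 1)).map_mul ((m : A) + 1)
      have hs : IsSmall L ε (∑ p ∈ (Finset.HasAntidiagonal.antidiagonal m).erase (m, 0),
          coeff p.1 w * coeff p.2 (a * b)) := by
        refine IsSmall.sum fun p hp => ?_
        rw [Finset.mem_erase, Finset.HasAntidiagonal.mem_antidiagonal] at hp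
        refine (ih p.1 ?_).mul (hab _)
        rcases lt_or_eq_of_le (show p.1 ≤ m by omega) with h | h
        · exact h
        · exact absurd (Prod.ext h (by simp only; omega)) hp.1
      have := hd.add hs
      rw [← h] at this
      convert this using 1
      simp only
      ring
  constructor
  · intro m
    rw [map_add]
    exact (hc m).add (hsm m)
  · intro m
    rw [map_sub, sub_eq_add_neg]
    exact (hc m).add (hsm m).neg

end Small

/-! ### Existence of power series solutions satisfying the recursion relations -/

section Existence

variable {F : Type*} [Field F]

/-- The time dependent coefficients of the recursion relations, as power series. -/
noncomputable def seriesU (S : Type*) [CommRing S] [Algebra F S] (u : ℤ → F) (i : ℤ) : S⟦X⟧ :=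
  C (algebraMap F S (u i)) + if i = 1 ∨ i = -1 then X else 0

/-- The inverse of the top coefficients of the recursion relations. -/
noncomputable def seriesC (S : Type*) [CommRing S] [Algebra F S] (N : ℕ) (u : ℤ → F) (e : Bool) :
    S⟦X⟧ := C (algebraMap F S (signedU u e (N - 1))⁻¹)

theorem map_seriesU {S S' : Type*} [CommRing S] [CommRing S'] [Algebra F S] [Algebra F S']
    (g : S →ₐ[F] S') (u : ℤ → F) (i : ℤ) :
    PowerSeries.map (g : S →+* S') (seriesU S u i) = seriesU S' u i := by
  rw [seriesU, seriesU, map_add, map_C]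
  split_ifs <;> simp

theorem map_signedU {S S' : Type*} [CommRing S] [CommRing S'] [Algebra F S] [Algebra F S']
    (g : S →ₐ[F] S') (u : ℤ → F) (e : Bool) (s : ℕ) :
    PowerSeries.map (g : S →+* S') (signedU (seriesU S u) e s) = signedU (seriesU S' u) e s := by
  simp only [signedU]
  split_ifs <;> rw [map_seriesU]

theorem map_seriesC {S S' : Type*} [CommRing S] [CommRing S'] [Algebra F S] [Algebra F S']
    (g : S →ₐ[F] S') (N : ℕ) (u : ℤ → F) (e : Bool) :
    PowerSeries.map (g : S →+* S') (seriesC S N u e) = seriesC S' N u e := by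
  simp [seriesC]

theorem seriesC_mul {S : Type*} [CommRing S] [Algebra F S] {N : ℕ} (hN : 2 ≤ N) {u : ℤ → F}
    (hu : ∀ e, signedU u e (N - 1) ≠ 0) (e : Bool) :
    seriesC S N u e * signedU (seriesU S u) e (N - 1) = 1 := by
  have h : signedU (seriesU S u) e (N - 1) = C (algebraMap F S (signedU u e (N - 1))) := by
    simp only [signedU, seriesU]
    cases e
    · simp only [Bool.false_eq_true, if_false]
      rw [if_neg (by omega), add_zero]
    · simp only [if_true]
      rw [if_neg (by omega), add_zero]
  rw [h, seriesC, ← map_mul, ← map_mul, inv_mul_cancel₀ (hu e), map_one, map_one]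

theorem ddt_seriesU {S : Type*} [CommRing S] [Algebra F S] (u : ℤ → F) (i : ℤ) :
    ddt S (seriesU S u i) = if i = 1 ∨ i = -1 then 1 else 0 := by
  ext m
  rw [coeff_ddt, seriesU, map_add, coeff_C, if_neg (Nat.succ_ne_zero m)]
  split_ifs
  · rw [zero_add, coeff_X, coeff_one]
    split_ifs with h1 h2 h2
    · simp [h2]
    · omega
    · omega
    · simp
  · simp

/-- Formal solutions of the flow on which the recursion relations hold. -/
structure IsGammaSolution {L : Type*} [Field L] [Algebra F L] (N : ℕ) (u : ℤ → F)
    (x y : ℤ → L⟦X⟧) : Prop where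
  flow : ∀ k, FlowAt (ddt L) x y k
  v_ne : ∀ k, constantCoeff (toeplitzV x y k) ≠ 0
  gamma : ∀ k, toeplitzGamma N (seriesU L u) x y k = 0 ∧
    toeplitzGammaTilde N (seriesU L u) x y k = 0

theorem exists_bond_integral {S : Type*} [CommRing S] [Algebra F S] [CharZero F] (N : ℕ) (u : ℤ → F)
    (k : ℤ) (z₀ : Bool → Bool → ℕ → S) : ∃ z : Bool → Bool → ℕ → S⟦X⟧,
      (∀ e f s, constantCoeff (z e f s) = z₀ e f s) ∧
      ∀ e f s, ddt S (z e f s) = bondField N (seriesC S N u) (signedU (seriesU S u)) k z e f s := by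
  obtain ⟨z, h0, hz⟩ := exists_ode_solution F
    (bondField_congr N (seriesC S N u) (signedU (seriesU S u)) k)
    (fun i : Bool × Bool × ℕ => z₀ i.1 i.2.1 i.2.2)
  exact ⟨fun e f s => z (e, f, s), fun e f s => h0 (e, f, s), fun e f s => hz (e, f, s)⟩

theorem bond_integral_unique {S : Type*} [CommRing S] [IsDomain S] [CharZero S] [Algebra F S]
    {N : ℕ} {u : ℤ → F} {k : ℤ} {z z' : Bool → Bool → ℕ → S⟦X⟧}
    (h0 : ∀ e f s, constantCoeff (z e f s) = constantCoeff (z' e f s))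
    (hz : ∀ e f s, ddt S (z e f s) =
      bondField N (seriesC S N u) (signedU (seriesU S u)) k z e f s)
    (hz' : ∀ e f s, ddt S (z' e f s) =
      bondField N (seriesC S N u) (signedU (seriesU S u)) k z' e f s) : z = z' := by
  have := ode_unique (bondField_congr N (seriesC S N u) (signedU (seriesU S u)) k)
    (z := fun i => z i.1 i.2.1 i.2.2) (z' := fun i => z' i.1 i.2.1 i.2.2)
    (fun i => h0 _ _ _) (fun i => hz _ _ _) (fun i => hz' _ _ _)
  funext e f s
  exact congrFun this (e, f, s)

theorem map_bond_integral {S S' : Type*} [CommRing S] [CommRing S'] [Algebra F S] [Algebra F S']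
    (g : S →ₐ[F] S') {N : ℕ} {u : ℤ → F} {k : ℤ} {z : Bool → Bool → ℕ → S⟦X⟧}
    (hz : ∀ e f s, ddt S (z e f s) =
      bondField N (seriesC S N u) (signedU (seriesU S u)) k z e f s) (e f : Bool) (s : ℕ) :
    ddt S' (PowerSeries.map (g : S →+* S') (z e f s)) =
      bondField N (seriesC S' N u) (signedU (seriesU S' u)) k
        (fun e f s => PowerSeries.map (g : S →+* S') (z e f s)) e f s := by
  rw [ddt_map, hz, map_bondField]
  simp only [map_signedU, map_seriesC]

theorem flowAt_v_ne {L : Type*} [Field L] {x y : ℤ → L⟦X⟧}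
    (h : ∀ k, constantCoeff (toeplitzV x y k) ≠ 0) (k : ℤ) : toeplitzV x y k ≠ 0 := by
  intro h0
  apply h k
  rw [h0, map_zero]

theorem bondGamma_all {T : Type*} [CommRing T] {N : ℕ} {u x y : ℤ → T}
    (h : ∀ k, toeplitzGamma N u x y k = 0 ∧ toeplitzGammaTilde N u x y k = 0) (k : ℤ)
    (e f : Bool) : bondGamma N u x y k e f = 0 := by
  cases e <;> cases f
  exacts [(h k).1, (h (k - 1)).2, (h k).2, (h (k - 1)).1]

/-- The moments are integrated over `A` from the initial values given by the window. Under `ε` the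
curve becomes the one through zero, which is constant, so all its coefficients are killed by `ε`.
Its entries of order zero are therefore small sites over `L` and extend to a solution of the flow
with all `v` invertible; `bondMoment_eq_of_integral` supplies the relations at the bond. -/
theorem exists_isGammaSolution [CharZero F] {A L : Type*} [CommRing A] [IsDomain A] [Algebra F A]
    [Field L] [Algebra A L] [IsFractionRing A L] [Algebra F L] [IsScalarTower F A L]
    (ε : A →ₐ[F] F) {N : ℕ} (hN : 2 ≤ N) {u : ℤ → F} (hu : ∀ e, signedU u e (N - 1) ≠ 0)
    (xW yW : ℤ → A) (hx : ∀ j, ε (xW j) = 0) (hy : ∀ j, ε (yW j) = 0) (k : ℤ) :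
    ∃ x y : ℤ → L⟦X⟧, IsGammaSolution N u x y ∧
      (∀ e f, ∀ s < N, constantCoeff (bondMoment x y k e f s) =
        algebraMap A L (bondMoment xW yW k e f s)) ∧
      ∀ j, k - N ≤ j ∧ j ≤ k + N - 1 → constantCoeff (x j) = algebraMap A L (xW j) ∧
        constantCoeff (y j) = algebraMap A L (yW j) := by
  obtain ⟨z, h0, hz⟩ := exists_bond_integral N u k
    (fun e f s => if s < N then bondMoment xW yW k e f s else 0)
  have hzero : (fun e f s => PowerSeries.map (ε : A →+* F) (z e f s)) = fun _ _ _ => 0 := by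
    refine bond_integral_unique (fun e f s => ?_) (map_bond_integral ε hz) (fun e f s => ?_)
    · rw [← coeff_zero_eq_constantCoeff_apply, coeff_map, coeff_zero_eq_constantCoeff_apply, h0]
      split_ifs
      · rw [map_bondMoment]
        simp [hx, hy, bondMoment_zero]
      · simp
    · rw [bondField_zero, map_zero]
  have hzs : ∀ e f s m, ε (coeff m (z e f s)) = 0 := by
    intro e f s m
    have := congrArg (coeff m) (congrFun (congrFun (congrFun hzero e) f) s)
    simpa using this
  set j : A →ₐ[F] L := IsScalarTower.toAlgHom F A L with hj
  have hjA : ∀ a, j a = algebraMap A L a := fun a => rfl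
  set zL : Bool → Bool → ℕ → L⟦X⟧ := fun e f s => PowerSeries.map (j : A →+* L) (z e f s) with hzL
  have hsm : ∀ e f s m, IsSmall L (ε : A →+* F) (coeff m (zL e f s)) := fun e f s m => by
    rw [hzL, coeff_map]
    exact IsSmall.of_ker (hzs e f s m)
  obtain ⟨x, y, hf, hP, ⟨p1, p2⟩, q1, q2⟩ := exists_flow_extension
    (P := fun a : L⟦X⟧ => ∀ m, IsSmall L (ε : A →+* F) (coeff m a))
    (fun a b ha hb => by
      rw [map_sub, map_one, map_mul]
      have h1 := (ha 0).mul (hb 0)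
      rw [coeff_zero_eq_constantCoeff_apply, coeff_zero_eq_constantCoeff_apply] at h1
      exact h1.one_sub_ne_zero)
    (fun a b c ha hb hc => isSmall_extension_step ha hb hc) k
    -- In order zero the moments indexed `true true`, `false true`, `false false`, `true false` are
    -- `x (k - 1)`, `y (k - 1)`, `x k`, `y k`.
    (zL true true 0, zL false true 0) (zL false false 0, zL true false 0)
    ⟨hsm _ _ _, hsm _ _ _⟩ ⟨hsm _ _ _, hsm _ _ _⟩
  have hv : ∀ k, constantCoeff (toeplitzV x y k) ≠ 0 := fun k => by
    rw [toeplitzV, map_sub, map_one, map_mul]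
    have h1 := ((hP k).1 0).mul ((hP k).2 0)
    rw [coeff_zero_eq_constantCoeff_apply, coeff_zero_eq_constantCoeff_apply] at h1
    exact h1.one_sub_ne_zero
  obtain ⟨hM, hG⟩ := bondMoment_eq_of_integral (z := zL) hf (flowAt_v_ne hv) (by omega : 0 < N)
    (seriesC_mul (S := L) hN hu) (fun e f s _ => map_bond_integral j hz e f s) (fun e f => by
      cases e <;> cases f <;>
        simp only [bondMoment, bondA_zero, bondB_zero, p1, p2, q1, q2])
  have hgam := gamma_eq_zero_of_bond (by omega : 0 < N) (fun i => ddt_seriesU u i) hf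
    (flowAt_v_ne hv) (k₀ := k) ⟨hG true true, hG false true⟩ ⟨hG false false, hG true false⟩
  have hmom : ∀ e f, ∀ s < N, constantCoeff (bondMoment x y k e f s) =
      algebraMap A L (bondMoment xW yW k e f s) := fun e f s hs => by
    rw [hM e f s hs, hzL, ← coeff_zero_eq_constantCoeff_apply, coeff_map,
      coeff_zero_eq_constantCoeff_apply, h0, if_pos hs]
    rfl
  refine ⟨x, y, ⟨hf, hv, hgam⟩, hmom, ?_⟩
  refine site_eq_of_bondMoment (fun k => ?_) (fun k => ?_) (fun e f s hs => ?_)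
  · rw [← map_toeplitzV]; exact hv k
  · rw [← map_toeplitzV]
    have : IsSmall L (ε : A →+* F) (algebraMap A L (xW k * yW k)) :=
      IsSmall.of_ker (by simp [hx])
    rw [toeplitzV, map_sub, map_one]
    exact this.one_sub_ne_zero
  · rw [← map_bondMoment, ← map_bondMoment, hmom e f s hs]

end Existence

/-! ### Coefficients in a subalgebra and the polynomial rings at the bonds -/

section Regular

variable {F L : Type*} [Field F] [Field L] [Algebra F L]

/-- The power series with coefficients in a subalgebra. -/
def regular (O : Subalgebra F L) : Subring L⟦X⟧ where
  carrier := {f | ∀ m, coeff m f ∈ O}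
  mul_mem' := fun {a b} ha hb m => by
    rw [coeff_mul]
    exact sum_mem fun i _ => mul_mem (ha _) (hb _)
  one_mem' := fun m => by
    rw [coeff_one]
    split_ifs
    exacts [one_mem _, zero_mem _]
  add_mem' := fun {a b} ha hb m => by
    rw [map_add]
    exact add_mem (ha m) (hb m)
  zero_mem' := fun m => by
    rw [map_zero]
    exact zero_mem _
  neg_mem' := fun {a} ha m => by
    rw [map_neg]
    exact neg_mem (ha m)

theorem constantCoeff_mem {O : Subalgebra F L} {f : L⟦X⟧} (h : f ∈ regular O) :
    constantCoeff f ∈ O := by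
  rw [← coeff_zero_eq_constantCoeff_apply]
  exact h 0

theorem ddt_mem_regular {O : Subalgebra F L} {f : L⟦X⟧} (h : f ∈ regular O) :
    ddt L f ∈ regular O := fun m => by
  rw [coeff_ddt]
  exact mul_mem (h _) (add_mem (natCast_mem _ _) (one_mem _))

theorem inv_mem_regular {O : Subalgebra F L} {f : L⟦X⟧} (h : f ∈ regular O)
    (h0 : (constantCoeff f)⁻¹ ∈ O) : f⁻¹ ∈ regular O := fun m => by
  induction m using Nat.strong_induction_on with
  | _ m ih =>
    rw [PowerSeries.coeff_inv]
    split_ifs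
    · exact h0
    · refine mul_mem (neg_mem h0) (sum_mem fun p _ => ?_)
      split_ifs with hp
      · exact mul_mem (h _) (ih _ hp)
      · exact zero_mem _

theorem map_mem_regular {O : Subalgebra F L} (f : O⟦X⟧) :
    PowerSeries.map (O.val : O →+* L) f ∈ regular O := fun m => by
  rw [coeff_map]
  exact (coeff m f).2

theorem regular_mono {O O' : Subalgebra F L} (h : O ≤ O') : regular O ≤ regular O' :=
  fun _ hf m => h (hf m)

/-- The sites adjacent to a bond are regular. -/
def BondRegular (O : Subalgebra F L) (x y : ℤ → L⟦X⟧) (k : ℤ) : Prop :=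
  (x (k - 1) ∈ regular O ∧ y (k - 1) ∈ regular O) ∧ (x k ∈ regular O ∧ y k ∈ regular O)

/-- The algebra generated by the initial moments at a bond. -/
noncomputable def bondAlg (F : Type*) {L : Type*} [Field F] [Field L] [Algebra F L] (N : ℕ)
    (x y : ℤ → L⟦X⟧) (k : ℤ) : Subalgebra F L :=
  Algebra.adjoin F (Set.range fun i : Bool × Bool × Fin N =>
    constantCoeff (bondMoment x y k i.1 i.2.1 i.2.2))

variable {N : ℕ} {u : ℤ → F} {x y : ℤ → L⟦X⟧}

theorem prime_one_sub_X_mul_X {σ : Type*} {i j : σ} (hij : i ≠ j) :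
    Prime (1 - MvPolynomial.X i * MvPolynomial.X j : MvPolynomial σ F) := by
  have h := MvPolynomial.irreducible_mul_X_add (-(MvPolynomial.X i : MvPolynomial σ F)) 1 j
    (neg_ne_zero.mpr (MvPolynomial.X_ne_zero i)) (by simp [MvPolynomial.vars_X, hij.symm])
    (by simp [MvPolynomial.vars_one]) isRelPrime_one_right
  have e : (1 - MvPolynomial.X i * MvPolynomial.X j : MvPolynomial σ F) =
      -(MvPolynomial.X i) * MvPolynomial.X j + 1 := by ring
  rw [e]
  exact h.prime

theorem quadD_mem {R : Type*} [CommRing R] (S : Subring R) {a b : ℕ → R} {n : ℕ}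
    (ha : ∀ i < n, a i ∈ S) (hb : ∀ i < n, b i ∈ S) : ∀ s ≤ n, quadD a b s ∈ S := by
  intro s
  induction s using Nat.strong_induction_on with
  | _ s ih =>
    intro hs
    cases s with
    | zero => rw [quadD_zero]; exact one_mem _
    | succ s =>
      rw [quadD_succ]
      refine sub_mem (neg_mem (sum_mem fun i hi => ?_)) (sum_mem fun i hi => ?_)
      · rw [Finset.mem_range] at hi
        exact mul_mem (ha _ (by omega)) (hb _ (by omega))
      · rw [Finset.mem_range] at hi
        exact mul_mem (ih _ (by omega) (by omega)) (ih _ (by omega) (by omega))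

/-- The derivative of a moment contains the moment of the next order with coefficient one, so all
moments are differential polynomials in the two sites adjacent to the bond. -/
theorem IsGammaSolution.moment_regular (h : IsGammaSolution N u x y) {O : Subalgebra F L} {k : ℤ}
    (hO : BondRegular O x y k) (s : ℕ) : ∀ e f, bondMoment x y k e f s ∈ regular O := by
  have h0 : ∀ e f, bondMoment x y k e f 0 ∈ regular O := by
    intro e f
    cases e <;> cases f <;> simp only [bondMoment, bondA_zero, bondB_zero]
    exacts [hO.2.1, hO.1.2, hO.2.2, hO.1.1]
  induction s using Nat.strong_induction_on with
  | _ s ih =>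
    intro e f
    cases s with
    | zero => exact h0 e f
    | succ s =>
      have hd := deriv_bondMoment h.flow (flowAt_v_ne h.v_ne) k e f s
      have hm : momentField (bondMoment x y k e f 0) (bondMoment x y k (!e) f 0)
          (bondMoment x y k (!e) (!f) 0) (bondMoment x y k e (!f) 0) (bondMoment x y k e f)
          (quadD (bondMoment x y k e f) (bondMoment x y k e (!f))) s ∈ regular O := by
        have := ddt_mem_regular (ih s (by omega) e f)
        rw [hd] at this
        cases f <;> simpa using this
      have hq := quadD_mem (regular O) (n := s + 1) (fun i hi => ih i hi e f)
        (fun i hi => ih i hi e (!f))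
      set m := bondMoment x y k with hmdef
      set q := quadD (m e f) (m e (!f))
      have h2 : ∀ a ∈ regular O, ∀ b ∈ regular O, 2 * a * b ∈ regular O := fun a ha b hb =>
        mul_mem (mul_mem (natCast_mem (regular O) 2) ha) hb
      cases s with
      | zero =>
        simp only [momentField] at hm
        have e1 : m e f 1 = (m e f 1 - 2 * m e f 0 * q 1 +
            (m (!e) (!f) 0 * m (!e) f 0 - m e f 0 * m e (!f) 0) * m e f 0 - m (!e) (!f) 0 * q 0) +
            (2 * m e f 0 * q 1) -
            ((m (!e) (!f) 0 * m (!e) f 0 - m e f 0 * m e (!f) 0) * m e f 0) +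
            m (!e) (!f) 0 * q 0 := by ring
        rw [zero_add, e1]
        exact add_mem (sub_mem (add_mem hm (h2 _ (h0 _ _) _ (hq 1 (by omega))))
          (mul_mem (sub_mem (mul_mem (h0 _ _) (h0 _ _)) (mul_mem (h0 _ _) (h0 _ _))) (h0 _ _)))
          (mul_mem (h0 _ _) (hq 0 (by omega)))
      | succ s =>
        simp only [momentField] at hm
        have e1 : m e f (s + 1 + 1) = (m e f (s + 2) - 2 * m e f 0 * q (s + 2) +
            (m (!e) (!f) 0 * m (!e) f 0 - m e f 0 * m e (!f) 0) * m e f (s + 1) -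
            m (!e) (!f) 0 * q (s + 1) - (m e f s + m (!e) (!f) 0 * q (s + 1))) +
            (2 * m e f 0 * q (s + 2)) -
            ((m (!e) (!f) 0 * m (!e) f 0 - m e f 0 * m e (!f) 0) * m e f (s + 1)) +
            m (!e) (!f) 0 * q (s + 1) + (m e f s + m (!e) (!f) 0 * q (s + 1)) := by ring
        rw [e1]
        exact add_mem (add_mem (sub_mem (add_mem hm (h2 _ (h0 _ _) _ (hq _ (by omega))))
          (mul_mem (sub_mem (mul_mem (h0 _ _) (h0 _ _)) (mul_mem (h0 _ _) (h0 _ _)))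
            (ih _ (by omega) _ _))) (mul_mem (h0 _ _) (hq _ (by omega))))
          (add_mem (ih _ (by omega) _ _) (mul_mem (h0 _ _) (hq _ (by omega))))

/-- Regularity of the sites next to a bond is decided by the initial moments. -/
theorem IsGammaSolution.bondRegular_iff [CharZero F] (h : IsGammaSolution N u x y) (hN : 2 ≤ N)
    (hu : ∀ e, signedU u e (N - 1) ≠ 0) {O : Subalgebra F L} {k : ℤ} :
    BondRegular O x y k ↔ bondAlg F N x y k ≤ O := by
  constructor
  · intro hO
    refine Algebra.adjoin_le ?_
    rintro _ ⟨i, rfl⟩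
    exact constantCoeff_mem (h.moment_regular hO _ _ _)
  · intro hO
    have hmem : ∀ e f, ∀ s < N, constantCoeff (bondMoment x y k e f s) ∈ O := fun e f s hs =>
      hO (Algebra.subset_adjoin ⟨(e, f, ⟨s, hs⟩), rfl⟩)
    have : CharZero L := charZero_of_injective_algebraMap (algebraMap F L).injective
    -- The curve integrated over `O` has the same initial values, so by uniqueness it is the curve
    -- of moments.
    obtain ⟨z, h0, hz⟩ := exists_bond_integral (S := O) N u k
      (fun e f s => if hs : s < N then ⟨_, hmem e f s hs⟩ else 0)
    have huniq := bond_integral_unique (S := L)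
      (z' := fun e f s => PowerSeries.map (O.val : O →+* L) (z e f s))
      (fun e f s => ?_) (deriv_bondMoment_eq_bondField h.flow (flowAt_v_ne h.v_ne)
        (by omega : 0 < N) (seriesC_mul (S := L) hN hu) (bondGamma_all h.gamma k) _ rfl)
      (map_bond_integral O.val hz)
    · have hr : ∀ e f, bondMoment x y k e f 0 ∈ regular O := by
        intro e f
        have e1 := congrFun (congrFun (congrFun huniq e) f) 0
        simp only [if_pos (by omega : 0 < N)] at e1
        rw [e1]
        exact map_mem_regular _
      have h1 := hr false false
      have h2 := hr false true
      have h3 := hr true false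
      have h4 := hr true true
      simp only [bondMoment, bondA_zero, bondB_zero] at h1 h2 h3 h4
      exact ⟨⟨h4, h2⟩, h1, h3⟩
    · rw [← coeff_zero_eq_constantCoeff_apply (PowerSeries.map _ _), coeff_map,
        coeff_zero_eq_constantCoeff_apply, h0]
      split_ifs with hs
      · rfl
      · simp

theorem BondRegular.succ (h : IsGammaSolution N u x y) {O : Subalgebra F L} {k : ℤ}
    (hO : BondRegular O x y k) (hv : (constantCoeff (toeplitzV x y k))⁻¹ ∈ O) :
    BondRegular O x y (k + 1) := by
  have hvr : toeplitzV x y k ∈ regular O := sub_mem (one_mem _) (mul_mem hO.2.1 hO.2.2)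
  have hvi := inv_mem_regular hvr hv
  have e : ∀ a b d : L⟦X⟧, d = toeplitzV x y k * (a - b) → a = b + d * (toeplitzV x y k)⁻¹ := by
    intro a b d hd
    rw [hd, mul_right_comm, PowerSeries.mul_inv_cancel _ (h.v_ne k), one_mul]
    ring
  refine ⟨by rw [add_sub_cancel_right]; exact hO.2, ?_⟩
  rw [e _ _ _ (h.flow k).1, e _ _ _ (h.flow k).2]
  exact ⟨add_mem hO.1.1 (mul_mem (ddt_mem_regular hO.2.1) hvi),
    add_mem hO.1.2 (mul_mem (ddt_mem_regular hO.2.2) hvi)⟩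

theorem BondRegular.pred (h : IsGammaSolution N u x y) {O : Subalgebra F L} {k : ℤ}
    (hO : BondRegular O x y (k + 1)) (hv : (constantCoeff (toeplitzV x y k))⁻¹ ∈ O) :
    BondRegular O x y k := by
  rw [BondRegular, add_sub_cancel_right] at hO
  have hvr : toeplitzV x y k ∈ regular O := sub_mem (one_mem _) (mul_mem hO.1.1 hO.1.2)
  have hvi := inv_mem_regular hvr hv
  have e : ∀ a b d : L⟦X⟧, d = toeplitzV x y k * (a - b) → b = a - d * (toeplitzV x y k)⁻¹ := by
    intro a b d hd
    rw [hd, mul_right_comm, PowerSeries.mul_inv_cancel _ (h.v_ne k), one_mul]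
    ring
  refine ⟨?_, hO.1⟩
  rw [e _ _ _ (h.flow k).1, e _ _ _ (h.flow k).2]
  exact ⟨sub_mem hO.2.1 (mul_mem (ddt_mem_regular hO.1.1) hvi),
    sub_mem hO.2.2 (mul_mem (ddt_mem_regular hO.1.2) hvi)⟩

/-- A solution whose initial values generate a field of transcendence degree `4 N`. -/
structure IsGenericSolution (N : ℕ) (u : ℤ → F) (x y : ℤ → L⟦X⟧) : Prop
    extends IsGammaSolution N u x y where
  two_le : 2 ≤ N
  top_ne : ∀ e, signedU u e (N - 1) ≠ 0
  gen : ∀ E : IntermediateField F L,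
    (∀ j, constantCoeff (x j) ∈ E ∧ constantCoeff (y j) ∈ E) → E = ⊤
  trdeg : ((4 * N : ℕ) : Cardinal) ≤ Algebra.trdeg F L

variable [CharZero F]

theorem IsGenericSolution.bondRegular_iff (h : IsGenericSolution N u x y) {O : Subalgebra F L}
    {k : ℤ} : BondRegular O x y k ↔ bondAlg F N x y k ≤ O :=
  h.toIsGammaSolution.bondRegular_iff h.two_le h.top_ne

/-- In a field the nonzero initial values of all `v` are invertible, so regularity spreads from one
bond to every site. -/
theorem IsGenericSolution.intermediateField_eq_top (h : IsGenericSolution N u x y)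
    (E : IntermediateField F L) (k : ℤ) (hE : bondAlg F N x y k ≤ E.toSubalgebra) : E = ⊤ := by
  have hk := h.bondRegular_iff.mpr hE
  have hv : ∀ j, constantCoeff (x j) ∈ E ∧ constantCoeff (y j) ∈ E →
      (constantCoeff (toeplitzV x y j))⁻¹ ∈ E.toSubalgebra := by
    intro j hj
    refine E.inv_mem ?_
    rw [toeplitzV, map_sub, map_one, map_mul]
    exact sub_mem (one_mem _) (mul_mem hj.1 hj.2)
  have hr : ∀ m : ℕ, BondRegular E.toSubalgebra x y (k + m) := by
    intro m
    induction m with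
    | zero => simpa using hk
    | succ m ih =>
      have := BondRegular.succ h.toIsGammaSolution ih
        (hv _ ⟨constantCoeff_mem ih.2.1, constantCoeff_mem ih.2.2⟩)
      push_cast
      rwa [← add_assoc]
  have hl : ∀ m : ℕ, BondRegular E.toSubalgebra x y (k - m) := by
    intro m
    induction m with
    | zero => simpa using hk
    | succ m ih =>
      push_cast
      rw [← sub_sub]
      refine BondRegular.pred h.toIsGammaSolution ?_
        (hv _ ⟨constantCoeff_mem ih.1.1, constantCoeff_mem ih.1.2⟩)
      rwa [sub_add_cancel]
  refine h.gen E fun j => ?_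
  rcases le_total k j with hj | hj
  · have := hr (j - k).toNat
    rw [show k + ((j - k).toNat : ℤ) = j by omega] at this
    exact ⟨constantCoeff_mem this.2.1, constantCoeff_mem this.2.2⟩
  · have := hl (k - j).toNat
    rw [show k - ((k - j).toNat : ℤ) = j by omega] at this
    exact ⟨constantCoeff_mem this.2.1, constantCoeff_mem this.2.2⟩

theorem IsGenericSolution.exists_div (h : IsGenericSolution N u x y) (k : ℤ) (z : L) :
    ∃ a ∈ bondAlg F N x y k, ∃ b ∈ bondAlg F N x y k, z = a / b := by
  refine IntermediateField.mem_adjoin_iff_div.mp ?_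
  rw [h.intermediateField_eq_top (IntermediateField.adjoin F _) k
    (IntermediateField.algebra_adjoin_le_adjoin F _)]
  exact IntermediateField.mem_top

/-- There are `4 N` moments here, and `L` is algebraic over the algebra they generate while its
transcendence degree is at least `4 N`. -/
theorem IsGenericSolution.algebraicIndependent (h : IsGenericSolution N u x y) (k : ℤ) :
    AlgebraicIndependent F (fun i : Bool × Bool × Fin N =>
      constantCoeff (bondMoment x y k i.1 i.2.1 i.2.2)) := by
  set g : Bool × Bool × Fin N → L := fun i => constantCoeff (bondMoment x y k i.1 i.2.1 i.2.2)
  have halg : Algebra.IsAlgebraic (Algebra.adjoin F (Set.range g)) L := by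
    refine ⟨fun z => ?_⟩
    obtain ⟨a, ha, b, hb, rfl⟩ := h.exists_div k z
    rw [div_eq_mul_inv]
    exact (isAlgebraic_algebraMap (A := L) (⟨a, ha⟩ : Algebra.adjoin F (Set.range g))).mul
      (isAlgebraic_algebraMap (A := L) (⟨b, hb⟩ : Algebra.adjoin F (Set.range g))).inv
  refine (Algebra.IsAlgebraic.isTranscendenceBasis_of_lift_le_trdeg_of_finite F g ?_).1
  refine le_trans ?_ (Cardinal.lift_le.mpr h.trdeg)
  simp only [Cardinal.mk_fintype, Cardinal.lift_natCast, Fintype.card_prod, Fintype.card_bool,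
    Fintype.card_fin, Nat.cast_le]
  omega

/-- The algebra generated by the initial moments is a polynomial ring. -/
noncomputable def bondEquiv (h : IsGenericSolution N u x y) (k : ℤ) :
    MvPolynomial (Bool × Bool × Fin N) F ≃ₐ[F] bondAlg F N x y k :=
  (h.algebraicIndependent k).aevalEquiv

theorem bondEquiv_X (h : IsGenericSolution N u x y) (k : ℤ) (i : Bool × Bool × Fin N) :
    (bondEquiv h k (MvPolynomial.X i) : L) =
      constantCoeff (bondMoment x y k i.1 i.2.1 i.2.2) := by
  have := (h.algebraicIndependent k).algebraMap_aevalEquiv (MvPolynomial.X i)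
  rw [MvPolynomial.aeval_X] at this
  exact this

theorem IsGenericSolution.ufd (h : IsGenericSolution N u x y) (k : ℤ) :
    UniqueFactorizationMonoid (bondAlg F N x y k) :=
  (bondEquiv h k).toMulEquiv.uniqueFactorizationMonoid inferInstance

theorem IsGenericSolution.eq_algebraMap_of_isUnit (h : IsGenericSolution N u x y) {k : ℤ}
    {a : bondAlg F N x y k} (ha : IsUnit a) : ∃ c : F, (a : L) = algebraMap F L c := by
  have hu := ha.map (bondEquiv h k).symm
  obtain ⟨c, _, hc⟩ := MvPolynomial.isUnit_iff_eq_C_of_isReduced.mp hu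
  refine ⟨c, ?_⟩
  have := congrArg (bondEquiv h k) hc
  rw [AlgEquiv.apply_symm_apply] at this
  rw [this, ← MvPolynomial.algebraMap_eq, AlgEquiv.commutes]
  rfl

/-- The initial moments can be specialised to arbitrary values. -/
theorem IsGenericSolution.exists_eval (h : IsGenericSolution N u x y) (k : ℤ)
    (g : Bool → Bool → ℕ → F) : ∃ φ : bondAlg F N x y k →ₐ[F] F,
      ∀ e f, ∀ s < N, ∀ hm, φ ⟨constantCoeff (bondMoment x y k e f s), hm⟩ = g e f s := by
  refine ⟨(MvPolynomial.aeval fun i : Bool × Bool × Fin N => g i.1 i.2.1 i.2.2).comp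
    (bondEquiv h k).symm.toAlgHom, fun e f s hs hm => ?_⟩
  have : (⟨constantCoeff (bondMoment x y k e f s), hm⟩ : bondAlg F N x y k) =
      bondEquiv h k (MvPolynomial.X (e, f, ⟨s, hs⟩)) := by
    apply Subtype.ext
    rw [bondEquiv_X]
  rw [this]
  simp

/-- The initial value of `v` at a site. -/
noncomputable def v0 (x y : ℤ → L⟦X⟧) (k : ℤ) : L := constantCoeff (toeplitzV x y k)

theorem v0_eq (k : ℤ) : v0 x y k = 1 - constantCoeff (x k) * constantCoeff (y k) := by
  rw [v0, toeplitzV, map_sub, map_one, map_mul]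

/-- The initial values of `x k` and `y k` are two of the variables of the polynomial ring at the
bond. The same element is prime at the bond `k + 1`, where they are again variables
(`v0_prime_pred`). -/
theorem IsGenericSolution.v0_prime (h : IsGenericSolution N u x y) (k : ℤ) :
    ∃ p : bondAlg F N x y k, Prime p ∧ (p : L) = v0 x y k := by
  have hN := h.two_le
  refine ⟨bondEquiv h k (1 - MvPolynomial.X (false, false, ⟨0, by omega⟩) *
    MvPolynomial.X (true, false, ⟨0, by omega⟩)), ?_, ?_⟩
  · exact (MulEquiv.prime_iff (bondEquiv h k).toMulEquiv).mpr (prime_one_sub_X_mul_X (by simp))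
  · rw [map_sub, map_one, map_mul, v0_eq]
    push_cast
    rw [bondEquiv_X, bondEquiv_X]
    simp [bondMoment, bondA_zero]

theorem IsGenericSolution.v0_prime_pred (h : IsGenericSolution N u x y) (k : ℤ) :
    ∃ p : bondAlg F N x y (k + 1), Prime p ∧ (p : L) = v0 x y k := by
  have hN := h.two_le
  refine ⟨bondEquiv h (k + 1) (1 - MvPolynomial.X (true, true, ⟨0, by omega⟩) *
    MvPolynomial.X (false, true, ⟨0, by omega⟩)), ?_, ?_⟩
  · exact (MulEquiv.prime_iff (bondEquiv h (k + 1)).toMulEquiv).mpr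
      (prime_one_sub_X_mul_X (by simp))
  · rw [map_sub, map_one, map_mul, v0_eq]
    push_cast
    rw [bondEquiv_X, bondEquiv_X]
    simp [bondMoment, bondB_zero]

end Regular

/-! ### Localizations of subalgebras at primes -/

section Domination

variable {F L : Type*} [Field F] [Field L] [Algebra F L]

/-- Units of a subalgebra of a field, as elements of the field. -/
def IsUnitIn (O : Subalgebra F L) (z : L) : Prop := z ∈ O ∧ z ≠ 0 ∧ z⁻¹ ∈ O

variable {O R R' : Subalgebra F L}

theorem IsUnitIn.mul {z w : L} (hz : IsUnitIn O z) (hw : IsUnitIn O w) : IsUnitIn O (z * w) :=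
  ⟨mul_mem hz.1 hw.1, mul_ne_zero hz.2.1 hw.2.1, by
    rw [mul_inv]; exact mul_mem hz.2.2 hw.2.2⟩

theorem IsUnitIn.inv {z : L} (hz : IsUnitIn O z) : IsUnitIn O z⁻¹ :=
  ⟨hz.2.2, inv_ne_zero hz.2.1, by rw [inv_inv]; exact hz.1⟩

theorem IsUnitIn.one : IsUnitIn O (1 : L) :=
  ⟨one_mem _, one_ne_zero, by rw [inv_one]; exact one_mem _⟩

theorem IsUnitIn.pow {z : L} (hz : IsUnitIn O z) (m : ℕ) : IsUnitIn O (z ^ m) := by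
  induction m with
  | zero => rw [pow_zero]; exact IsUnitIn.one
  | succ m ih => rw [pow_succ]; exact ih.mul hz

theorem IsUnitIn.prod {ι : Type*} {s : Finset ι} {f : ι → L} (h : ∀ i ∈ s, IsUnitIn O (f i)) :
    IsUnitIn O (∏ i ∈ s, f i) := by
  classical
  induction s using Finset.induction_on with
  | empty => rw [Finset.prod_empty]; exact IsUnitIn.one
  | insert i s hi ih =>
    rw [Finset.prod_insert hi]
    exact (h i (Finset.mem_insert_self i s)).mul
      (ih fun j hj => h j (Finset.mem_insert_of_mem hj))

theorem IsUnitIn.algebraMap {c : F} (hc : c ≠ 0) : IsUnitIn O (algebraMap F L c) :=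
  ⟨O.algebraMap_mem c, (map_ne_zero _).mpr hc, by rw [← map_inv₀]; exact O.algebraMap_mem _⟩

theorem IsUnitIn.of_mul_left {z w : L} (hz : z ∈ O) (hw : w ∈ O) (h : IsUnitIn O (z * w)) :
    IsUnitIn O z := by
  have hz0 : z ≠ 0 := left_ne_zero_of_mul h.2.1
  have hw0 : w ≠ 0 := right_ne_zero_of_mul h.2.1
  refine ⟨hz, hz0, ?_⟩
  have := mul_mem hw h.2.2
  rwa [mul_inv, mul_left_comm, mul_inv_cancel₀ hw0, mul_one] at this

/-- The fractions of elements of `R` whose denominator is a unit of `O`. -/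
def loc (R O : Subalgebra F L) : Subalgebra F L where
  carrier := {z | ∃ a ∈ R, ∃ b ∈ R, b ≠ 0 ∧ b⁻¹ ∈ O ∧ z = a / b}
  mul_mem' := by
    rintro _ _ ⟨a, ha, b, hb, hb0, hbO, rfl⟩ ⟨a', ha', b', hb', hb0', hbO', rfl⟩
    refine ⟨a * a', mul_mem ha ha', b * b', mul_mem hb hb', mul_ne_zero hb0 hb0', ?_, ?_⟩
    · rw [mul_inv]; exact mul_mem hbO hbO'
    · rw [div_mul_div_comm]
  add_mem' := by
    rintro _ _ ⟨a, ha, b, hb, hb0, hbO, rfl⟩ ⟨a', ha', b', hb', hb0', hbO', rfl⟩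
    refine ⟨a * b' + b * a', add_mem (mul_mem ha hb') (mul_mem hb ha'), b * b', mul_mem hb hb',
      mul_ne_zero hb0 hb0', ?_, ?_⟩
    · rw [mul_inv]; exact mul_mem hbO hbO'
    · rw [div_add_div _ _ hb0 hb0']
  algebraMap_mem' := fun r => ⟨algebraMap F L r, R.algebraMap_mem r, 1, one_mem _, one_ne_zero, by
    rw [inv_one]; exact one_mem _, by rw [div_one]⟩

theorem le_loc : R ≤ loc R O := fun a ha =>
  ⟨a, ha, 1, one_mem _, one_ne_zero, by rw [inv_one]; exact one_mem _, by rw [div_one]⟩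

theorem inv_mem_loc {z : L} (hz : z ∈ loc R O) (h : z⁻¹ ∈ O) : z⁻¹ ∈ loc R O := by
  obtain ⟨a, ha, b, hb, hb0, hbO, rfl⟩ := hz
  rcases eq_or_ne a 0 with rfl | ha0
  · rw [zero_div, inv_zero]; exact zero_mem _
  refine ⟨b, hb, a, ha, ha0, ?_, by rw [inv_div]⟩
  have := mul_mem h hbO
  rwa [inv_div, div_mul_eq_mul_div, mul_inv_cancel₀ hb0, one_div] at this

theorem loc_le (h : R ≤ O) : loc R O ≤ O := by
  rintro _ ⟨a, ha, b, hb, hb0, hbO, rfl⟩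
  rw [div_eq_mul_inv]
  exact mul_mem (h ha) hbO

/-- `O` consists of fractions of elements of `R`. -/
def Dominates (O R : Subalgebra F L) : Prop := R ≤ O ∧ O ≤ loc R O

/-- Used to pass from one bond to another: besides regularity in `O`, the old generators must be
fractions in the new ones with denominators invertible in `O`. -/
theorem Dominates.trans (h : Dominates O R) (h1 : R' ≤ O) (h2 : R ≤ loc R' O) :
    Dominates O R' := by
  refine ⟨h1, fun z hz => ?_⟩
  obtain ⟨a, ha, b, hb, hb0, hbO, rfl⟩ := h.2 hz
  rw [div_eq_mul_inv]
  exact mul_mem (h2 ha) (inv_mem_loc (h2 hb) hbO)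

/-- Every nonunit has a power divisible by a given nonzero element. -/
def IsArch (O : Subalgebra F L) : Prop :=
  ∀ a ∈ O, a ≠ 0 → ∀ b ∈ O, ¬IsUnitIn O b → ∃ m : ℕ, b ^ m / a ∈ O

/-- The sum of a unit and a nonunit is a unit. -/
def IsLocalIn (O : Subalgebra F L) : Prop :=
  ∀ a b, IsUnitIn O a → b ∈ O → ¬IsUnitIn O b → IsUnitIn O (a + b)

/-- The localization of a subalgebra of a field at a prime element. -/
def locAt {R : Subalgebra F L} {π : R} (hπ : Prime π) : Subalgebra F L where
  carrier := {z | ∃ a b : R, ¬π ∣ b ∧ z = a / b}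
  mul_mem' := by
    rintro _ _ ⟨a, b, hb, rfl⟩ ⟨a', b', hb', rfl⟩
    refine ⟨a * a', b * b', hπ.not_dvd_mul hb hb', ?_⟩
    push_cast
    rw [div_mul_div_comm]
  add_mem' := by
    rintro _ _ ⟨a, b, hb, rfl⟩ ⟨a', b', hb', rfl⟩
    refine ⟨a * b' + b * a', b * b', hπ.not_dvd_mul hb hb', ?_⟩
    have h1 : (b : L) ≠ 0 := fun h => hb (by
      rw [show b = 0 from Subtype.ext h]; exact dvd_zero _)
    have h2 : (b' : L) ≠ 0 := fun h => hb' (by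
      rw [show b' = 0 from Subtype.ext h]; exact dvd_zero _)
    push_cast
    rw [div_add_div _ _ h1 h2]
  algebraMap_mem' := fun r => ⟨algebraMap F R r, 1, fun h => hπ.not_isUnit (isUnit_of_dvd_one h), by
    simp⟩

variable {π : R} (hπ : Prime π)

theorem ne_zero_of_not_dvd {b : R} (hb : ¬π ∣ b) : (b : L) ≠ 0 := fun h => hb (by
  rw [show b = 0 from Subtype.ext h]; exact dvd_zero _)

theorem le_locAt : R ≤ locAt hπ := fun a ha =>
  ⟨⟨a, ha⟩, 1, fun h => hπ.not_isUnit (isUnit_of_dvd_one h), by simp⟩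

theorem isUnitIn_locAt_iff {b : R} : IsUnitIn (locAt hπ) (b : L) ↔ ¬π ∣ b := by
  constructor
  · rintro ⟨-, hb0, a, d, hd, h⟩ ⟨c, rfl⟩
    apply hd
    have hd0 := ne_zero_of_not_dvd hd
    refine ⟨a * c, Subtype.ext ?_⟩
    push_cast at h hb0 ⊢
    rw [inv_eq_iff_eq_inv, inv_div, eq_div_iff (by
      rintro h0
      rw [h0, div_zero] at h
      exact hb0 h)] at h
    rw [← h]
    ring
  · intro h
    refine ⟨le_locAt hπ b.2, ne_zero_of_not_dvd h, 1, b, h, ?_⟩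
    simp

theorem dominates_locAt : Dominates (locAt hπ) R := by
  refine ⟨le_locAt hπ, ?_⟩
  rintro _ ⟨a, b, hb, rfl⟩
  exact ⟨a, a.2, b, b.2, ne_zero_of_not_dvd hb, ((isUnitIn_locAt_iff hπ).mpr hb).2.2, rfl⟩

theorem isUnitIn_locAt_div {a b : R} (hb : ¬π ∣ b) :
    IsUnitIn (locAt hπ) ((a : L) / b) ↔ ¬π ∣ a := by
  have hu := (isUnitIn_locAt_iff hπ).mpr hb
  rw [← isUnitIn_locAt_iff hπ]
  constructor
  · intro h
    have := h.mul hu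
    rwa [div_mul_cancel₀ _ hu.2.1] at this
  · intro h
    rw [div_eq_mul_inv]
    exact h.mul hu.inv

theorem isLocalIn_locAt : IsLocalIn (locAt hπ) := by
  rintro _ _ ha ⟨b, d, hd, rfl⟩ hb
  obtain ⟨a, c, hc, rfl⟩ := ha.1
  rw [isUnitIn_locAt_div hπ hc] at ha
  rw [isUnitIn_locAt_div hπ hd, not_not] at hb
  rw [div_add_div _ _ (ne_zero_of_not_dvd hc) (ne_zero_of_not_dvd hd)]
  have := isUnitIn_locAt_div hπ (a := a * d + c * b) (hπ.not_dvd_mul hc hd)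
  push_cast at this
  rw [this, dvd_add_left (hb.mul_left c)]
  exact hπ.not_dvd_mul ha hd

theorem isArch_locAt [WfDvdMonoid R] : IsArch (locAt hπ) := by
  rintro _ ⟨a, c, hc, rfl⟩ ha0 _ ⟨b, d, hd, rfl⟩ hb
  rw [isUnitIn_locAt_div hπ hd, not_not] at hb
  obtain ⟨b, rfl⟩ := hb
  have ha : a ≠ 0 := by
    rintro rfl
    simp at ha0
  obtain ⟨a', ha', e⟩ := (FiniteMultiplicity.of_prime_left hπ ha).exists_eq_pow_mul_and_not_dvd
  set m := multiplicity π a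
  have hd' : ¬π ∣ a' * d ^ m := hπ.not_dvd_mul e (fun h => hd (hπ.dvd_of_dvd_pow h))
  refine ⟨m, c * b ^ m, a' * d ^ m, hd', ?_⟩
  have h1 := ne_zero_of_not_dvd e
  have h2 := ne_zero_of_not_dvd hd
  have h3 := ne_zero_of_not_dvd hc
  have h4 : (π : L) ≠ 0 := fun h => hπ.ne_zero (Subtype.ext h)
  rw [ha']
  push_cast
  rw [div_pow, mul_pow]
  field_simp

/-- An archimedean subalgebra that dominates `R` is determined by any prime of `R` which is not a
unit. -/
theorem Dominates.eq_locAt (h : Dominates O R) (hA : IsArch O) (hn : ¬IsUnitIn O (π : L)) :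
    O = locAt hπ := by
  have h0 : (π : L) ≠ 0 := fun h => hπ.ne_zero (Subtype.ext h)
  have key : ∀ b : R, IsUnitIn O (b : L) ↔ ¬π ∣ b := by
    intro b
    have hdvd : ∀ d : R, IsUnitIn O (d : L) → ¬π ∣ d := by
      rintro _ hd ⟨c, rfl⟩
      push_cast at hd
      exact hn (hd.of_mul_left (h.1 π.2) (h.1 c.2))
    refine ⟨hdvd b, fun hb => ?_⟩
    -- If `b` were a nonunit, then `π` would divide `b ^ m * d` for some unit `d` of `O`, hence `b`
    -- or `d`; but multiples of `π` are not units of `O`.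
    by_contra hbu
    obtain ⟨m, hm⟩ := hA _ (h.1 π.2) h0 _ (h.1 b.2) hbu
    obtain ⟨c, hc, d, hd, hd0, hdO, e⟩ := h.2 hm
    rw [div_eq_div_iff h0 hd0] at e
    have e' : b ^ m * ⟨d, hd⟩ = π * ⟨c, hc⟩ := Subtype.ext (by
      push_cast
      rw [e, mul_comm])
    rcases hπ.dvd_or_dvd (Dvd.intro _ e'.symm) with h1 | h1
    · exact hb (hπ.dvd_of_dvd_pow h1)
    · exact hdvd _ ⟨h.1 hd, hd0, hdO⟩ h1
  apply le_antisymm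
  · intro z hz
    obtain ⟨a, ha, b, hb, hb0, hbO, rfl⟩ := h.2 hz
    exact ⟨⟨a, ha⟩, ⟨b, hb⟩, (key ⟨b, hb⟩).mp ⟨h.1 hb, hb0, hbO⟩, rfl⟩
  · rintro _ ⟨a, b, hb, rfl⟩
    rw [div_eq_mul_inv]
    exact mul_mem (h.1 a.2) ((key b).mpr hb).2.2

/-- A fraction which is a unit at all primes comes from a unit. -/
theorem exists_unit_of_isUnitIn_locAt [UniqueFactorizationMonoid R] {z : L} {a b : R} (hb : b ≠ 0)
    (hz : z = a / b) (h : ∀ (q : R) (hq : Prime q), IsUnitIn (locAt hq) z) (h0 : z ≠ 0) :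
    ∃ c : R, IsUnit c ∧ z = c := by
  obtain ⟨a', b', g, hrel, rfl, rfl⟩ := UniqueFactorizationMonoid.exists_reduced_factors' a b hb
  have hg : (g : L) ≠ 0 := fun h => hb (by rw [show g = 0 from Subtype.ext h, zero_mul])
  have hb' : b' ≠ 0 := right_ne_zero_of_mul hb
  have hbL : (b' : L) ≠ 0 := fun h => hb' (Subtype.ext h)
  push_cast at hz
  rw [mul_div_mul_left _ _ hg] at hz
  have ha' : a' ≠ 0 := by
    rintro rfl
    simp at hz
    exact h0 hz
  have haL : (a' : L) ≠ 0 := fun h => ha' (Subtype.ext h)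
  -- In a reduced fraction a prime dividing the numerator or the denominator prevents the fraction
  -- from being a unit at this prime.
  have key : ∀ q : R, Prime q → ¬q ∣ a' ∧ ¬q ∣ b' := by
    intro q hq
    obtain ⟨⟨c, d, hd, e⟩, -, ⟨c', d', hd', e'⟩⟩ := h q hq
    rw [hz] at e e'
    rw [inv_div] at e'
    rw [div_eq_div_iff hbL (ne_zero_of_not_dvd hd)] at e
    rw [div_eq_div_iff haL (ne_zero_of_not_dvd hd')] at e'
    have e1 : a' * d = c * b' := Subtype.ext (by push_cast; exact e)
    have e2 : b' * d' = c' * a' := Subtype.ext (by push_cast; exact e')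
    constructor
    · intro hqa
      have h1 : q ∣ b' * d' := by rw [e2]; exact hqa.mul_left _
      exact hq.not_isUnit (hrel hqa ((hq.dvd_or_dvd h1).resolve_right hd'))
    · intro hqb
      have h1 : q ∣ a' * d := by rw [e1]; exact hqb.mul_left _
      exact hq.not_isUnit (hrel ((hq.dvd_or_dvd h1).resolve_right hd) hqb)
  have hunit : ∀ c : R, c ≠ 0 → (∀ q : R, Prime q → ¬q ∣ c) → IsUnit c := by
    intro c hc hq
    by_contra hu
    obtain ⟨i, hi, hic⟩ := WfDvdMonoid.exists_irreducible_factor hu hc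
    exact hq i hi.prime hic
  have ua := hunit a' ha' fun q hq => (key q hq).1
  have ub := hunit b' hb' fun q hq => (key q hq).2
  obtain ⟨w, hw⟩ := ub
  refine ⟨a' * ((w⁻¹ : Rˣ) : R), ua.mul (Units.isUnit _), ?_⟩
  rw [hz, div_eq_iff hbL, ← hw]
  have : ((w⁻¹ : Rˣ) : R) * (w : R) = 1 := Units.inv_mul w
  have h2 := congrArg (fun r : R => (r : L)) this
  push_cast at h2 ⊢
  rw [mul_assoc, h2, mul_one]

end Domination

/-! ### Singularity confinement: the identities -/

section ConfinementAlgebra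

variable {T : Type*} [CommRing T] {A : Subring T} {δ : Derivation ℤ T T}
  {x₀ y₀ X Y x₂ y₂ x₃ y₃ x₄ y₄ v p q G r Gi w : T}

/-- Notation for a pole at the site `n`: `x₀, X, x₂, x₃, x₄` are the values of `x` at `n - 2, …, n +
2`, similarly for `y`, and `v` belongs to `n - 1`. The products `p = v x_n` and `q = v y_n` remain
regular, and `G = v² - p q` equals `v² v_n`. -/
theorem deriv_one_sub_mul (hv : v = 1 - X * Y) (hX : δ X = v * (x₂ - x₀))
    (hY : δ Y = v * (y₂ - y₀)) (hp : p = v * x₂) (hq : q = v * y₂) (hr : r = x₀ * Y + X * y₀) :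
    δ v = -(X * q + Y * p) + v * r := by
  have h : δ v = -(X * δ Y + Y * δ X) := by
    rw [hv, map_sub, Derivation.map_one_eq_zero, Derivation.leibniz]
    simp
  rw [h, hX, hY, hp, hq, hr]
  ring

/-- The flow at the pole with denominators cleared. The only division left is by `G`, which is
invertible at the pole, so the site `n + 1` is regular. -/
theorem deriv_next (hp : p = v * x₂) (hq : q = v * y₂) (hG : G = v ^ 2 - p * q)
    (hx₂ : δ x₂ = (1 - x₂ * y₂) * (x₃ - X)) : G * x₃ = G * X + v * δ p - p * δ v := by
  have h : δ p = v * δ x₂ + x₂ * δ v := by rw [hp, Derivation.leibniz]; simp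
  rw [h, hx₂, hG, hp, hq]
  ring

/-- The value of `v` past a pole. -/
theorem v_past_pole (hv : v = 1 - X * Y) (hX : δ X = v * (x₂ - x₀)) (hY : δ Y = v * (y₂ - y₀))
    (hp : p = v * x₂) (hq : q = v * y₂) (hG : G = v ^ 2 - p * q) (hr : r = x₀ * Y + X * y₀)
    (hx₂ : δ x₂ = (1 - x₂ * y₂) * (x₃ - X)) (hy₂ : δ y₂ = (1 - x₂ * y₂) * (y₃ - Y)) :
    G ^ 2 * (1 - x₃ * y₃) = v * (G ^ 2 - G * (X * δ q + Y * δ p) + δ v * (r * G - v * δ v) -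
      δ p * δ q * v + δ v * (δ p * q + p * δ q)) := by
  have h1 := deriv_next hp hq hG hx₂
  have h2 := deriv_next (G := G) (x₂ := y₂) (y₂ := x₂) (x₃ := y₃) (X := Y) (δ := δ) hq hp
    (by rw [hG, mul_comm p]) (by rw [hy₂, mul_comm x₂])
  have h3 := deriv_one_sub_mul hv hX hY hp hq hr
  have e : G ^ 2 * (1 - x₃ * y₃) = G ^ 2 - (G * x₃) * (G * y₃) := by ring
  rw [e, h1, h2]
  generalize δ p = P at *
  generalize δ q = Q at *
  have h4 : X * q + Y * p = v * r - δ v := by rw [h3]; ring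
  generalize δ v = V at *
  have h5 : X * Y = 1 - v := by rw [hv]; ring
  subst hG
  linear_combination (-(v ^ 2 - p * q) ^ 2) * h5 + (v ^ 2 - p * q) * V * h4

theorem mem_past_pole (hδ : ∀ f ∈ A, δ f ∈ A) (hv : v = 1 - X * Y)
    (hX : δ X = v * (x₂ - x₀)) (hY : δ Y = v * (y₂ - y₀))
    (hp : p = v * x₂) (hq : q = v * y₂) (hG : G = v ^ 2 - p * q) (hr : r = x₀ * Y + X * y₀)
    (hx₂ : δ x₂ = (1 - x₂ * y₂) * (x₃ - X)) (hy₂ : δ y₂ = (1 - x₂ * y₂) * (y₃ - Y))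
    (mx₀ : x₀ ∈ A) (my₀ : y₀ ∈ A) (mX : X ∈ A) (mY : Y ∈ A) (mG : Gi ∈ A) (hGi : G * Gi = 1) :
    (p ∈ A ∧ q ∈ A ∧ v ∈ A) ∧ (x₃ ∈ A ∧ y₃ ∈ A) ∧ ∃ w ∈ A, 1 - x₃ * y₃ = v * w := by
  have mv : v ∈ A := by rw [hv]; exact sub_mem (one_mem _) (mul_mem mX mY)
  have mp : p ∈ A := by
    have : p = δ X + v * x₀ := by rw [hX, hp]; ring
    rw [this]; exact add_mem (hδ _ mX) (mul_mem mv mx₀)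
  have mq : q ∈ A := by
    have : q = δ Y + v * y₀ := by rw [hY, hq]; ring
    rw [this]; exact add_mem (hδ _ mY) (mul_mem mv my₀)
  have mG' : G ∈ A := by rw [hG]; exact sub_mem (pow_mem mv 2) (mul_mem mp mq)
  have h1 := deriv_next hp hq hG hx₂
  have h2 := deriv_next (G := G) (x₂ := y₂) (y₂ := x₂) (x₃ := y₃) (X := Y) (δ := δ) hq hp
    (by rw [hG, mul_comm p]) (by rw [hy₂, mul_comm x₂])
  have h3 := v_past_pole hv hX hY hp hq hG hr hx₂ hy₂
  have mr : r ∈ A := by rw [hr]; exact add_mem (mul_mem mx₀ mY) (mul_mem mX my₀)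
  have dv := hδ _ mv
  have dp := hδ _ mp
  have dq := hδ _ mq
  refine ⟨⟨mp, mq, mv⟩, ⟨?_, ?_⟩, Gi ^ 2 * (G ^ 2 - G * (X * δ q + Y * δ p) +
    δ v * (r * G - v * δ v) - δ p * δ q * v + δ v * (δ p * q + p * δ q)), ?_, ?_⟩
  · have : x₃ = X + Gi * (v * δ p - p * δ v) := by linear_combination Gi * h1 - (x₃ - X) * hGi
    rw [this]
    exact add_mem mX (mul_mem mG (sub_mem (mul_mem mv dp) (mul_mem mp dv)))
  · have : y₃ = Y + Gi * (v * δ q - q * δ v) := by linear_combination Gi * h2 - (y₃ - Y) * hGi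
    rw [this]
    exact add_mem mY (mul_mem mG (sub_mem (mul_mem mv dq) (mul_mem mq dv)))
  · refine mul_mem (pow_mem mG 2) (add_mem (sub_mem (add_mem (sub_mem (pow_mem mG' 2)
      (mul_mem mG' (add_mem (mul_mem mX dq) (mul_mem mY dp)))) (mul_mem dv
      (sub_mem (mul_mem mr mG') (mul_mem mv dv)))) (mul_mem (mul_mem dp dq) mv))
      (mul_mem dv (add_mem (mul_mem dp mq) (mul_mem mp dq))))
  · linear_combination Gi ^ 2 * h3 - (1 - x₃ * y₃) * (G * Gi + 1) * hGi

/-- The flow at `n + 1` reads `v w x₄ = p w + δ x₃`, so the right side has to be divisible by `v`.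
It suffices to check this after multiplication by the unit `δ v`. Modulo `v` one has `q δ x₃ ≡ p δ
y₃` (`s3`), `δ v ≡ q x₃ + p y₃` (`s4`) and `w δ v ≡ -(x₃ δ y₃ + y₃ δ x₃)` (`s5`), whence `δ v (p w +
δ x₃) ≡ x₃ (q δ x₃ - p δ y₃) ≡ 0`. -/
theorem mem_after_pole [IsDomain T] {di wi : T} (hδ : ∀ f ∈ A, δ f ∈ A) (hv0 : v ≠ 0) (hv : v = 1 - X * Y)
    (hX : δ X = v * (x₂ - x₀)) (hY : δ Y = v * (y₂ - y₀))
    (hp : p = v * x₂) (hq : q = v * y₂) (hG : G = v ^ 2 - p * q)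
    (hx₂ : δ x₂ = (1 - x₂ * y₂) * (x₃ - X)) (hy₂ : δ y₂ = (1 - x₂ * y₂) * (y₃ - Y))
    (hx₃ : δ x₃ = (1 - x₃ * y₃) * (x₄ - x₂)) (hy₃ : δ y₃ = (1 - x₃ * y₃) * (y₄ - y₂))
    (hw : 1 - x₃ * y₃ = v * w) (mw : w ∈ A) (mwi : wi ∈ A) (hwi : w * wi = 1)
    (mdi : di ∈ A) (hdi : δ v * di = 1)
    (mx₀ : x₀ ∈ A) (my₀ : y₀ ∈ A) (mX : X ∈ A) (mY : Y ∈ A) (mG : Gi ∈ A) (hGi : G * Gi = 1) :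
    x₄ ∈ A ∧ y₄ ∈ A := by
  obtain ⟨r, hr⟩ : ∃ r, r = x₀ * Y + X * y₀ := ⟨_, rfl⟩
  obtain ⟨⟨mp, mq, mv⟩, ⟨mx₃, my₃⟩, -⟩ := mem_past_pole hδ hv hX hY hp hq hG hr hx₂ hy₂
    mx₀ my₀ mX mY mG hGi
  have mr : r ∈ A := by rw [hr]; exact add_mem (mul_mem mx₀ mY) (mul_mem mX my₀)
  have h1 := deriv_next hp hq hG hx₂
  have h2 := deriv_next (G := G) (x₂ := y₂) (y₂ := x₂) (x₃ := y₃) (X := Y) (δ := δ) hq hp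
    (by rw [hG, mul_comm p]) (by rw [hy₂, mul_comm x₂])
  have hdv := deriv_one_sub_mul hv hX hY hp hq hr
  have e1 : x₃ = X + Gi * (v * δ p - p * δ v) := by linear_combination Gi * h1 - (x₃ - X) * hGi
  have e2 : y₃ = Y + Gi * (v * δ q - q * δ v) := by linear_combination Gi * h2 - (y₃ - Y) * hGi
  obtain ⟨σ, hσ⟩ : ∃ σ, σ = Gi * (q * δ p - p * δ q) := ⟨_, rfl⟩
  have mσ : σ ∈ A := by
    rw [hσ]; exact mul_mem mG (sub_mem (mul_mem mq (hδ _ mp)) (mul_mem mp (hδ _ mq)))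
  have s1 : q * (x₃ - X) - p * (y₃ - Y) = v * σ := by rw [e1, e2, hσ]; ring
  have s2 : δ q * (x₃ - X) - δ p * (y₃ - Y) = δ v * σ := by rw [e1, e2, hσ]; ring
  have s3 : q * δ x₃ - p * δ y₃ = v * (δ σ - q * x₀ + p * y₀) := by
    have h := congrArg δ s1
    simp only [map_sub, Derivation.leibniz, smul_eq_mul] at h
    rw [hX, hY] at h
    linear_combination h - s2 - q * hp + p * hq
  obtain ⟨μ, hμ⟩ : ∃ μ, μ = δ σ - q * x₀ + p * y₀ := ⟨_, rfl⟩
  have mμ : μ ∈ A := by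
    rw [hμ]; exact add_mem (sub_mem (hδ _ mσ) (mul_mem mq mx₀)) (mul_mem mp my₀)
  rw [← hμ] at s3
  obtain ⟨κ, hκ⟩ : ∃ κ, κ = r + Gi * (q * δ p + p * δ q) - 2 * (Gi * v * δ v) := ⟨_, rfl⟩
  have mκ : κ ∈ A := by
    rw [hκ]
    refine sub_mem (add_mem mr (mul_mem mG (add_mem (mul_mem mq (hδ _ mp))
      (mul_mem mp (hδ _ mq))))) (mul_mem (natCast_mem A 2) (mul_mem (mul_mem mG mv) (hδ _ mv)))
  have s4 : q * x₃ + p * y₃ = δ v + v * κ := by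
    rw [e1, e2, hκ]
    linear_combination hdv + 2 * δ v * hGi - 2 * Gi * δ v * hG
  have s5 : v * δ w + w * δ v = -(x₃ * δ y₃ + y₃ * δ x₃) := by
    have h := congrArg δ hw
    simp only [map_sub, Derivation.leibniz, smul_eq_mul, Derivation.map_one_eq_zero] at h
    linear_combination -h
  have key : ∀ {z z₂ z₄ P m : T}, P = v * z₂ → δ z = (1 - x₃ * y₃) * (z₄ - z₂) →
      δ v * (P * w + δ z) = v * m → m ∈ A → z₄ ∈ A := by
    intro z z₂ z₄ P m hP hz hm mm
    have h : z₄ = m * di * wi := by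
      have h3 : v * (δ v * w * z₄) = v * m := by
        rw [← hm, hz, hw, hP]; ring
      have h4 := mul_left_cancel₀ hv0 h3
      rw [← h4]
      linear_combination -z₄ * w * wi * hdi - z₄ * hwi
    rw [h]
    exact mul_mem (mul_mem mm mdi) mwi
  constructor
  · refine key (m := -(p * δ w) - κ * δ x₃ + x₃ * μ) hp hx₃ ?_
      (add_mem (sub_mem (neg_mem (mul_mem mp (hδ _ mw))) (mul_mem mκ (hδ _ mx₃)))
        (mul_mem mx₃ mμ))
    linear_combination p * s5 - δ x₃ * s4 + x₃ * s3
  · refine key (m := -(q * δ w) - κ * δ y₃ - y₃ * μ) hq hy₃ ?_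
      (sub_mem (sub_mem (neg_mem (mul_mem mq (hδ _ mw))) (mul_mem mκ (hδ _ my₃)))
        (mul_mem my₃ mμ))
    linear_combination q * s5 - δ y₃ * s4 - y₃ * s3

end ConfinementAlgebra

/-- Derivations of a ring. Spelling them for a general ring fixes the instances used for power
series. -/
abbrev RingDerivation (R : Type*) [CommRing R] := Derivation ℤ R R

/-! ### Singularity confinement over a local ring -/

section Confinement

variable {F L : Type*} [Field F] [Field L] [Algebra F L] {O B : Subalgebra F L}
  {δ : RingDerivation L⟦X⟧} {x y : ℤ → L⟦X⟧} {n : ℤ}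

/-- Units are tested in `O`, but their inverses are taken in the smaller ring `B`. Taking `B = O`
gives regularity past a pole; taking for `B` a localization of the algebra at a bond gives
domination. -/
theorem exists_regular_inv (hinv : ∀ z ∈ B, z⁻¹ ∈ O → z⁻¹ ∈ B) {f : L⟦X⟧} (hf : f ∈ regular B)
    (hu : IsUnitIn O (constantCoeff f)) : ∃ g ∈ regular B, f * g = 1 :=
  ⟨f⁻¹, inv_mem_regular hf (hinv _ (constantCoeff_mem hf) hu.2.2),
    PowerSeries.mul_inv_cancel _ hu.2.1⟩

/-- Confinement of a singularity: two sites past a pole, the solution is regular again. -/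
theorem confinement (hBO : B ≤ O) (hinv : ∀ z ∈ B, z⁻¹ ∈ O → z⁻¹ ∈ B) (hloc : IsLocalIn O)
    (hδ : ∀ f ∈ regular B, δ f ∈ regular B)
    (h1 : FlowAt δ x y (n - 1)) (h2 : FlowAt δ x y n) (h3 : FlowAt δ x y (n + 1))
    (hB : BondRegular B x y (n - 1)) (hv0 : toeplitzV x y (n - 1) ≠ 0)
    (hv : ¬IsUnitIn O (constantCoeff (toeplitzV x y (n - 1))))
    (hp : IsUnitIn O (constantCoeff (toeplitzV x y (n - 1) * x n)))
    (hq : IsUnitIn O (constantCoeff (toeplitzV x y (n - 1) * y n)))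
    (hd : IsUnitIn O (constantCoeff (δ (toeplitzV x y (n - 1)))))
    (hw : ∀ w ∈ regular B, toeplitzV x y (n + 1) = toeplitzV x y (n - 1) * w →
      IsUnitIn O (constantCoeff w)) :
    BondRegular B x y (n + 2) ∧
      ∃ w ∈ regular B, toeplitzV x y (n + 1) = toeplitzV x y (n - 1) * w := by
  obtain ⟨⟨mx₀, my₀⟩, mX, mY⟩ := hB
  simp only [FlowAt, add_sub_cancel_right, sub_add_cancel] at h1 h2 h3
  rw [show n - 1 - 1 = n - 2 by ring] at h1 mx₀ my₀
  rw [show n + 1 + 1 = n + 2 by ring] at h3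
  have mv : toeplitzV x y (n - 1) ∈ regular B := sub_mem (one_mem _) (mul_mem mX mY)
  have mp : toeplitzV x y (n - 1) * x n ∈ regular B := by
    have : toeplitzV x y (n - 1) * x n = δ (x (n - 1)) + toeplitzV x y (n - 1) * x (n - 2) := by
      rw [h1.1]; ring
    rw [this]; exact add_mem (hδ _ mX) (mul_mem mv mx₀)
  have mq : toeplitzV x y (n - 1) * y n ∈ regular B := by
    have : toeplitzV x y (n - 1) * y n = δ (y (n - 1)) + toeplitzV x y (n - 1) * y (n - 2) := by
      rw [h1.2]; ring
    rw [this]; exact add_mem (hδ _ mY) (mul_mem mv my₀)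
  -- `-p q` is a unit and `v²` is not, so their sum is a unit of the local ring `O`.
  obtain ⟨Gi, mG, hGi⟩ := exists_regular_inv hinv (f := toeplitzV x y (n - 1) ^ 2 -
    toeplitzV x y (n - 1) * x n * (toeplitzV x y (n - 1) * y n))
    (sub_mem (pow_mem mv 2) (mul_mem mp mq)) (by
      rw [map_sub, map_pow, map_mul, sub_eq_add_neg, add_comm]
      refine hloc _ _ ?_ (pow_mem (hBO (constantCoeff_mem mv)) 2) ?_
      · have := (hp.mul hq).mul (IsUnitIn.algebraMap (L := L) (neg_ne_zero.mpr (one_ne_zero (α := F))))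
        simpa using this
      · intro hu
        rw [pow_two] at hu
        exact hv (hu.of_mul_left (hBO (constantCoeff_mem mv)) (hBO (constantCoeff_mem mv))))
  obtain ⟨-, ⟨mx₃, my₃⟩, w, mw, hvw⟩ := mem_past_pole hδ rfl h1.1 h1.2 rfl rfl rfl rfl h2.1 h2.2
    mx₀ my₀ mX mY mG hGi
  obtain ⟨wi, mwi, hwi⟩ := exists_regular_inv hinv mw (hw w mw hvw)
  obtain ⟨di, mdi, hdi⟩ := exists_regular_inv hinv (hδ _ mv) hd
  rw [BondRegular, show n + 2 - 1 = n + 1 by ring]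
  exact ⟨⟨⟨mx₃, my₃⟩, mem_after_pole hδ hv0 rfl h1.1 h1.2 rfl rfl rfl h2.1 h2.2 h3.1 h3.2 hvw mw
    mwi hwi mdi hdi mx₀ my₀ mX mY mG hGi⟩, w, mw, hvw⟩

theorem flowAt_refl_neg {k : ℤ} (h : FlowAt δ x y (-k)) : FlowAt (-δ) (refl x) (refl y) k :=
  h.refl.swap

end Confinement

/-! ### Values of moments at a point -/

section Evaluation

variable {F L : Type*} [Field F] [Field L] [Algebra F L] {N : ℕ} {u : ℤ → F} {x y : ℤ → L⟦X⟧}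

/-- Evaluation of a regular power series at `t = 0` and at a point. -/
noncomputable def evalAt {R : Subalgebra F L} (φ : R →ₐ[F] F) : regular R →+* F where
  toFun f := φ ⟨constantCoeff (f : L⟦X⟧), constantCoeff_mem f.2⟩
  map_one' := by
    have : (⟨constantCoeff (1 : L⟦X⟧), constantCoeff_mem (one_mem (regular R))⟩ : R) = 1 :=
      Subtype.ext (by simp)
    exact (congrArg φ this).trans (map_one φ)
  map_zero' := by
    have : (⟨constantCoeff (0 : L⟦X⟧), constantCoeff_mem (zero_mem (regular R))⟩ : R) = 0 :=
      Subtype.ext (by simp)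
    exact (congrArg φ this).trans (map_zero φ)
  map_mul' f g := by
    rw [← map_mul]
    exact congrArg φ (Subtype.ext (by simp))
  map_add' f g := by
    rw [← map_add]
    exact congrArg φ (Subtype.ext (by simp))

/-- Multiples of `π` vanish wherever `π` does, so one zero of `π` at which `f` does not vanish is
enough. -/
theorem isUnitIn_of_evalAt_ne {R : Subalgebra F L} {π : R} (hπ : Prime π) {φ : R →ₐ[F] F}
    (h0 : φ π = 0) {f : regular R} (hf : evalAt φ f ≠ 0) :
    IsUnitIn (locAt hπ) (constantCoeff (f : L⟦X⟧)) := by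
  refine (isUnitIn_locAt_iff hπ (b := ⟨_, constantCoeff_mem f.2⟩)).mpr fun hd => hf ?_
  have := map_dvd φ hd
  rw [h0, zero_dvd_iff] at this
  exact this

/-- The moments of a bond as elements of the ring of regular power series. -/
noncomputable def regMoment [CharZero F] (h : IsGenericSolution N u x y) (k : ℤ) (e f : Bool) (s : ℕ) :
    regular (bondAlg F N x y k) :=
  ⟨bondMoment x y k e f s, h.moment_regular (h.bondRegular_iff.mpr le_rfl) s e f⟩

variable [CharZero F]

/-- The derivative of a regular power series. -/
noncomputable def regDeriv {R : Subalgebra F L} (f : regular R) : regular R :=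
  ⟨ddt L f, ddt_mem_regular f.2⟩

theorem evalAt_regDeriv_moment (h : IsGenericSolution N u x y) {k : ℤ}
    (φ : bondAlg F N x y k →ₐ[F] F) {g : Bool → Bool → ℕ → F}
    (hg : ∀ e f s, evalAt φ (regMoment h k e f s) = g e f s) (e f : Bool) (s : ℕ) :
    evalAt φ (regDeriv (regMoment h k e f s)) = (if f then -1 else 1) *
      momentField (g e f 0) (g (!e) f 0) (g (!e) (!f) 0) (g e (!f) 0) (g e f)
        (quadD (g e f) (g e (!f))) s := by
  have h1 : regDeriv (regMoment h k e f s) = (if f then -1 else 1) *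
      momentField (regMoment h k e f 0) (regMoment h k (!e) f 0) (regMoment h k (!e) (!f) 0)
        (regMoment h k e (!f) 0) (regMoment h k e f)
        (quadD (regMoment h k e f) (regMoment h k e (!f))) s := by
    apply (regular (bondAlg F N x y k)).subtype_injective
    rw [map_mul, map_momentField]
    simp only [map_quadD]
    have := deriv_bondMoment h.flow (flowAt_v_ne h.v_ne) k e f s
    rw [apply_ite (regular (bondAlg F N x y k)).subtype, map_neg, map_one]
    exact this
  rw [h1, map_mul, map_momentField]
  simp only [map_quadD, hg]
  congr 1
  split_ifs <;> simp

/-- At a point only the moments of order less than `N` can be prescribed; those of order `N` are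
forced. For `N = 2` this affects the second order moments in `exists_pole_eval`. -/
theorem evalAt_top (h : IsGenericSolution N u x y) {k : ℤ} (φ : bondAlg F N x y k →ₐ[F] F)
    {g : Bool → Bool → ℕ → F} (hg : ∀ e f s, evalAt φ (regMoment h k e f s) = g e f s)
    (e f : Bool) :
    g e f N = topMoment N (fun e => (signedU u e (N - 1))⁻¹) (signedU u) k g e f := by
  have hN := h.two_le
  have h1 := (bondGamma_eq_zero_iff (by omega) (seriesC_mul (S := L) hN h.top_ne)
    (flowAt_v_ne h.v_ne) k e f).mp (bondGamma_all h.gamma k e f)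
  have hC : ∀ c : F, C (algebraMap F L c) ∈ regular (bondAlg F N x y k) := fun c m => by
    rw [coeff_C]
    split_ifs
    exacts [algebraMap_mem _ _, zero_mem _]
  have hX : (X : L⟦X⟧) ∈ regular (bondAlg F N x y k) := fun m => by
    rw [coeff_X]
    split_ifs
    exacts [one_mem _, zero_mem _]
  have hc : ∀ e, seriesC L N u e ∈ regular (bondAlg F N x y k) := fun e => hC _
  have hU : ∀ i, seriesU L u i ∈ regular (bondAlg F N x y k) := fun i => by
    rw [seriesU]
    split_ifs
    exacts [add_mem (hC _) hX, add_mem (hC _) (zero_mem _)]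
  have hw : ∀ e s, signedU (seriesU L u) e s ∈ regular (bondAlg F N x y k) := fun e s => by
    rw [signedU]
    split_ifs <;> exact hU _
  have h2 : regMoment h k e f N =
      topMoment N (fun e => ⟨_, hc e⟩) (fun e s => ⟨_, hw e s⟩) k (regMoment h k) e f := by
    apply (regular (bondAlg F N x y k)).subtype_injective
    rw [map_topMoment]
    exact h1
  have h3 : ∀ (c : F) (f : L⟦X⟧) (hf : f ∈ regular (bondAlg F N x y k)),
      constantCoeff f = algebraMap F L c → evalAt φ ⟨f, hf⟩ = c := by
    intro c f hf hfc
    have : (⟨constantCoeff f, constantCoeff_mem hf⟩ : bondAlg F N x y k) = algebraMap F _ c :=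
      Subtype.ext hfc
    exact (congrArg φ this).trans (φ.commutes c)
  rw [← hg, h2, map_topMoment]
  simp only [hg]
  congr 1
  · funext e
    exact h3 _ _ _ (by simp [seriesC])
  · funext e s
    refine h3 _ _ _ ?_
    have : ∀ i, constantCoeff (seriesU L u i) = algebraMap F L (u i) := by
      intro i
      rw [seriesU, map_add, constantCoeff_C]
      split_ifs <;> simp
    simp only [signedU]
    split_ifs <;> exact this _

end Evaluation

/-! ### A point of the divisor at which nothing else vanishes -/

section EvaluationPoint

variable {F L : Type*} [Field F] [Field L] [Algebra F L] {N : ℕ} {u : ℤ → F} {x y : ℤ → L⟦X⟧}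

theorem quadD_one {T : Type*} [CommRing T] (a b : ℕ → T) : quadD a b 1 = -(a 0 * b 0) := by
  rw [quadD_succ a b 0]
  simp

theorem quadD_two {T : Type*} [CommRing T] (a b : ℕ → T) :
    quadD a b 2 = -(a 0 * b 1 + a 1 * b 0) - (a 0 * b 0) ^ 2 := by
  rw [quadD_succ a b 1]
  simp only [Finset.sum_range_succ, Finset.sum_range_zero, zero_add, Nat.sub_zero, Nat.sub_self,
    quadD_one]
  ring

theorem deriv_mul_eq {T : Type*} [CommRing T] (δ : RingDerivation T) (a b : T) :
    δ (a * b) = a * δ b + b * δ a := δ.leibniz a b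

theorem deriv_one_sub_eq {T : Type*} [CommRing T] (δ : RingDerivation T) (a : T) :
    δ (1 - a) = -δ a := by
  rw [map_sub, Derivation.map_one_eq_zero, zero_sub]

theorem regDeriv_add {R : Subalgebra F L} (f g : regular R) :
    regDeriv (f + g) = regDeriv f + regDeriv g := Subtype.ext (map_add (ddt L) _ _)

theorem regDeriv_mul {R : Subalgebra F L} (f g : regular R) :
    regDeriv (f * g) = f * regDeriv g + g * regDeriv f :=
  Subtype.ext (deriv_mul_eq (ddt L) (f : L⟦X⟧) g)

theorem regDeriv_one_sub {R : Subalgebra F L} (f : regular R) :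
    regDeriv (1 - f) = -regDeriv f := 
  Subtype.ext (deriv_one_sub_eq (ddt L) (f : L⟦X⟧))

variable [CharZero F]

/-- The values of the pole data at a point with `v = 0`. -/
theorem IsGenericSolution.evalAt_pole (h : IsGenericSolution N u x y) {k : ℤ}
    (φ : bondAlg F N x y k →ₐ[F] F) {g : Bool → Bool → ℕ → F}
    (hg : ∀ e f s, evalAt φ (regMoment h k e f s) = g e f s)
    (h1 : g false false 0 = 1) (h2 : g true false 0 = 1) (h3 : g false true 0 = 0)
    (h4 : g false true 1 = 0) (h5 : g true true 1 = 0)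
    {X Y P Q V : regular (bondAlg F N x y k)} (hX : X = regMoment h k false false 0)
    (hY : Y = regMoment h k true false 0)
    (hP : P = regMoment h k false false 1 + X * (X * regMoment h k false true 0))
    (hQ : Q = regMoment h k true false 1 + Y * (Y * regMoment h k true true 0))
    (hV : V = 1 - X * Y) {p q ξ : F} (hp : p = g false false 1) (hξ : ξ = g true true 0)
    (hq : q = g true false 1 + ξ) :
    evalAt φ X = 1 ∧ evalAt φ Y = 1 ∧ evalAt φ V = 0 ∧ evalAt φ P = p ∧ evalAt φ Q = q ∧
      evalAt φ (regDeriv V) = -(p + q) ∧ evalAt φ (regDeriv P) = g false false 2 + ξ * p ∧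
      evalAt φ (regDeriv Q) = g true false 2 + 3 * (ξ * q) := by
  have d1 : quadD (g false false) (g false true) 1 = 0 := by
    rw [quadD_one, h3]; ring
  have d2 : quadD (g false false) (g false true) 2 = 0 := by
    rw [quadD_two, h3, h4]; ring
  have d1' : quadD (g true false) (g true true) 1 = -ξ := by
    rw [quadD_one, h2, hξ]; ring
  have d2' : quadD (g true false) (g true true) 2 = -(q * ξ) := by
    rw [quadD_two, h2, h5, ← hξ, hq]
    ring
  have dX := evalAt_regDeriv_moment h φ hg false false 0
  have dY := evalAt_regDeriv_moment h φ hg true false 0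
  have dyp := evalAt_regDeriv_moment h φ hg false true 0
  have dxp := evalAt_regDeriv_moment h φ hg true true 0
  have da := evalAt_regDeriv_moment h φ hg false false 1
  have da' := evalAt_regDeriv_moment h φ hg true false 1
  simp only [momentField, quadD_comm (g false true), quadD_comm (g true true), Bool.not_false,
    Bool.not_true, if_true, if_false, Bool.false_eq_true, quadD_zero, zero_add, d1, d2, d1', d2',
    h1, h2, h3, h4, h5, ← hp, ← hξ] at dX dY dyp dxp da da'
  rw [← hX] at dX
  rw [← hY] at dY
  have eX : evalAt φ X = 1 := by rw [hX, hg, h1]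
  have eY : evalAt φ Y = 1 := by rw [hY, hg, h2]
  subst hV
  refine ⟨eX, eY, by rw [map_sub, map_mul, map_one, eX, eY]; ring, ?_, ?_, ?_, ?_, ?_⟩
  · rw [hP, map_add, map_mul, map_mul, hg, hg, eX, h3, ← hp]; ring
  · rw [hQ, map_add, map_mul, map_mul, hg, hg, eY, ← hξ, hq]; ring
  · rw [regDeriv_one_sub, regDeriv_mul, map_neg, map_add, map_mul, map_mul, eX, eY, dX, dY, hq]
    ring
  · rw [hP, regDeriv_add, regDeriv_mul, regDeriv_mul]
    simp only [map_add, map_mul, hg, eX, dX, da, dyp, h3]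
    ring
  · rw [hQ, regDeriv_add, regDeriv_mul, regDeriv_mul]
    simp only [map_add, map_mul, hg, eY, dY, da', dxp, ← hξ]
    rw [show g true false 1 = q - ξ by rw [hq]; ring]
    ring

/-- A point with `v = 0` at which the leading terms of the pole data do not vanish. -/
theorem IsGenericSolution.exists_pole_eval (h : IsGenericSolution N u x y) (k : ℤ) :
    ∃ (φ : bondAlg F N x y k →ₐ[F] F) (g : Bool → Bool → ℕ → F),
      (∀ e f s, evalAt φ (regMoment h k e f s) = g e f s) ∧
      g false false 0 = 1 ∧ g true false 0 = 1 ∧ g false true 0 = 0 ∧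
      g false true 1 = 0 ∧ g true true 1 = 0 ∧
      ∃ p q ξ : F, p = g false false 1 ∧ ξ = g true true 0 ∧ q = g true false 1 + ξ ∧
        p ≠ 0 ∧ q ≠ 0 ∧ p + q ≠ 0 ∧
        p ^ 2 * q ^ 2 - q ^ 2 * (g false false 2 + ξ * p) - p ^ 2 * (g true false 2 + 3 * (ξ * q)) +
          p * q * ξ * (p + q) ≠ 0 := by
  have hN := h.two_le
  have main : ∀ g₀ : Bool → Bool → ℕ → F, ∃ (φ : bondAlg F N x y k →ₐ[F] F)
      (g : Bool → Bool → ℕ → F), (∀ e f s, evalAt φ (regMoment h k e f s) = g e f s) ∧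
      ∀ e f, ∀ s < N, g e f s = g₀ e f s := by
    intro g₀
    obtain ⟨φ, hφ⟩ := h.exists_eval k g₀
    exact ⟨φ, _, fun _ _ _ => rfl, fun e f s hs => hφ e f s hs _⟩
  rcases hN.eq_or_lt with rfl | hN3
  -- For `N = 2` the moments of order two are forced, and `ξ` is used to satisfy the last condition.
  -- The coefficient of `ξ` there is nonzero when `q² u_{-2} + u_2 ≠ 0`; if `q = 1` fails, then `q =
  -- 2` gives `3 u_{-2}`.
  · obtain ⟨q, hq, hq1, hqu⟩ : ∃ q : F, q ≠ 0 ∧ 1 + q ≠ 0 ∧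
        q ^ 2 * signedU u true 1 + signedU u false 1 ≠ 0 := by
      have hu := h.top_ne true
      by_cases h1 : signedU u true 1 + signedU u false 1 = 0
      · refine ⟨2, two_ne_zero, by norm_num, fun h2 => hu ?_⟩
        have : (3 : F) * signedU u true 1 = 0 := by linear_combination h2 - h1
        exact (mul_eq_zero.mp this).resolve_left (by norm_num)
      · exact ⟨1, one_ne_zero, by norm_num, by simpa using h1⟩
    have hw := h.top_ne false
    have hw' := h.top_ne true
    simp only [Nat.add_one_sub_one] at hw hw'
    -- the condition on `ξ` is linear
    obtain ⟨ξ, hξ⟩ : ∃ ξ : F, q ^ 2 - q ^ 2 * ((signedU u false 1)⁻¹ *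
        (-signedU u false 0 + signedU u true 1 * (ξ * q) - k)) +
        (signedU u true 1)⁻¹ * (signedU u true 0 * q + k) - q * ξ = 1 := by
      set c := q ^ 2 - q ^ 2 * ((signedU u false 1)⁻¹ * (-signedU u false 0 - k)) +
        (signedU u true 1)⁻¹ * (signedU u true 0 * q + k) with hc
      refine ⟨(c - 1) * signedU u false 1 / (q * (q ^ 2 * signedU u true 1 + signedU u false 1)), ?_⟩
      have e : ∀ ξ : F, q ^ 2 - q ^ 2 * ((signedU u false 1)⁻¹ *
        (-signedU u false 0 + signedU u true 1 * (ξ * q) - k)) +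
        (signedU u true 1)⁻¹ * (signedU u true 0 * q + k) - q * ξ =
        c - ξ * (q * (q ^ 2 * signedU u true 1 + signedU u false 1)) * (signedU u false 1)⁻¹ := by
        intro ξ
        rw [hc]
        field_simp
        ring
      rw [e, div_mul_cancel₀ _ (mul_ne_zero hq hqu), mul_assoc, mul_inv_cancel₀ hw]
      ring
    obtain ⟨φ, g, hg, hg0⟩ := main fun e f s => match e, f, s with
      | false, false, _ => 1
      | true, false, 0 => 1
      | true, false, _ => q - ξ
      | true, true, 0 => ξ
      | _, _, _ => 0
    have v1 : g false false 0 = 1 := hg0 _ _ _ (by norm_num)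
    have v2 : g true false 0 = 1 := hg0 _ _ _ (by norm_num)
    have v3 : g false true 0 = 0 := hg0 _ _ _ (by norm_num)
    have v4 : g false true 1 = 0 := hg0 _ _ _ (by norm_num)
    have v5 : g true true 1 = 0 := hg0 _ _ _ (by norm_num)
    have v6 : g false false 1 = 1 := hg0 _ _ _ (by norm_num)
    have v7 : g true false 1 = q - ξ := hg0 _ _ _ (by norm_num)
    have v8 : g true true 0 = ξ := hg0 _ _ _ (by norm_num)
    refine ⟨φ, g, hg, v1, v2, v3, v4, v5, 1, q, ξ, v6.symm, v8.symm, by rw [v7]; ring,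
      one_ne_zero, hq, hq1, ?_⟩
    have t1 := evalAt_top h φ hg false false
    have t2 := evalAt_top h φ hg true false
    simp only [topMoment, Bool.not_false, Bool.not_true, Bool.false_eq_true, if_false,
      Nat.add_one_sub_one, quadD_one, quadD_two, Finset.sum_range_succ, Finset.sum_range_zero,
      zero_add, Nat.reduceAdd, v1, v2, v3, v4, v5, v6, v7, v8, sub_zero] at t1 t2
    have e : (1 : F) ^ 2 * q ^ 2 - q ^ 2 * (g false false 2 + ξ * 1) -
        1 ^ 2 * (g true false 2 + 3 * (ξ * q)) + 1 * q * ξ * (1 + q) = 1 := by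
      refine Eq.trans ?_ hξ
      rw [t1, t2]
      field_simp
      ring
    rw [e]
    exact one_ne_zero
  -- For `N ≥ 3` the moments of order two are free and are set to zero.
  · obtain ⟨φ, g, hg, hg0⟩ := main fun e f s => if f = false ∧ s < 2 then 1 else 0
    have v1 : g false false 0 = 1 := (hg0 _ _ _ (by omega)).trans (by simp)
    have v2 : g true false 0 = 1 := (hg0 _ _ _ (by omega)).trans (by simp)
    have v3 : g false true 0 = 0 := (hg0 _ _ _ (by omega)).trans (by simp)
    have v4 : g false true 1 = 0 := (hg0 _ _ _ (by omega)).trans (by simp)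
    have v5 : g true true 1 = 0 := (hg0 _ _ _ (by omega)).trans (by simp)
    have v6 : g false false 1 = 1 := (hg0 _ _ _ (by omega)).trans (by simp)
    have v7 : g true false 1 = 1 := (hg0 _ _ _ (by omega)).trans (by simp)
    have v8 : g true true 0 = 0 := (hg0 _ _ _ (by omega)).trans (by simp)
    have v9 : g false false 2 = 0 := (hg0 _ _ _ (by omega)).trans (by simp)
    have v10 : g true false 2 = 0 := (hg0 _ _ _ (by omega)).trans (by simp)
    refine ⟨φ, g, hg, v1, v2, v3, v4, v5, 1, 1, 0, v6.symm, v8.symm, by rw [v7]; ring,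
      one_ne_zero, one_ne_zero, by norm_num, ?_⟩
    rw [v9, v10]
    norm_num

end EvaluationPoint

/-! ### Crossing the pole -/

section Pass

variable {F L : Type*} [Field F] [Field L] [Algebra F L] {N : ℕ} {u : ℤ → F} {x y : ℤ → L⟦X⟧}

variable [CharZero F]

/-- Everything is evaluated at the point from `exists_pole_eval`, where `v (n - 1)` vanishes. The
quotient `w` is reached through `(p q)² w`, which agrees with an explicit element up to a multiple
of `v (n - 1)`. -/
theorem IsGenericSolution.pole_units (h : IsGenericSolution N u x y) (n : ℤ)
    {π : bondAlg F N x y (n - 1)} (hπ : Prime π) (hπv : (π : L) = v0 x y (n - 1)) :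
    IsUnitIn (locAt hπ) (constantCoeff (toeplitzV x y (n - 1) * x n)) ∧
    IsUnitIn (locAt hπ) (constantCoeff (toeplitzV x y (n - 1) * y n)) ∧
    IsUnitIn (locAt hπ) (constantCoeff (ddt L (toeplitzV x y (n - 1)))) ∧
    ∀ w ∈ regular (locAt hπ), toeplitzV x y (n + 1) = toeplitzV x y (n - 1) * w →
      IsUnitIn (locAt hπ) (constantCoeff w) := by
  obtain ⟨φ, g, hg, h1, h2, h3, h4, h5, pc, qc, ξ, hpc, hξ, hqc, hp0, hq0, hpq, hΩ⟩ :=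
    h.exists_pole_eval (n - 1)
  obtain ⟨X, hX⟩ : ∃ X, X = regMoment h (n - 1) false false 0 := ⟨_, rfl⟩
  obtain ⟨Y, hY⟩ : ∃ Y, Y = regMoment h (n - 1) true false 0 := ⟨_, rfl⟩
  obtain ⟨P, hP⟩ : ∃ P, P = regMoment h (n - 1) false false 1 +
    X * (X * regMoment h (n - 1) false true 0) := ⟨_, rfl⟩
  obtain ⟨Q, hQ⟩ : ∃ Q, Q = regMoment h (n - 1) true false 1 +
    Y * (Y * regMoment h (n - 1) true true 0) := ⟨_, rfl⟩
  obtain ⟨V, hV⟩ : ∃ V, V = 1 - X * Y := ⟨_, rfl⟩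
  obtain ⟨eX, eY, eV, eP, eQ, edV, edP, edQ⟩ :=
    h.evalAt_pole φ hg h1 h2 h3 h4 h5 hX hY hP hQ hV hpc hξ hqc
  have f1 := h.flow (n - 1)
  have f2 := h.flow n
  simp only [FlowAt, sub_add_cancel] at f1 f2
  rw [show n - 1 - 1 = n - 2 by ring] at f1
  have cX : (X : L⟦X⟧) = x (n - 1) := by rw [hX]; exact bondA_zero _ _ _
  have cY : (Y : L⟦X⟧) = y (n - 1) := by rw [hY]; exact bondA_zero _ _ _
  have cy : (regMoment h (n - 1) false true 0 : L⟦X⟧) = y (n - 2) := by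
    refine (bondB_zero _ _ _).trans ?_
    congr 1; ring
  have cx : (regMoment h (n - 1) true true 0 : L⟦X⟧) = x (n - 2) := by
    refine (bondB_zero _ _ _).trans ?_
    congr 1; ring
  have cV : (V : L⟦X⟧) = toeplitzV x y (n - 1) := by
    rw [hV, toeplitzV, ← cX, ← cY]; rfl
  have cP : (P : L⟦X⟧) = toeplitzV x y (n - 1) * x n := by
    have e := deriv_bondMoment h.flow (flowAt_v_ne h.v_ne) (n - 1) false false 0
    simp only [bondMoment, bondA_zero, bondB_zero, momentField, quadD_one, quadD_zero,
      Bool.not_false, Bool.false_eq_true, if_false, one_mul] at e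
    rw [f1.1, show n - 1 - 1 = n - 2 by ring] at e
    have e2 : (P : L⟦X⟧) = bondA x y (n - 1) 1 + x (n - 1) * (x (n - 1) * y (n - 2)) := by
      rw [hP, ← cX, ← cy]; rfl
    rw [e2]
    have e3 : toeplitzV x y (n - 1) = 1 - x (n - 1) * y (n - 1) := rfl
    linear_combination -e - x (n - 2) * e3
  have cQ : (Q : L⟦X⟧) = toeplitzV x y (n - 1) * y n := by
    have e := deriv_bondMoment h.flow (flowAt_v_ne h.v_ne) (n - 1) true false 0
    simp only [bondMoment, bondA_zero, bondB_zero, momentField, quadD_one, quadD_zero,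
      Bool.not_false, Bool.not_true, Bool.false_eq_true, if_false, one_mul] at e
    rw [f1.2, show n - 1 - 1 = n - 2 by ring] at e
    have e2 : (Q : L⟦X⟧) = bondA y x (n - 1) 1 + y (n - 1) * (y (n - 1) * x (n - 2)) := by
      rw [hQ, ← cY, ← cx]; rfl
    rw [e2]
    have e3 : toeplitzV x y (n - 1) = 1 - x (n - 1) * y (n - 1) := rfl
    linear_combination -e - y (n - 2) * e3
  have φπ : φ π = 0 := by
    rw [← eV]
    refine congrArg φ (Subtype.ext ?_)
    rw [hπv, v0, ← cV]
  have key : ∀ f : regular (bondAlg F N x y (n - 1)), evalAt φ f ≠ 0 →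
      IsUnitIn (locAt hπ) (constantCoeff (f : L⟦X⟧)) := fun f hf =>
    isUnitIn_of_evalAt_ne hπ φπ hf
  have uP := key P (by rwa [eP])
  have uQ := key Q (by rwa [eQ])
  have udV := key (regDeriv V) (by rw [edV]; exact neg_ne_zero.mpr hpq)
  -- This is `(p q)² w` modulo `v`: the bracket in `v_past_pole` with `G = -p q` and `δ v = -(X q +
  -- Y p)` inserted.
  have uΩ := key (P * P * (Q * Q) - X * (Q * Q) * regDeriv P - Y * (P * P) * regDeriv Q +
      P * Q * (regMoment h (n - 1) true true 0 * Y + X * regMoment h (n - 1) false true 0) *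
        (X * Q + Y * P)) (by
    simp only [map_add, map_sub, map_mul, hg, eX, eY, eP, eQ, edP, edQ, h3, ← hξ]
    convert hΩ using 1
    ring)
  refine ⟨cP ▸ uP, cQ ▸ uQ, cV ▸ udV, fun w mw hw => ?_⟩
  have up : ∀ f : regular (bondAlg F N x y (n - 1)), (f : L⟦X⟧) ∈ regular (locAt hπ) := fun f =>
    regular_mono (le_locAt hπ) f.2
  have v0' : (V : L⟦X⟧) ≠ 0 := by rw [cV]; exact flowAt_v_ne h.v_ne _
  have eV' : (V : L⟦X⟧) = 1 - X * Y := by rw [hV]; rfl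
  rw [← cX, ← cY, ← cV, ← cx, ← cy] at f1
  rw [← cX, ← cY] at f2
  rw [← cV] at hw cP cQ
  have h6 := v_past_pole (G := (V : L⟦X⟧) ^ 2 - P * Q) eV' f1.1 f1.2 cP cQ rfl rfl f2.1 f2.2
  change _ * toeplitzV x y (n + 1) = _ at h6
  rw [hw, mul_left_comm] at h6
  have h7 := mul_left_cancel₀ v0' h6
  have h8 := deriv_one_sub_mul eV' f1.1 f1.2 cP cQ rfl
  obtain ⟨s, hs⟩ : ∃ s : regular (locAt hπ), (P * P * (Q * Q) : L⟦X⟧) * w =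
      (P * P * (Q * Q) - X * (Q * Q) * ddt L P - Y * (P * P) * ddt L Q +
      P * Q * (regMoment h (n - 1) true true 0 * Y + X * regMoment h (n - 1) false true 0) *
        (X * Q + Y * P) : L⟦X⟧) + V * s := by
    let i : regular (bondAlg F N x y (n - 1)) → regular (locAt hπ) := fun f => ⟨f, up f⟩
    let r := i (regMoment h (n - 1) true true 0 * Y + X * regMoment h (n - 1) false true 0)
    refine ⟨i V * (i V * i V - (i P * i Q + i P * i Q)) - i V * (i X * i (regDeriv Q) + i Y * i (regDeriv P)) +
      r * r * (i V * i V - i P * i Q) - (i X * i Q + i Y * i P) * r * i V -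
      i (regDeriv V) * i (regDeriv V) - i (regDeriv P) * i (regDeriv Q) +
      r * (i (regDeriv P) * i Q + i P * i (regDeriv Q)) -
      (i V * i V * i V - (i P * i Q + i P * i Q) * i V) * ⟨w, mw⟩, ?_⟩
    have er : (r : L⟦X⟧) = regMoment h (n - 1) true true 0 * Y +
      X * regMoment h (n - 1) false true 0 := rfl
    rw [← er] at h7 h8 ⊢
    change _ = _ + (V : L⟦X⟧) * ((V : L⟦X⟧) * (V * V - (P * Q + P * Q)) -
      V * (X * ddt L Q + Y * ddt L P) + r * r * (V * V - P * Q) - (X * Q + Y * P) * r * V -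
      ddt L V * ddt L V - ddt L P * ddt L Q + r * (ddt L P * Q + P * ddt L Q) -
      (V * V * V - (P * Q + P * Q) * V) * w)
    linear_combination h7 + ((r : L⟦X⟧) * (V ^ 2 - P * Q) + (ddt L P * Q + P * ddt L Q)) * h8
  have hc := congrArg constantCoeff hs
  rw [map_mul, map_add, map_mul constantCoeff (V : L⟦X⟧)] at hc
  have mw' := constantCoeff_mem mw
  have hV0 : ¬IsUnitIn (locAt hπ) (constantCoeff (V : L⟦X⟧)) := by
    rw [cV, ← v0, ← hπv, isUnitIn_locAt_iff, not_not]
  have hmV := constantCoeff_mem (up V)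
  have hms := constantCoeff_mem s.2
  have hu := isLocalIn_locAt hπ _ _ uΩ (mul_mem hmV hms) fun hu => hV0 (hu.of_mul_left hmV hms)
  have hu2 : IsUnitIn (locAt hπ) (constantCoeff w * constantCoeff (P * P * (Q * Q) : L⟦X⟧)) := by
    rw [mul_comm, hc]
    exact hu
  exact hu2.of_mul_left mw' (constantCoeff_mem (up (P * P * (Q * Q))))

/-- The ring of a pole dominates the bonds on both sides of the pole. -/
theorem IsGenericSolution.pass (h : IsGenericSolution N u x y) (n : ℤ)
    {π : bondAlg F N x y (n - 1)} (hπ : Prime π) (hπv : (π : L) = v0 x y (n - 1)) :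
    Dominates (locAt hπ) (bondAlg F N x y (n + 2)) ∧
    (∃ w, IsUnitIn (locAt hπ) w ∧ v0 x y (n + 1) = v0 x y (n - 1) * w) ∧
    IsUnitIn (locAt hπ) (v0 x y n * v0 x y (n - 1) ^ 2) ∧
    IsUnitIn (locAt hπ) (v0 x y (n - 1) * constantCoeff (x n)) ∧
    ∃ w ∈ regular (locAt hπ), toeplitzV x y (n + 1) = toeplitzV x y (n - 1) * w := by
  obtain ⟨up, uq, ud, uw⟩ := h.pole_units n hπ hπv
  set O := locAt hπ with hO
  have hloc : IsLocalIn O := isLocalIn_locAt hπ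
  have hD := dominates_locAt hπ
  have hB : BondRegular O x y (n - 1) := h.bondRegular_iff.mpr hD.1
  have hvn : ¬IsUnitIn O (constantCoeff (toeplitzV x y (n - 1))) := by
    rw [← v0, ← hπv, hO, isUnitIn_locAt_iff, not_not]
  have v0ne := flowAt_v_ne h.v_ne
  have mV : toeplitzV x y (n - 1) ∈ regular O := sub_mem (one_mem _) (mul_mem hB.2.1 hB.2.2)
  have mP : constantCoeff (toeplitzV x y (n - 1)) ∈ O := constantCoeff_mem mV
  have uG : IsUnitIn O (v0 x y n * v0 x y (n - 1) ^ 2) := by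
    have e : v0 x y n * v0 x y (n - 1) ^ 2 =
        constantCoeff (toeplitzV x y (n - 1) * x n) * constantCoeff (toeplitzV x y (n - 1) * y n) *
          algebraMap F L (-1) + v0 x y (n - 1) * v0 x y (n - 1) := by
      rw [v0_eq n, map_mul, map_mul, v0, map_neg, map_one]
      ring
    rw [e]
    exact hloc _ _ ((up.mul uq).mul (IsUnitIn.algebraMap (by simp))) (mul_mem mP mP)
      fun hu => hvn (hu.of_mul_left mP mP)
  obtain ⟨hf, w, mw, hw⟩ := confinement le_rfl (fun _ _ h => h) hloc
    (fun _ => ddt_mem_regular) (h.flow _) (h.flow _) (h.flow _) hB (v0ne _) hvn up uq ud uw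
  have hwu := uw w mw hw
  have h1 := h.bondRegular_iff.mp hf
  have hw0 : v0 x y (n + 1) = v0 x y (n - 1) * constantCoeff w := by
    rw [v0, hw, map_mul, v0]
  refine ⟨hD.trans h1 ?_, ⟨_, hwu, hw0⟩, uG, by rwa [v0, ← map_mul],
    w, mw, hw⟩
  -- For domination the pole is crossed backwards, starting from the algebra at the bond `n + 2`. In
  -- the reversed lattice `v (n + 1)` takes the role of `v (n - 1)`, and the quotient of the two
  -- becomes the inverse of `w`.
  set B := loc (bondAlg F N x y (n + 2)) O with hBdef
  have hBO : B ≤ O := loc_le h1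
  have hBr : BondRegular B x y (n + 2) := h.bondRegular_iff.mpr le_loc
  have hx : ∀ j : ℤ, toeplitzV (refl x) (refl y) j = toeplitzV x y (-j) := fun j => rfl
  have e1 : -(-n - 1) = n + 1 := by ring
  have e2 : -(-n - 2) = n + 2 := by ring
  have e3 : -(-n + 1) = n - 1 := by ring
  have e4 : -(-n + 2) = n - 2 := by ring
  obtain ⟨hcon, -⟩ := confinement (n := -n) (x := refl x) (y := refl y) (δ := -ddt L) hBO
    (fun z hz hzO => inv_mem_loc hz hzO) hloc (fun f hf => neg_mem (ddt_mem_regular hf))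
    (flowAt_refl_neg (h.flow _)) (flowAt_refl_neg (h.flow _)) (flowAt_refl_neg (h.flow _))
    (by
      rw [BondRegular, show -n - 1 - 1 = -n - 2 by ring, refl, refl, refl, refl, e1, e2]
      have := hBr
      rw [BondRegular, show n + 2 - 1 = n + 1 by ring] at this
      exact ⟨this.2, this.1⟩)
    (by rw [hx]; exact v0ne _)
    (by
      rw [hx, e1, ← v0, hw0]
      exact fun hu => hvn (hu.of_mul_left mP hwu.1))
    (by
      rw [hx, e1, hw, refl, neg_neg, mul_right_comm, map_mul]
      exact up.mul hwu)
    (by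
      rw [hx, e1, hw, refl, neg_neg, mul_right_comm, map_mul]
      exact uq.mul hwu)
    (by
      rw [hx, e1, hw]
      have e5 : (-ddt L) (toeplitzV x y (n - 1) * w) = -(w * ddt L (toeplitzV x y (n - 1))) +
          toeplitzV x y (n - 1) * -ddt L w := by
        change -(ddt L (toeplitzV x y (n - 1) * w)) = _
        rw [deriv_mul_eq]
        ring
      rw [e5, map_add]
      have mdw : constantCoeff (-ddt L w) ∈ O := constantCoeff_mem (neg_mem (ddt_mem_regular mw))
      rw [map_mul constantCoeff (toeplitzV x y (n - 1)), map_neg, map_mul]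
      refine hloc _ _ ?_ (mul_mem mP mdw) fun hu => hvn (hu.of_mul_left mP mdw)
      have := (hwu.mul ud).mul (IsUnitIn.algebraMap (neg_ne_zero.mpr (one_ne_zero (α := F))))
      simpa using this)
    (fun w' mw' hw' => by
      rw [hx, hx, e3, e1, hw] at hw'
      have : w * w' = 1 := mul_left_cancel₀ (v0ne (n - 1)) (by
        rw [mul_one, ← mul_assoc, ← hw'])
      have hc := congrArg constantCoeff this
      rw [map_mul, map_one] at hc
      rw [eq_inv_of_mul_eq_one_right hc]
      exact hwu.inv)
  rw [BondRegular, show -n + 2 - 1 = -n + 1 by ring, refl, refl, refl, refl, e3, e4] at hcon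
  refine h.bondRegular_iff.mp ?_
  rw [BondRegular, show n - 1 - 1 = n - 2 by ring]
  exact ⟨hcon.2, hcon.1⟩

end Pass

/-! ### The valuation ring of a pole has no other pole -/

section PoleRing

variable {F L : Type*} [Field F] [Field L] [Algebra F L] {N : ℕ} {u : ℤ → F} {x y : ℤ → L⟦X⟧}
  [CharZero F]

/-- The ring of initial values whose solutions have a pole at a given site, specialised. -/
noncomputable def poleRing (h : IsGenericSolution N u x y) (n : ℤ) : Subalgebra F L :=
  locAt (h.v0_prime (n - 1)).choose_spec.1

theorem dominates_poleRing (h : IsGenericSolution N u x y) (n : ℤ) :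
    Dominates (poleRing h n) (bondAlg F N x y (n - 1)) :=
  dominates_locAt _

theorem pass_poleRing (h : IsGenericSolution N u x y) (n : ℤ) :
    Dominates (poleRing h n) (bondAlg F N x y (n + 2)) ∧
    (∃ w, IsUnitIn (poleRing h n) w ∧ v0 x y (n + 1) = v0 x y (n - 1) * w) ∧
    IsUnitIn (poleRing h n) (v0 x y n * v0 x y (n - 1) ^ 2) ∧
    IsUnitIn (poleRing h n) (v0 x y (n - 1) * constantCoeff (x n)) ∧
    ∃ w ∈ regular (poleRing h n), toeplitzV x y (n + 1) = toeplitzV x y (n - 1) * w :=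
  h.pass n _ (h.v0_prime (n - 1)).choose_spec.2

theorem not_isUnitIn_poleRing (h : IsGenericSolution N u x y) (n : ℤ) :
    ¬IsUnitIn (poleRing h n) (v0 x y (n - 1)) := by
  rw [← (h.v0_prime (n - 1)).choose_spec.2, poleRing, isUnitIn_locAt_iff, not_not]

theorem isArch_poleRing (h : IsGenericSolution N u x y) (n : ℤ) : IsArch (poleRing h n) := by
  have := h.ufd (n - 1)
  exact isArch_locAt _

variable {O : Subalgebra F L}

theorem eq_poleRing (h : IsGenericSolution N u x y) {n : ℤ}
    (hD : Dominates O (bondAlg F N x y (n - 1))) (hA : IsArch O)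
    (hn : ¬IsUnitIn O (v0 x y (n - 1))) : O = poleRing h n :=
  hD.eq_locAt _ hA (by rwa [(h.v0_prime (n - 1)).choose_spec.2])

theorem v0_mem_bondAlg (h : IsGenericSolution N u x y) (k : ℤ) : v0 x y k ∈ bondAlg F N x y k := by
  obtain ⟨p, -, hp⟩ := h.v0_prime k
  rw [← hp]
  exact p.2

/-- `v (n + 1)` is prime in the algebra at the bond `n + 2`, and it is a nonunit both in `O` and in
the ring of the pole, where it is `v (n - 1)` times a unit. Both rings are the localization at this
prime. -/
theorem eq_poleRing_of_dominates_right (h : IsGenericSolution N u x y) {n : ℤ}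
    (hD : Dominates O (bondAlg F N x y (n + 2))) (hA : IsArch O) (hn : ¬IsUnitIn O (v0 x y (n + 1))) : O = poleRing h n := by
  obtain ⟨p, hp, hpv⟩ := h.v0_prime_pred (n + 1)
  have e : n + 1 + 1 = n + 2 := by ring
  rw [← e] at hD
  obtain ⟨h1, ⟨w, hw, hvw⟩, -, -⟩ := pass_poleRing h n
  rw [← e] at h1
  rw [hD.eq_locAt hp hA (by rwa [hpv]), h1.eq_locAt hp (isArch_poleRing h n)]
  rw [hpv, hvw]
  exact fun hu => not_isUnitIn_poleRing h n (hu.of_mul_left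
    ((dominates_poleRing h n).1 (v0_mem_bondAlg h _)) hw.1)

theorem Dominates.succ {k : ℤ} (hD : Dominates O (bondAlg F N x y k))
    (h : IsGenericSolution N u x y) (hv : IsUnitIn O (v0 x y k)) : Dominates O (bondAlg F N x y (k + 1)) := by
  refine hD.trans (h.bondRegular_iff.mp
    (BondRegular.succ h.toIsGammaSolution (h.bondRegular_iff.mpr hD.1) hv.2.2)) ?_
  have hB : BondRegular (loc (bondAlg F N x y (k + 1)) O) x y (k + 1) :=
    h.bondRegular_iff.mpr le_loc
  refine h.bondRegular_iff.mp (BondRegular.pred h.toIsGammaSolution hB (inv_mem_loc ?_ hv.2.2))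
  rw [BondRegular, add_sub_cancel_right] at hB
  exact constantCoeff_mem (sub_mem (one_mem _) (mul_mem hB.1.1 hB.1.2))

theorem Dominates.pred {k : ℤ} (hD : Dominates O (bondAlg F N x y (k + 1)))
    (h : IsGenericSolution N u x y) (hv : IsUnitIn O (v0 x y k)) : Dominates O (bondAlg F N x y k) := by
  refine hD.trans (h.bondRegular_iff.mp
    (BondRegular.pred h.toIsGammaSolution (h.bondRegular_iff.mpr hD.1) hv.2.2)) ?_
  have hB : BondRegular (loc (bondAlg F N x y k) O) x y k := h.bondRegular_iff.mpr le_loc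
  refine h.bondRegular_iff.mp (BondRegular.succ h.toIsGammaSolution hB (inv_mem_loc ?_ hv.2.2))
  exact constantCoeff_mem (sub_mem (one_mem _) (mul_mem hB.2.1 hB.2.2))

theorem Dominates.add {k : ℤ} (hD : Dominates O (bondAlg F N x y k))
    (h : IsGenericSolution N u x y) (m : ℕ)
    (hv : ∀ j < m, IsUnitIn O (v0 x y (k + j))) : Dominates O (bondAlg F N x y (k + m)) := by
  induction m with
  | zero => simpa using hD
  | succ m ih =>
    push_cast
    rw [← add_assoc]
    exact (ih fun j hj => hv j (by omega)).succ h (hv m (by omega))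

theorem Dominates.sub {k : ℤ} (hD : Dominates O (bondAlg F N x y k))
    (h : IsGenericSolution N u x y) (m : ℕ)
    (hv : ∀ j < m, IsUnitIn O (v0 x y (k - 1 - j))) : Dominates O (bondAlg F N x y (k - m)) := by
  induction m with
  | zero => simpa using hD
  | succ m ih =>
    push_cast
    refine Dominates.pred ?_ h (by
      have := hv m (by omega)
      rwa [show k - 1 - (m : ℤ) = k - (m + 1) by ring] at this)
    rw [show k - ((m : ℤ) + 1) + 1 = k - m by ring]
    exact ih fun j hj => hv j (by omega)

/-- A weighted product of values of `v` in which a pole cancels. -/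
noncomputable def vProd (x y : ℤ → L⟦X⟧) (n : ℤ) (d : ℕ) : L :=
  ∏ j ∈ Finset.range d, v0 x y (n + 1 + j) ^ (d - 1 - j)

/-- At a pole at the site `m` the values of `v` at `m - 1, m, m + 1` have orders `1, -2, 1`, so
exponents in arithmetic progression cancel. The factors to the left are units by `hlt`, those to the
right by `ih`. -/
theorem vProd_unit_of_pole (h : IsGenericSolution N u x y) {n : ℤ} {d : ℕ}
    (ih : ∀ d' : ℕ, 3 ≤ d' → d' < d → ∀ n, IsUnitIn (poleRing h n) (v0 x y (n + d' - 1)))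
    {j₀ : ℕ} (hj : j₀ + 3 ≤ d) (hO : O = poleRing h (n + 1 + j₀ + 1))
    (hlt : ∀ j < j₀, IsUnitIn O (v0 x y (n + 1 + j))) : IsUnitIn O (vProd x y n d) := by
  obtain ⟨r, rfl⟩ := Nat.exists_eq_add_of_le hj
  rw [vProd, Finset.prod_range_add, Finset.prod_range_succ, Finset.prod_range_succ,
    Finset.prod_range_succ]
  obtain ⟨-, ⟨w, hw, hvw⟩, hG, -⟩ := pass_poleRing h (n + 1 + j₀ + 1)
  rw [← hO] at hw hG
  rw [show n + 1 + (j₀ : ℤ) + 1 - 1 = n + 1 + j₀ by ring] at hvw hG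
  have e1 : j₀ + 3 + r - 1 - j₀ = r + 2 := by omega
  have e2 : j₀ + 3 + r - 1 - (j₀ + 1) = r + 1 := by omega
  have e3 : j₀ + 3 + r - 1 - (j₀ + 2) = r := by omega
  rw [e1, e2, e3]
  have e4 : n + 1 + ((j₀ + 1 : ℕ) : ℤ) = n + 1 + j₀ + 1 := by push_cast; ring
  have e5 : n + 1 + ((j₀ + 2 : ℕ) : ℤ) = n + 1 + j₀ + 1 + 1 := by push_cast; ring
  rw [e4, e5, hvw]
  have e6 : ∀ p v v' s w : L, p * v ^ (r + 2) * v' ^ (r + 1) * (v * w) ^ r * s =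
      p * ((v' * v ^ 2) ^ (r + 1) * w ^ r) * s := fun p v v' s w => by ring
  rw [e6]
  refine IsUnitIn.mul (IsUnitIn.mul (IsUnitIn.prod fun j hj => ?_) ((hG.pow _).mul (hw.pow _)))
    (IsUnitIn.prod fun j hj => ?_)
  · exact (hlt j (Finset.mem_range.mp hj)).pow _
  · rw [Finset.mem_range] at hj
    rw [hO]
    have := ih (j + 3) (by omega) (by omega) (n + 1 + j₀ + 1)
    refine IsUnitIn.pow ?_ _
    convert this using 2
    push_cast
    ring

/-- Induction on the distance. If `v` at `n + d - 1` is a nonunit, the values in between are units,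
so the ring dominates the bond `n + d - 1` and is also the ring of a pole at `n + d`. At a prime of
the polynomial ring at the bond `n + 1`, the first nonunit among the following `v` creates a pole,
whose contribution to `vProd` cancels. So `vProd` is a unit at all primes and lies in `F`,
contradicting the factor `v (n + 1)`, a nonunit in the ring of the pole at `n`. -/
theorem isUnitIn_poleRing_right (h : IsGenericSolution N u x y) (d : ℕ) (hd : 3 ≤ d) :
    ∀ n, IsUnitIn (poleRing h n) (v0 x y (n + d - 1)) := by
  induction d using Nat.strong_induction_on with
  | _ d ih =>
    have ih' : ∀ d' : ℕ, 3 ≤ d' → d' < d → ∀ n, IsUnitIn (poleRing h n) (v0 x y (n + d' - 1)) :=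
      fun d' h3 hlt => ih d' hlt h3
    intro n
    obtain ⟨r, rfl⟩ := Nat.exists_eq_add_of_le' hd
    by_contra hnu
    have hun : ∀ j < r, IsUnitIn (poleRing h n) (v0 x y (n + 2 + j)) := by
      intro j hj
      have := ih' (j + 3) (by omega) (by omega) n
      convert this using 2
      push_cast
      ring
    have hDm : Dominates (poleRing h n) (bondAlg F N x y (n + (r + 3 : ℕ) - 1)) := by
      have := (pass_poleRing h n).1.add h r hun
      convert this using 2
      push_cast
      ring
    have hnm := eq_poleRing h hDm (isArch_poleRing h n) hnu
    have hxn : constantCoeff (x n) ∉ poleRing h n := fun hx => by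
      obtain ⟨-, -, -, hu, -⟩ := pass_poleRing h n
      exact not_isUnitIn_poleRing h n (hu.of_mul_left
        ((dominates_poleRing h n).1 (v0_mem_bondAlg h _)) hx)
    have := h.ufd (n + 1)
    -- the product is a unit at all primes of the bond between `n` and `n + 1`
    have hprime : ∀ (q : bondAlg F N x y (n + 1)) (hq : Prime q),
        IsUnitIn (locAt hq) (vProd x y n (r + 3)) := by
      intro q hq
      by_cases hall : ∀ j < r + 2, IsUnitIn (locAt hq) (v0 x y (n + 1 + j))
      · refine IsUnitIn.prod fun j hj => ?_
        rw [Finset.mem_range] at hj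
        rcases Nat.lt_or_ge j (r + 2) with h1 | h1
        · exact (hall j h1).pow _
        · rw [show r + 3 - 1 - j = 0 by omega, pow_zero]
          exact IsUnitIn.one
      · push Not at hall
        classical
        have hex := hall
        set j₀ := Nat.find hex with hj₀
        obtain ⟨hlt, hnu₀⟩ := Nat.find_spec hex
        rw [← hj₀] at hlt hnu₀
        have hmin : ∀ j < j₀, IsUnitIn (locAt hq) (v0 x y (n + 1 + j)) := by
          intro j hj
          have := Nat.find_min hex hj
          push Not at this
          exact this (by omega)
        have hDj := (dominates_locAt hq).add h j₀ hmin
        have hpole : locAt hq = poleRing h (n + 1 + j₀ + 1) := by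
          refine eq_poleRing h ?_ (isArch_locAt hq) ?_
          · rwa [add_sub_cancel_right]
          · rwa [add_sub_cancel_right]
        rcases (show j₀ + 3 ≤ r + 3 ∨ j₀ = r + 1 by omega) with h1 | h1
        · exact vProd_unit_of_pole h ih' h1 hpole hmin
        -- The localization would be the ring of the pole at `n + d`, hence the one of the pole at
        -- `n`; but it contains the initial value of `x n`, a site adjacent to the bond `n + 1`.
        · exfalso
          have e : n + 1 + (j₀ : ℤ) + 1 = n + (r + 3 : ℕ) := by
            rw [h1]; push_cast; ring
          rw [e, ← hnm] at hpole
          apply hxn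
          have hB := h.bondRegular_iff.mpr (le_locAt hq)
          rw [BondRegular, add_sub_cancel_right] at hB
          rw [← hpole]
          exact constantCoeff_mem hB.1.1
    have hv0 : ∀ k, v0 x y k ≠ 0 := h.v_ne
    have hg0 : vProd x y n (r + 3) ≠ 0 := Finset.prod_ne_zero_iff.mpr fun j _ => pow_ne_zero _ (hv0 _)
    obtain ⟨a, ha, b, hb, hab⟩ := h.exists_div (n + 1) (vProd x y n (r + 3))
    have hb0 : b ≠ 0 := by
      rintro rfl
      rw [div_zero] at hab
      exact hg0 hab
    obtain ⟨c, hc, hgc⟩ := exists_unit_of_isUnitIn_locAt (a := ⟨a, ha⟩) (b := ⟨b, hb⟩)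
      (fun h => hb0 (congrArg Subtype.val h)) hab hprime hg0
    obtain ⟨c', hc'⟩ := h.eq_algebraMap_of_isUnit hc
    have hc0 : c' ≠ 0 := by
      rintro rfl
      rw [hgc, hc', map_zero] at hg0
      exact hg0 rfl
    have hgu : IsUnitIn (poleRing h n) (vProd x y n (r + 3)) := by
      rw [hgc, hc']
      exact IsUnitIn.algebraMap hc0
    -- All factors lie in the ring of the pole at `n`, and the first one is a positive power of the
    -- nonunit `v (n + 1)`.
    rw [vProd, Finset.prod_range_succ'] at hgu
    obtain ⟨-, ⟨w, hw, hvw⟩, -, -⟩ := pass_poleRing h n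
    have m0 : v0 x y (n - 1) ∈ poleRing h n := (dominates_poleRing h n).1 (v0_mem_bondAlg h _)
    have m1 : v0 x y (n + 1) ∈ poleRing h n := by
      rw [hvw]
      exact mul_mem m0 hw.1
    have m2 : ∏ j ∈ Finset.range (r + 2), v0 x y (n + 1 + (j + 1 : ℕ)) ^ (r + 3 - 1 - (j + 1)) ∈
        poleRing h n := by
      refine prod_mem fun j hj => ?_
      rw [Finset.mem_range] at hj
      rcases (show j < r ∨ j = r ∨ j = r + 1 by omega) with h1 | h1 | h1
      · refine pow_mem ?_ _
        have := (hun j h1).1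
        convert this using 2
        push_cast
        ring
      · refine pow_mem ?_ _
        have := hDm.1 (v0_mem_bondAlg h _)
        convert this using 2
        rw [h1]
        push_cast
        ring
      · rw [show r + 3 - 1 - (j + 1) = 0 by omega, pow_zero]
        exact one_mem _
    rw [mul_comm] at hgu
    have hu1 := hgu.of_mul_left (pow_mem (by simpa using m1) _) m2
    rw [Nat.cast_zero, add_zero, hvw, show r + 3 - 1 - 0 = r + 1 + 1 by omega, pow_succ, mul_comm,
      mul_assoc] at hu1
    exact not_isUnitIn_poleRing h n (hu1.of_mul_left m0
      (mul_mem hw.1 (pow_mem (mul_mem m0 hw.1) _)))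

theorem dominates_poleRing_right (h : IsGenericSolution N u x y) (n : ℤ) (m : ℕ) :
    Dominates (poleRing h n) (bondAlg F N x y (n + 2 + m)) :=
  (pass_poleRing h n).1.add h m fun j _ => by
    have := isUnitIn_poleRing_right h (j + 3) (by omega) n
    convert this using 2
    push_cast
    ring

/-- If `v` at `n - 2 - m` were the nearest nonunit on the left, the ring would also be the ring of a
pole at `n - 3 - m`. There `v (n - 1)` lies to the right and is a unit, whereas it is a nonunit for
the pole at `n`. -/
theorem isUnitIn_poleRing_left (h : IsGenericSolution N u x y) (n : ℤ) (m : ℕ) :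
    IsUnitIn (poleRing h n) (v0 x y (n - 2 - m)) := by
  induction m using Nat.strong_induction_on with
  | _ m ih =>
    by_contra hnu
    have hD := (dominates_poleRing h n).sub h m (fun j hj => by
      have := ih j hj
      rwa [show n - 1 - 1 - (j : ℤ) = n - 2 - j by ring])
    have e : n - 1 - (m : ℤ) = (n - 3 - m) + 2 := by ring
    rw [e] at hD
    rw [show n - 2 - (m : ℤ) = (n - 3 - m) + 1 by ring] at hnu
    have hp := eq_poleRing_of_dominates_right h hD (isArch_poleRing h n) hnu
    apply not_isUnitIn_poleRing h n
    rw [hp]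
    have := isUnitIn_poleRing_right h (m + 3) (by omega) (n - 3 - m)
    convert this using 2
    push_cast
    ring

theorem dominates_poleRing_left (h : IsGenericSolution N u x y) (n : ℤ) (m : ℕ) :
    Dominates (poleRing h n) (bondAlg F N x y (n - 1 - m)) :=
  (dominates_poleRing h n).sub h m fun j _ => by
    have := isUnitIn_poleRing_left h n j
    rwa [show n - 1 - 1 - (j : ℤ) = n - 2 - j by ring]

/-- All sites except the pole are regular. -/
theorem regular_poleRing (h : IsGenericSolution N u x y) (n : ℤ) {j : ℤ} (hj : j ≠ n) :
    x j ∈ regular (poleRing h n) ∧ y j ∈ regular (poleRing h n) := by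
  rcases lt_or_gt_of_ne hj with h1 | h1
  · have := h.bondRegular_iff.mpr (dominates_poleRing_left h n (n - 1 - j).toNat).1
    rw [show n - 1 - ((n - 1 - j).toNat : ℤ) = j by omega] at this
    exact this.2
  · have := h.bondRegular_iff.mpr (dominates_poleRing_right h n (j - n - 1).toNat).1
    rw [show n + 2 + ((j - n - 1).toNat : ℤ) = j + 1 by omega, BondRegular,
      add_sub_cancel_right] at this
    exact this.1

end PoleRing

/-! ### Derivation of Laurent series -/

section LaurentDerivation

variable {K : Type*} [Field K]

theorem coeff_laurent_derivative (f : LaurentSeries K) (i : ℤ) :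
    (LaurentSeries.derivative K f).coeff i = (i + 1 : ℤ) * f.coeff (i + 1) := by
  rw [LaurentSeries.derivative_apply, LaurentSeries.hasseDeriv_coeff, Nat.cast_one,
    Ring.choose_one_right, zsmul_eq_mul]

theorem laurent_derivative_single_mul (k : ℤ) (f : LaurentSeries K) :
    LaurentSeries.derivative K (HahnSeries.single k 1 * f) =
      HahnSeries.single k 1 * LaurentSeries.derivative K f +
        HahnSeries.single (k - 1) (k : K) * f := by
  ext i
  rw [HahnSeries.coeff_add, coeff_laurent_derivative, HahnSeries.coeff_single_mul,
    HahnSeries.coeff_single_mul, HahnSeries.coeff_single_mul, coeff_laurent_derivative,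
    show i - (k - 1) = i + 1 - k by ring, show i - k + 1 = i + 1 - k by ring]
  push_cast
  ring

theorem laurent_derivative_ofPowerSeries (f : K⟦X⟧) :
    LaurentSeries.derivative K (HahnSeries.ofPowerSeries ℤ K f) =
      HahnSeries.ofPowerSeries ℤ K (ddt K f) := by
  ext i
  rw [coeff_laurent_derivative, PowerSeries.coeff_coe, PowerSeries.coeff_coe]
  rcases lt_trichotomy i (-1) with h | rfl | h
  · rw [if_pos (by omega), if_pos (by omega), mul_zero]
  · simp
  · obtain ⟨m, rfl⟩ := Int.eq_ofNat_of_zero_le (show 0 ≤ i by omega)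
    rw [if_neg (by omega), if_neg (by omega), coeff_ddt, mul_comm]
    push_cast
    rfl

/-- Each factor is a power of `t` times a power series, which reduces the claim to the Leibniz rule
for power series. -/
theorem laurent_derivative_mul (f g : LaurentSeries K) :
    LaurentSeries.derivative K (f * g) =
      f * LaurentSeries.derivative K g + g * LaurentSeries.derivative K f := by
  rw [← LaurentSeries.single_order_mul_powerSeriesPart f,
    ← LaurentSeries.single_order_mul_powerSeriesPart g]
  generalize f.order = a
  generalize g.order = b
  generalize f.powerSeriesPart = f
  generalize g.powerSeriesPart = g
  have e : HahnSeries.single a (1 : K) * HahnSeries.ofPowerSeries ℤ K f *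
      (HahnSeries.single b 1 * HahnSeries.ofPowerSeries ℤ K g) =
      HahnSeries.single (a + b) 1 * HahnSeries.ofPowerSeries ℤ K (f * g) := by
    rw [map_mul, mul_mul_mul_comm, HahnSeries.single_mul_single, one_mul]
  have e2 : ∀ c d : ℤ, ∀ z : K, HahnSeries.single (c + d) z =
      HahnSeries.single c (1 : K) * HahnSeries.single d z := fun c d z => by
    rw [HahnSeries.single_mul_single, one_mul]
  rw [e, laurent_derivative_single_mul, laurent_derivative_single_mul,
    laurent_derivative_single_mul, laurent_derivative_ofPowerSeries,
    laurent_derivative_ofPowerSeries, laurent_derivative_ofPowerSeries, deriv_mul_eq, map_add,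
    map_mul, map_mul, map_mul, e2 a b]
  have e3 : HahnSeries.single (a + b - 1) (((a + b : ℤ) : K)) =
      HahnSeries.single a (1 : K) * HahnSeries.single (b - 1) ((b : ℤ) : K) +
      HahnSeries.single b (1 : K) * HahnSeries.single (a - 1) ((a : ℤ) : K) := by
    rw [HahnSeries.single_mul_single, HahnSeries.single_mul_single, one_mul, one_mul,
      show b + (a - 1) = a + b - 1 by ring, show a + (b - 1) = a + b - 1 by ring,
      ← HahnSeries.single_add]
    push_cast
    rw [add_comm (a : K)]
  rw [e3]
  ring

/-- The derivative of Laurent series as a derivation. -/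
noncomputable def laurentDeriv (K : Type*) [Field K] : RingDerivation (LaurentSeries K) :=
  derivationOfAddHom (LaurentSeries.derivative K).toAddMonoidHom laurent_derivative_mul

end LaurentDerivation

/-! ### Extending homomorphisms to elements with a pole -/

section PoleSubring

variable {M E : Type*} [CommRing M] [Field E]

/-- The elements which lie in a subring after multiplication with a power of `v`. -/
def poleSubring (T : Subring M) (v : T) : Subring M where
  carrier := {f | ∃ m : ℕ, (v : M) ^ m * f ∈ T}
  mul_mem' := by
    rintro f g ⟨m, hm⟩ ⟨k, hk⟩
    refine ⟨m + k, ?_⟩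
    rw [pow_add, mul_mul_mul_comm]
    exact mul_mem hm hk
  one_mem' := ⟨0, by simp⟩
  add_mem' := by
    rintro f g ⟨m, hm⟩ ⟨k, hk⟩
    refine ⟨m + k, ?_⟩
    have e : (v : M) ^ (m + k) * (f + g) =
        (v : M) ^ k * ((v : M) ^ m * f) + (v : M) ^ m * ((v : M) ^ k * g) := by ring
    rw [e]
    exact add_mem (mul_mem (pow_mem v.2 k) hm) (mul_mem (pow_mem v.2 m) hk)
  zero_mem' := ⟨0, by simp⟩
  neg_mem' := by
    rintro f ⟨m, hm⟩
    refine ⟨m, ?_⟩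
    rw [mul_neg]
    exact neg_mem hm

variable {T : Subring M} {v : T} {σ : T →+* E}

theorem le_poleSubring : T ≤ poleSubring T v := fun f hf => ⟨0, by simpa using hf⟩

/-- Needed for the site `n`: its values become regular only after multiplication by `v (n - 1)`,
whose specialisation is a nonzero series. The extension transports all polynomial and differential
identities at once. -/
theorem exists_poleSubring_hom (hv : σ v ≠ 0) : ∃ τ : poleSubring T v →+* E,
    ∀ (f : poleSubring T v) (m : ℕ) (hm : (v : M) ^ m * f ∈ T), σ v ^ m * τ f = σ ⟨_, hm⟩ := by
  have hmem : ∀ f : poleSubring T v, ∃ m : ℕ, (v : M) ^ m * f ∈ T := fun f => f.2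
  choose d hd using hmem
  have key : ∀ (f : poleSubring T v) (m : ℕ) (hm : (v : M) ^ m * f ∈ T),
      σ v ^ m * (σ ⟨_, hd f⟩ / σ v ^ d f) = σ ⟨_, hm⟩ := by
    intro f m hm
    rw [← mul_div_assoc, div_eq_iff (pow_ne_zero _ hv), ← map_pow, ← map_pow, ← map_mul, ← map_mul]
    refine congrArg σ (Subtype.ext ?_)
    push_cast
    ring
  refine ⟨{
    toFun := fun f => σ ⟨_, hd f⟩ / σ v ^ d f
    map_one' := ?_
    map_mul' := fun f g => ?_
    map_zero' := ?_
    map_add' := fun f g => ?_ }, key⟩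
  · have h := key 1 0 (by simp)
    rw [pow_zero, one_mul] at h
    rw [h, ← map_one σ]
    exact congrArg σ (Subtype.ext (by simp))
  · have hm : (v : M) ^ (d f + d g) * (f * g : poleSubring T v) ∈ T := by
      push_cast
      rw [pow_add, mul_mul_mul_comm]
      exact mul_mem (hd f) (hd g)
    have h := key (f * g) _ hm
    rw [mul_comm, ← eq_div_iff (pow_ne_zero _ hv)] at h
    rw [h, div_mul_div_comm, ← map_mul, ← pow_add]
    refine congrArg (fun z => σ z / _) (Subtype.ext ?_)
    push_cast
    ring
  · have h := key 0 0 (by simp)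
    rw [pow_zero, one_mul] at h
    rw [h, ← map_zero σ]
    exact congrArg σ (Subtype.ext (by simp))
  · have hm : (v : M) ^ (d f + d g) * (f + g : poleSubring T v) ∈ T := by
      have e : (v : M) ^ (d f + d g) * (f + g : poleSubring T v) =
          (v : M) ^ d g * ((v : M) ^ d f * f) + (v : M) ^ d f * ((v : M) ^ d g * g) := by
        push_cast
        ring
      rw [e]
      exact add_mem (mul_mem (pow_mem v.2 _) (hd f)) (mul_mem (pow_mem v.2 _) (hd g))
    have h := key (f + g) _ hm
    rw [mul_comm, ← eq_div_iff (pow_ne_zero _ hv)] at h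
    rw [h, div_add_div _ _ (pow_ne_zero _ hv) (pow_ne_zero _ hv), ← pow_add,
      ← map_pow σ v (d f), ← map_pow σ v (d g), ← map_mul, ← map_mul, ← map_add]
    refine congrArg (fun z => σ z / _) (Subtype.ext ?_)
    push_cast
    ring

theorem deriv_mem_poleSubring {δ : RingDerivation M} (hδ : ∀ f ∈ T, δ f ∈ T) {f : M}
    (hf : f ∈ poleSubring T v) : δ f ∈ poleSubring T v := by
  obtain ⟨m, hm⟩ := hf
  refine ⟨m + 1, ?_⟩
  have h := hδ _ hm
  have e : (v : M) ^ (m + 1) * δ f = v * δ ((v : M) ^ m * f) - m * δ (v : M) * ((v : M) ^ m * f) := by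
    rw [deriv_mul_eq, Derivation.leibniz_pow]
    cases m with
    | zero => simp
    | succ m =>
      simp only [smul_eq_mul, nsmul_eq_mul, Nat.add_sub_cancel]
      ring
  rw [e]
  exact sub_mem (mul_mem v.2 h) (mul_mem (mul_mem (natCast_mem T m) (hδ _ v.2)) hm)

theorem deriv_poleSubring_hom (hv : σ v ≠ 0) {δ : RingDerivation M} {D : RingDerivation E}
    (hδ : ∀ f ∈ T, δ f ∈ T) (hD : ∀ f : T, D (σ f) = σ ⟨δ f, hδ f f.2⟩)
    {τ : poleSubring T v →+* E}
    (hτ : ∀ (f : poleSubring T v) (m : ℕ) (hm : (v : M) ^ m * f ∈ T), σ v ^ m * τ f = σ ⟨_, hm⟩)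
    (f : poleSubring T v) : D (τ f) = τ ⟨δ f, deriv_mem_poleSubring hδ f.2⟩ := by
  obtain ⟨m, hm⟩ := f.2
  have hτT : ∀ g : T, τ ⟨g, le_poleSubring g.2⟩ = σ g := fun g => by
    have := hτ ⟨g, le_poleSubring g.2⟩ 0 (by simp)
    rw [pow_zero, one_mul] at this
    rw [this]
    exact congrArg σ (Subtype.ext (by simp))
  have h1 := congrArg D (hτ f m hm)
  rw [hD, ← map_pow, deriv_mul_eq, hD, ← hτT, ← hτT, ← hτT] at h1
  have e : (⟨δ ((v : M) ^ m * f), le_poleSubring (hδ _ hm)⟩ : poleSubring T v) =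
      ⟨((v ^ m : T) : M), le_poleSubring (v ^ m).2⟩ * ⟨δ f, deriv_mem_poleSubring hδ f.2⟩ +
        f * ⟨δ ((v ^ m : T) : M), le_poleSubring (hδ _ (v ^ m).2)⟩ := by
    refine Subtype.ext ?_
    push_cast
    exact deriv_mul_eq δ _ _
  have h2 := congrArg τ e
  rw [map_add, map_mul τ, map_mul τ] at h2
  have h3 := h1.trans h2
  have h4 := add_right_cancel h3
  refine mul_left_cancel₀ ?_ h4
  rw [hτT, map_pow]
  exact pow_ne_zero _ hv

end PoleSubring

/-! ### Leading terms of the Laurent solution -/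

section Expansions

variable {K : Type*} [Field K]

local notation "ιL" => HahnSeries.ofPowerSeries ℤ K

theorem hasExpansion_ofPowerSeries (f : K⟦X⟧) :
    HasExpansion (ιL f) 0 (constantCoeff f) (coeff 1 f) := by
  refine ⟨fun i hi => ?_, ?_, ?_⟩
  · rw [PowerSeries.coeff_coe, if_pos hi]
  · rw [PowerSeries.coeff_coe, if_neg (by omega)]
    simp
  · rw [PowerSeries.coeff_coe, if_neg (by omega)]
    simp

theorem hasExpansion_pole (f : K⟦X⟧) :
    HasExpansion (HahnSeries.single (-1) 1 * ιL f) (-1) (constantCoeff f) (coeff 1 f) := by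
  obtain ⟨h1, h2, h3⟩ := hasExpansion_ofPowerSeries f
  refine ⟨fun i hi => ?_, ?_, ?_⟩
  · rw [HahnSeries.coeff_single_mul, one_mul]
    exact h1 _ (by omega)
  · rw [HahnSeries.coeff_single_mul, one_mul]
    exact h2
  · rw [HahnSeries.coeff_single_mul, one_mul]
    exact h3

theorem constantCoeff_ddt (f : K⟦X⟧) : constantCoeff (ddt K f) = coeff 1 f := by
  rw [← coeff_zero_eq_constantCoeff_apply, coeff_ddt]
  simp

/-- A solution of the flow in Laurent series, with the pole data expressed by power series, is a
formal Laurent solution. -/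
theorem exists_isLaurentSolution {n : ℤ} {f g : ℤ → K⟦X⟧} {P Q V w : K⟦X⟧}
    {xl yl : ℤ → LaurentSeries K}
    (hx : ∀ j, j ≠ n → xl j = ιL (f j)) (hy : ∀ j, j ≠ n → yl j = ιL (g j))
    (hP : ιL P = ιL V * xl n) (hQ : ιL Q = ιL V * yl n)
    (hV : V = 1 - f (n - 1) * g (n - 1)) (hw : 1 - f (n + 1) * g (n + 1) = V * w)
    (hdx : ∀ k, laurentDeriv K (xl k) = (1 - xl k * yl k) * (xl (k + 1) - xl (k - 1)))
    (hdy : ∀ k, laurentDeriv K (yl k) = (1 - xl k * yl k) * (yl (k + 1) - yl (k - 1)))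
    {A : K} (hA : A ≠ 0) (hfA : constantCoeff (f (n - 1)) = A)
    (hgA : constantCoeff (g (n - 1)) = 1 / A) (hV1 : coeff 1 V ≠ 0)
    (hP0 : constantCoeff P ≠ 0) :
    ∃ p : LaurentParams K, (∀ j, p.a j = constantCoeff (f j) ∧ p.b j = constantCoeff (g j)) ∧
      IsLaurentSolution n p xl yl := by
  have hinj : Function.Injective ιL := HahnSeries.ofPowerSeries_injective
  have hD : ∀ f : K⟦X⟧, laurentDeriv K (ιL f) = ιL (ddt K f) := laurent_derivative_ofPowerSeries
  -- relations between power series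
  have far : ∀ k, 2 ≤ |k - n| →
      ddt K (f k) = (1 - f k * g k) * (f (k + 1) - f (k - 1)) ∧
      ddt K (g k) = (1 - f k * g k) * (g (k + 1) - g (k - 1)) := by
    intro k hk
    have k0 : k ≠ n := by rintro rfl; simp at hk
    have k1 : k + 1 ≠ n := by rintro rfl; norm_num at hk
    have k2 : k - 1 ≠ n := by rintro rfl; norm_num at hk
    constructor <;> apply hinj <;>
      rw [← hD, map_mul, map_sub, map_sub, map_one, map_mul, ← hx k k0, ← hy k k0]
    · rw [hdx, hx _ k1, hx _ k2]
    · rw [hdy, hy _ k1, hy _ k2]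
  have n1 : n - 1 ≠ n := by omega
  have n2 : n - 2 ≠ n := by omega
  have n3 : n + 1 ≠ n := by omega
  have n4 : n + 2 ≠ n := by omega
  have hVl : ιL V = 1 - xl (n - 1) * yl (n - 1) := by
    rw [hV, map_sub, map_one, map_mul, hx _ n1, hy _ n1]
  have d1 := hdx (n - 1)
  have d1' := hdy (n - 1)
  rw [← hVl, sub_add_cancel, show n - 1 - 1 = n - 2 by ring] at d1 d1'
  have e1 : ddt K (f (n - 1)) = P - V * f (n - 2) := by
    apply hinj
    rw [← hD, map_sub, map_mul, ← hx _ n1, ← hx _ n2, d1, hP]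
    ring
  have e1' : ddt K (g (n - 1)) = Q - V * g (n - 2) := by
    apply hinj
    rw [← hD, map_sub, map_mul, ← hy _ n1, ← hy _ n2, d1', hQ]
    ring
  have eV : ddt K V = -(f (n - 1) * ddt K (g (n - 1)) + g (n - 1) * ddt K (f (n - 1))) := by
    rw [hV, deriv_one_sub_eq, deriv_mul_eq]
  have e2 : (V ^ 2 - P * Q) * f (n + 1) =
      (V ^ 2 - P * Q) * f (n - 1) + V * ddt K P - P * ddt K V := by
    apply hinj
    have := deriv_next (G := ιL (V ^ 2 - P * Q)) hP hQ (by simp) (hdx n)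
    rw [hD, hD, hx _ n1, hx _ n3] at this
    simpa using this
  have e2' : (V ^ 2 - P * Q) * g (n + 1) =
      (V ^ 2 - P * Q) * g (n - 1) + V * ddt K Q - Q * ddt K V := by
    apply hinj
    have := deriv_next (G := ιL (V ^ 2 - P * Q)) hQ hP (by simp [mul_comm])
      ((hdy n).trans (by rw [mul_comm (xl n)]))
    rw [hD, hD, hy _ n1, hy _ n3] at this
    simpa using this
  have d3 := hdx (n + 1)
  have d3' := hdy (n + 1)
  have hwl : 1 - xl (n + 1) * yl (n + 1) = ιL V * ιL w := by
    rw [← map_mul, ← hw, map_sub, map_one, map_mul, hx _ n3, hy _ n3]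
  rw [hwl, add_sub_cancel_right, show n + 1 + 1 = n + 2 by ring] at d3 d3'
  have e3 : ddt K (f (n + 1)) = V * w * f (n + 2) - w * P := by
    apply hinj
    rw [← hD, map_sub, map_mul, map_mul, map_mul, ← hx _ n3, ← hx _ n4, d3, hP]
    ring
  have e3' : ddt K (g (n + 1)) = V * w * g (n + 2) - w * Q := by
    apply hinj
    rw [← hD, map_sub, map_mul, map_mul, map_mul, ← hy _ n3, ← hy _ n4, d3', hQ]
    ring
  -- the simple pole
  have hV0 : constantCoeff V = 0 := by
    rw [hV, map_sub, map_mul, map_one, hfA, hgA, mul_one_div_cancel hA, sub_self]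
  obtain ⟨V₁, hV₁⟩ := X_dvd_iff.mpr hV0
  have hV₁0 : constantCoeff V₁ = coeff 1 V := by
    rw [hV₁, show (1 : ℕ) = 0 + 1 from rfl, coeff_succ_X_mul, coeff_zero_eq_constantCoeff_apply]
  have hc : constantCoeff V₁ ≠ 0 := by rwa [hV₁0]
  have hV₁ne : V₁ ≠ 0 := by
    rintro rfl
    exact hc (map_zero _)
  obtain ⟨ξ, hξ⟩ : ∃ ξ, P = ξ * V₁ := ⟨P * V₁⁻¹, by
    rw [mul_assoc, PowerSeries.inv_mul_cancel _ hc, mul_one]⟩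
  obtain ⟨η, hη⟩ : ∃ η, Q = η * V₁ := ⟨Q * V₁⁻¹, by
    rw [mul_assoc, PowerSeries.inv_mul_cancel _ hc, mul_one]⟩
  have hdX : ddt K (X : K⟦X⟧) = 1 := by
    ext m
    rw [coeff_ddt, coeff_X, coeff_one]
    by_cases hm : m = 0 <;> simp [hm]
  have hdV : ddt K V = X * ddt K V₁ + V₁ := by rw [hV₁, deriv_mul_eq, hdX, mul_one]
  -- `ξ` and `η` will be `t x_n` and `t y_n`; this is the flow at the site `n` multiplied by `t²`.
  have e4 : X * ddt K ξ - ξ = (X ^ 2 - ξ * η) * (f (n + 1) - f (n - 1)) := by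
    refine mul_left_cancel₀ (pow_ne_zero 2 hV₁ne) ?_
    have : ddt K P = ξ * ddt K V₁ + V₁ * ddt K ξ := by rw [hξ, deriv_mul_eq]
    rw [hdV, this, hV₁, hξ, hη] at e2
    linear_combination -e2
  have e4' : X * ddt K η - η = (X ^ 2 - ξ * η) * (g (n + 1) - g (n - 1)) := by
    refine mul_left_cancel₀ (pow_ne_zero 2 hV₁ne) ?_
    have : ddt K Q = η * ddt K V₁ + V₁ * ddt K η := by rw [hη, deriv_mul_eq]
    rw [hdV, this, hV₁, hξ, hη] at e2'
    linear_combination -e2'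
  have hXinv : HahnSeries.single (-1 : ℤ) (1 : K) * ιL X = 1 := by
    rw [HahnSeries.ofPowerSeries_X, HahnSeries.single_mul_single]
    simp
  have hιV₁ : ιL V₁ ≠ 0 := fun h => hV₁ne (hinj (by rw [h, map_zero]))
  have px : xl n = HahnSeries.single (-1) 1 * ιL ξ := by
    refine mul_left_cancel₀ hιV₁ ?_
    have := hP
    rw [hξ, hV₁, map_mul, map_mul] at this
    linear_combination (-HahnSeries.single (-1 : ℤ) (1 : K)) * this - ιL V₁ * xl n * hXinv
  have py : yl n = HahnSeries.single (-1) 1 * ιL η := by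
    refine mul_left_cancel₀ hιV₁ ?_
    have := hQ
    rw [hη, hV₁, map_mul, map_mul] at this
    linear_combination (-HahnSeries.single (-1 : ℤ) (1 : K)) * this - ιL V₁ * yl n * hXinv
  -- leading coefficients
  obtain ⟨A', hA'⟩ : ∃ A', A' = constantCoeff (f (n + 1)) := ⟨_, rfl⟩
  obtain ⟨B', hB'⟩ : ∃ B', B' = constantCoeff (g (n + 1)) := ⟨_, rfl⟩
  obtain ⟨ξ₀, hξ₀⟩ : ∃ ξ₀, ξ₀ = constantCoeff ξ := ⟨_, rfl⟩
  obtain ⟨η₀, hη₀⟩ : ∃ η₀, η₀ = constantCoeff η := ⟨_, rfl⟩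
  obtain ⟨c, hc'⟩ : ∃ c, c = constantCoeff V₁ := ⟨_, rfl⟩
  have c4 := congrArg constantCoeff e4
  have c4' := congrArg constantCoeff e4'
  simp only [map_sub, map_mul, map_pow, constantCoeff_X, zero_mul, ← hξ₀, ← hη₀, ← hA', ← hB', hfA,
    hgA] at c4 c4'
  have cP : constantCoeff P = ξ₀ * c := by rw [hξ, map_mul, hξ₀, hc']
  have cQ : constantCoeff Q = η₀ * c := by rw [hη, map_mul, hη₀, hc']
  rw [← hc'] at hc
  have hξ0 : ξ₀ ≠ 0 := by
    rintro h
    rw [cP, h, zero_mul] at hP0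
    exact hP0 rfl
  have r1 : η₀ * (A' - A) = 1 := by
    refine mul_left_cancel₀ hξ0 ?_
    linear_combination c4
  have hη0 : η₀ ≠ 0 := left_ne_zero_of_mul_eq_one r1
  have r2 : ξ₀ * (B' - 1 / A) = 1 := by
    refine mul_left_cancel₀ hη0 ?_
    linear_combination c4'
  -- The constant term of `V' = -(x y' + y x')` at the site `n - 1`, where `V` vanishes and the
  -- derivatives of `x` and `y` are the constant terms of `P` and `Q`.
  have r3 : ξ₀ = -A * A' * η₀ := by
    have h := congrArg constantCoeff eV
    rw [hdV, e1, e1'] at h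
    simp only [map_add, map_neg, map_sub, map_mul, constantCoeff_X, zero_mul, hV0, cP, cQ, hfA, hgA,
      ← hc', zero_add, sub_zero] at h
    have h2 : 1 = -(A * η₀ + 1 / A * ξ₀) := mul_left_cancel₀ hc (by linear_combination h)
    field_simp at h2
    linear_combination h2 + A * r1
  have hA'0 : A' ≠ 0 := by
    rintro rfl
    rw [mul_zero, zero_mul] at r3
    exact hξ0 r3
  have hAA : A' - A ≠ 0 := right_ne_zero_of_mul_eq_one r1
  have hAA' : A - A' ≠ 0 := by
    rw [← neg_sub]
    exact neg_ne_zero.mpr hAA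
  have vη : η₀ = 1 / (A - A') * (-1) := by
    field_simp
    linear_combination -r1
  have vξ : ξ₀ = 1 / (A - A') * (A * A') := by
    rw [r3, vη]
    field_simp
  have hB'1 : B' = 1 / A' := by
    have h1 : ξ₀ * (A - A') = A * A' := by
      rw [vξ]
      field_simp
    have h2 := mul_one_div_cancel hA
    rw [eq_div_iff hA'0]
    refine mul_left_cancel₀ hA ?_
    linear_combination -(B' - 1 / A) * h1 + (A - A') * r2 + A' * h2
  -- second coefficients
  have s1 : coeff 1 (f (n - 1)) = ξ₀ * c := by
    rw [← constantCoeff_ddt, e1, map_sub, map_mul, hV0, zero_mul, sub_zero, cP]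
  have s1' : coeff 1 (g (n - 1)) = η₀ * c := by
    rw [← constantCoeff_ddt, e1', map_sub, map_mul, hV0, zero_mul, sub_zero, cQ]
  obtain ⟨w₀, hw₀⟩ : ∃ w₀, w₀ = constantCoeff w := ⟨_, rfl⟩
  have s3 : coeff 1 (f (n + 1)) = -(w₀ * (ξ₀ * c)) := by
    rw [← constantCoeff_ddt, e3, map_sub, map_mul, map_mul, map_mul, hV0, cP, hw₀]
    ring
  have s3' : coeff 1 (g (n + 1)) = -(w₀ * (η₀ * c)) := by
    rw [← constantCoeff_ddt, e3', map_sub, map_mul, map_mul, map_mul, hV0, cQ, hw₀]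
    ring
  obtain ⟨ξ₁, hξ₁⟩ : ∃ ξ₁, ξ₁ = coeff 1 ξ := ⟨_, rfl⟩
  obtain ⟨η₁, hη₁⟩ : ∃ η₁, η₁ = coeff 1 η := ⟨_, rfl⟩
  -- On the left of `e4` the coefficient of `t` is `ξ₁ - ξ₁ = 0`. This determines `η₁` from `ξ₁`,
  -- which provides the parameter `a₀`.
  have s4 : (ξ₀ * η₁ + ξ₁ * η₀) * (A' - A) +
      ξ₀ * η₀ * (coeff 1 (f (n + 1)) - coeff 1 (f (n - 1))) = 0 := by
    have h := congrArg (coeff 1) e4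
    simp only [pow_two, map_sub, coeff_one_mul, coeff_one_X, constantCoeff_X, ← hξ₀, ← hη₀, ← hξ₁,
      ← hη₁, ← hA', hfA, map_mul, constantCoeff_ddt] at h
    linear_combination h
  -- `aMinus`, `aPlus` and `a₀` are read off from the second coefficients of `x` at `n - 1`, `n + 1`
  -- and `n`.
  refine ⟨⟨fun j => constantCoeff (f j), fun j => constantCoeff (g j), ξ₀ * c / A,
    -(w₀ * (ξ₀ * c)) / A', ξ₁ * (A - A') / (A * A')⟩, fun j => ⟨rfl, rfl⟩, ?_⟩
  have ex : ∀ {h : LaurentSeries K} {d : ℤ} {a b a' b' : K}, HasExpansion h d a b → a = a' →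
      b = b' → HasExpansion h d a' b' := by
    rintro h d a b _ _ H rfl rfl
    exact H
  constructor
  · exact hfA.trans_ne hA
  · exact hA'.symm.trans_ne hA'0
  · change constantCoeff (f (n + 1)) ≠ constantCoeff (f (n - 1))
    rw [hfA, ← hA']
    exact sub_ne_zero.mp hAA
  · change constantCoeff (g (n - 1)) = 1 / constantCoeff (f (n - 1))
    rw [hgA, hfA]
  · change constantCoeff (g (n + 1)) = 1 / constantCoeff (f (n + 1))
    rw [← hB', ← hA', hB'1]
  · exact hdx
  · exact hdy
  · intro k hk
    rw [hx k (by rintro rfl; simp at hk)]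
    refine ex (hasExpansion_ofPowerSeries _) rfl ?_
    rw [← constantCoeff_ddt, (far k hk).1]
    simp
  · intro k hk
    rw [hy k (by rintro rfl; simp at hk)]
    refine ex (hasExpansion_ofPowerSeries _) rfl ?_
    rw [← constantCoeff_ddt, (far k hk).2]
    simp
  · rw [hx _ n3]
    refine ex (hasExpansion_ofPowerSeries _) rfl ?_
    simp only [← hA']
    rw [s3, mul_div_cancel₀ _ hA'0]
  · rw [hy _ n3]
    refine ex (hasExpansion_ofPowerSeries _) ?_ ?_
    · simp only [← hA', ← hB', hB'1]
    · simp only [hfA]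
      rw [s3', r3]
      field_simp
  · rw [hx _ n1]
    refine ex (hasExpansion_ofPowerSeries _) rfl ?_
    simp only [hfA]
    rw [s1, mul_div_cancel₀ _ hA]
  · rw [hy _ n1]
    refine ex (hasExpansion_ofPowerSeries _) ?_ ?_
    · simp only [hfA, hgA]
    · simp only [← hA']
      rw [s1', r3]
      field_simp
  · rw [px]
    refine ex (hasExpansion_pole _) ?_ ?_
    · simp only [hfA, ← hA', ← hξ₀]
      exact vξ
    · simp only [hfA, ← hA', ← hξ₁]
      field_simp
  · rw [py]
    refine ex (hasExpansion_pole _) ?_ ?_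
    · simp only [hfA, ← hA', ← hη₀]
      exact vη
    · simp only [hfA, ← hA', ← hη₁]
      rw [s1, s3] at s4
      rw [vξ, vη] at s4
      rw [vξ]
      field_simp at s4 ⊢
      linear_combination s4

end Expansions

/-! ### From a specialisation of the pole ring to a Laurent solution -/

section Transport

variable {F L K : Type*} [Field F] [Field L] [Algebra F L] [Field K] [Algebra F K]
  {O : Subalgebra F L}

/-- Applying a homomorphism to the coefficients of a regular power series. -/
noncomputable def seriesHom (ρ : O →ₐ[F] K) : regular O →+* K⟦X⟧ :=
  have hinj : Function.Injective (PowerSeries.map (O.val : O →+* L)) := fun f g h => by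
    ext m
    simpa using congrArg (coeff m) h
  let lift : regular O →+* O⟦X⟧ :=
    { toFun := fun f => PowerSeries.mk fun m => ⟨coeff m (f : L⟦X⟧), f.2 m⟩
      map_one' := hinj (by ext m; simp)
      map_zero' := hinj (by ext m; simp)
      map_mul' := fun f g => hinj (by
        rw [map_mul]
        have e : ∀ f : regular O, PowerSeries.map (O.val : O →+* L)
            (PowerSeries.mk fun m => ⟨coeff m (f : L⟦X⟧), f.2 m⟩) = f := fun f => by ext m; simp
        rw [e, e, e]
        rfl)
      map_add' := fun f g => hinj (by ext m; simp) }
  (PowerSeries.map (ρ : O →+* K)).comp lift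

variable (ρ : O →ₐ[F] K)

theorem coeff_seriesHom (f : regular O) (m : ℕ) :
    coeff m (seriesHom ρ f) = ρ ⟨coeff m (f : L⟦X⟧), f.2 m⟩ := by
  simp [seriesHom]

theorem constantCoeff_seriesHom (f : regular O) :
    constantCoeff (seriesHom ρ f) = ρ ⟨constantCoeff (f : L⟦X⟧), constantCoeff_mem f.2⟩ := by
  rw [← coeff_zero_eq_constantCoeff_apply, coeff_seriesHom]
  exact congrArg ρ (Subtype.ext (coeff_zero_eq_constantCoeff_apply _))

theorem ddt_seriesHom (f : regular O) :
    ddt K (seriesHom ρ f) = seriesHom ρ ⟨ddt L f, ddt_mem_regular f.2⟩ := by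
  ext m
  rw [coeff_ddt, coeff_seriesHom, coeff_seriesHom]
  have e : (⟨coeff m (ddt L (f : L⟦X⟧)), ddt_mem_regular f.2 m⟩ : O) =
      ⟨coeff (m + 1) (f : L⟦X⟧), f.2 (m + 1)⟩ * (m + 1 : ℕ) :=
    Subtype.ext ((coeff_ddt _ _).trans (by push_cast; rfl))
  have e' := congrArg ρ e
  rw [map_mul, map_natCast] at e'
  rw [e']
  push_cast
  rfl

theorem seriesU_mem_regular (u : ℤ → F) (i : ℤ) : seriesU L u i ∈ regular O := by
  intro m
  rw [seriesU, map_add, coeff_C]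
  refine add_mem ?_ ?_
  · split_ifs
    exacts [O.algebraMap_mem _, zero_mem _]
  · split_ifs
    · rw [coeff_X]
      split_ifs
      exacts [one_mem _, zero_mem _]
    · rw [map_zero]
      exact zero_mem _

theorem coeff_seriesU (S : Type*) [Field S] [Algebra F S] (u : ℤ → F) (i : ℤ) (m : ℕ) :
    coeff m (seriesU S u i) = algebraMap F S
      ((if m = 0 then u i else 0) + if i = 1 ∨ i = -1 then (if m = 1 then 1 else 0) else 0) := by
  rw [seriesU, map_add, coeff_C, map_add]
  congr 1
  · split_ifs <;> simp
  · by_cases h : i = 1 ∨ i = -1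
    · rw [if_pos h, if_pos h, coeff_X]
      split_ifs <;> simp
    · rw [if_neg h, if_neg h, map_zero, map_zero]

theorem seriesHom_seriesU (u : ℤ → F) (i : ℤ) :
    seriesHom ρ ⟨seriesU L u i, seriesU_mem_regular u i⟩ = seriesU K u i := by
  have key : ∀ z : L, ∀ w : F, z = algebraMap F L w → ∀ hz, ρ ⟨z, hz⟩ = algebraMap F K w := by
    rintro _ w rfl hz
    exact ρ.commutes w
  ext m
  rw [coeff_seriesHom, coeff_seriesU K]
  exact key _ _ (coeff_seriesU L u i m) _

theorem ofPowerSeries_seriesU (u : ℤ → F) (i : ℤ) :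
    HahnSeries.ofPowerSeries ℤ K (seriesU K u i) = timeU (fun i => algebraMap F K (u i)) i := by
  rw [seriesU, timeU, map_add, HahnSeries.ofPowerSeries_C]
  congr 1
  split_ifs
  · exact HahnSeries.ofPowerSeries_X
  · exact map_zero _

variable [CharZero F] {N : ℕ} {u : ℤ → F} {x y : ℤ → L⟦X⟧}

/-- A specialisation of the ring of a pole yields a formal Laurent solution of the flow on which the
recursion relations hold. -/
theorem exists_laurent_of_specialisation (h : IsGenericSolution N u x y) (n : ℤ)
    (ρ : poleRing h n →ₐ[F] K) {A : K} (hA : A ≠ 0)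
    (hxA : ∀ hm, ρ ⟨constantCoeff (x (n - 1)), hm⟩ = A)
    (hyA : ∀ hm, ρ ⟨constantCoeff (y (n - 1)), hm⟩ = 1 / A) :
    ∃ p : LaurentParams K, (∀ j, j ≠ n → (∀ hm, p.a j = ρ ⟨constantCoeff (x j), hm⟩) ∧
        ∀ hm, p.b j = ρ ⟨constantCoeff (y j), hm⟩) ∧
      ∃ xl yl : ℤ → LaurentSeries K, IsLaurentSolution n p xl yl ∧ ∀ k,
        toeplitzGamma N (timeU fun i => algebraMap F K (u i)) xl yl k = 0 ∧
        toeplitzGammaTilde N (timeU fun i => algebraMap F K (u i)) xl yl k = 0 := by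
  classical
  have hr : ∀ j, j ≠ n → x j ∈ regular (poleRing h n) ∧ y j ∈ regular (poleRing h n) := fun j hj => regular_poleRing h n hj
  obtain ⟨-, -, -, hP0, w, mw, hw⟩ := pass_poleRing h n
  obtain ⟨-, -, hd0, -⟩ := h.pole_units n _ (h.v0_prime (n - 1)).choose_spec.2
  change IsUnitIn (poleRing h n) _ at hd0
  have n1 : n - 1 ≠ n := by omega
  have n2 : n - 2 ≠ n := by omega
  have n3 : n + 1 ≠ n := by omega
  have mV : toeplitzV x y (n - 1) ∈ regular (poleRing h n) :=
    sub_mem (one_mem _) (mul_mem (hr _ n1).1 (hr _ n1).2)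
  have f1 := h.flow (n - 1)
  rw [FlowAt, sub_add_cancel, show n - 1 - 1 = n - 2 by ring] at f1
  have mP : toeplitzV x y (n - 1) * x n ∈ regular (poleRing h n) := by
    have : toeplitzV x y (n - 1) * x n = ddt L (x (n - 1)) + toeplitzV x y (n - 1) * x (n - 2) := by
      rw [f1.1]; ring
    rw [this]
    exact add_mem (ddt_mem_regular (hr _ n1).1) (mul_mem mV (hr _ n2).1)
  have mQ : toeplitzV x y (n - 1) * y n ∈ regular (poleRing h n) := by
    have : toeplitzV x y (n - 1) * y n = ddt L (y (n - 1)) + toeplitzV x y (n - 1) * y (n - 2) := by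
      rw [f1.2]; ring
    rw [this]
    exact add_mem (ddt_mem_regular (hr _ n1).2) (mul_mem mV (hr _ n2).2)
  obtain ⟨v, hv⟩ : ∃ v : regular (poleRing h n), v = ⟨_, mV⟩ := ⟨_, rfl⟩
  have cv : (v : L⟦X⟧) ^ 1 = toeplitzV x y (n - 1) := by rw [hv, pow_one]
  obtain ⟨σ, hσ⟩ : ∃ σ : regular (poleRing h n) →+* LaurentSeries K,
      σ = (HahnSeries.ofPowerSeries ℤ K).comp (seriesHom ρ) := ⟨_, rfl⟩
  have hσ' : ∀ f, σ f = HahnSeries.ofPowerSeries ℤ K (seriesHom ρ f) := fun f => by rw [hσ]; rfl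
  have unit_ne : ∀ z (hz : IsUnitIn (poleRing h n) z), ρ ⟨z, hz.1⟩ ≠ 0 := by
    intro z hz h0
    have e : (⟨z, hz.1⟩ : poleRing h n) * ⟨z⁻¹, hz.2.2⟩ = 1 := Subtype.ext (mul_inv_cancel₀ hz.2.1)
    have := congrArg ρ e
    rw [map_mul, h0, zero_mul, map_one] at this
    exact zero_ne_one this
  -- The initial derivative of `v (n - 1)` is a unit of the ring of the pole, so its specialisation
  -- is nonzero.
  have hV1 : coeff 1 (seriesHom ρ v) ≠ 0 := by
    rw [← constantCoeff_ddt, ddt_seriesHom, constantCoeff_seriesHom]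
    convert unit_ne _ hd0
    rw [hv]
  have hσv : σ v ≠ 0 := by
    intro h0
    rw [hσ', map_eq_zero_iff _ HahnSeries.ofPowerSeries_injective] at h0
    rw [h0, map_zero] at hV1
    exact hV1 rfl
  obtain ⟨τ, hτ⟩ := exists_poleSubring_hom hσv
  have hτT : ∀ g : regular (poleRing h n), ∀ hg, τ ⟨g, hg⟩ = σ g := fun g hg => by
    have := hτ ⟨g, hg⟩ 0 (by simp)
    rw [pow_zero, one_mul] at this
    rw [this]
    exact congrArg σ (Subtype.ext (by simp))
  have hs : ∀ j, x j ∈ poleSubring (regular (poleRing h n)) v ∧ y j ∈ poleSubring (regular (poleRing h n)) v := by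
    intro j
    by_cases hj : j = n
    · subst hj
      exact ⟨⟨1, by rw [cv]; exact mP⟩, 1, by rw [cv]; exact mQ⟩
    · exact ⟨le_poleSubring (hr j hj).1, le_poleSubring (hr j hj).2⟩
  have hτd := deriv_poleSubring_hom (D := laurentDeriv K) (δ := ddt L) hσv
    (fun f hf => ddt_mem_regular hf) (fun f => by
      rw [hσ', hσ', ← ddt_seriesHom]
      exact laurent_derivative_ofPowerSeries _) hτ
  set xs : ℤ → poleSubring (regular (poleRing h n)) v := fun j => ⟨x j, (hs j).1⟩ with hxs
  set ys : ℤ → poleSubring (regular (poleRing h n)) v := fun j => ⟨y j, (hs j).2⟩ with hys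
  set U : ℤ → poleSubring (regular (poleRing h n)) v := fun i =>
    ⟨seriesU L u i, le_poleSubring (seriesU_mem_regular u i)⟩ with hU
  have hτU : (fun i => τ (U i)) = timeU fun i => algebraMap F K (u i) := by
    funext i
    rw [← ofPowerSeries_seriesU, ← seriesHom_seriesU ρ, ← hσ']
    exact hτT ⟨seriesU L u i, seriesU_mem_regular u i⟩ _
  have hgam : ∀ k, toeplitzGamma N U xs ys k = 0 ∧ toeplitzGammaTilde N U xs ys k = 0 := by
    intro k
    constructor <;> apply (poleSubring (regular (poleRing h n)) v).subtype_injective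
    · rw [map_toeplitzGamma, map_zero]
      exact (h.gamma k).1
    · rw [map_toeplitzGammaTilde, map_zero]
      exact (h.gamma k).2
  set f : ℤ → K⟦X⟧ := fun j => if hj : j = n then 0 else seriesHom ρ ⟨x j, (hr j hj).1⟩ with hf
  set g : ℤ → K⟦X⟧ := fun j => if hj : j = n then 0 else seriesHom ρ ⟨y j, (hr j hj).2⟩ with hg
  have fj : ∀ j (hj : j ≠ n), f j = seriesHom ρ ⟨x j, (hr j hj).1⟩ := fun j hj => by
    rw [hf]
    exact dif_neg hj
  have gj : ∀ j (hj : j ≠ n), g j = seriesHom ρ ⟨y j, (hr j hj).2⟩ := fun j hj => by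
    rw [hg]
    exact dif_neg hj
  have hV' : seriesHom ρ v = 1 - f (n - 1) * g (n - 1) := by
    rw [fj _ n1, gj _ n1, ← map_mul, ← map_one (seriesHom ρ), ← map_sub, hv]
    rfl
  obtain ⟨p, hp, hsol⟩ := exists_isLaurentSolution (n := n) (f := f) (g := g)
    (P := seriesHom ρ ⟨_, mP⟩) (Q := seriesHom ρ ⟨_, mQ⟩) (V := seriesHom ρ v)
    (w := seriesHom ρ ⟨w, mw⟩) (xl := fun j => τ (xs j)) (yl := fun j => τ (ys j)) (A := A)
    (fun j hj => by rw [fj j hj, ← hσ']; exact hτT ⟨x j, (hr j hj).1⟩ _)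
    (fun j hj => by rw [gj j hj, ← hσ']; exact hτT ⟨y j, (hr j hj).2⟩ _)
    (by
      rw [← hσ', ← hσ']
      have cx : (v : L⟦X⟧) ^ 1 * x n = toeplitzV x y (n - 1) * x n := by rw [cv]
      have := hτ (xs n) 1 (cx ▸ mP)
      rw [pow_one] at this
      rw [this]
      exact congrArg σ (Subtype.ext cx.symm))
    (by
      rw [← hσ', ← hσ']
      have cy : (v : L⟦X⟧) ^ 1 * y n = toeplitzV x y (n - 1) * y n := by rw [cv]
      have := hτ (ys n) 1 (cy ▸ mQ)
      rw [pow_one] at this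
      rw [this]
      exact congrArg σ (Subtype.ext cy.symm))
    hV'
    (by
      rw [fj _ n3, gj _ n3, ← map_mul, ← map_mul, ← map_one (seriesHom ρ), ← map_sub, hv]
      exact congrArg _ (Subtype.ext hw))
    (fun k => by
      rw [hτd, ← map_one τ, ← map_mul, ← map_sub, ← map_sub, ← map_mul]
      exact congrArg τ (Subtype.ext (h.flow k).1))
    (fun k => by
      rw [hτd, ← map_one τ, ← map_mul, ← map_sub, ← map_sub, ← map_mul]
      exact congrArg τ (Subtype.ext (h.flow k).2))
    hA (by rw [fj _ n1, constantCoeff_seriesHom]; exact hxA _)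
    (by rw [gj _ n1, constantCoeff_seriesHom]; exact hyA _) hV1
    (by
      rw [constantCoeff_seriesHom]
      convert unit_ne _ hP0 using 3
      rw [map_mul, v0])
  refine ⟨p, fun j hj => ⟨fun hm => ?_, fun hm => ?_⟩, _, _, hsol, fun k => ⟨?_, ?_⟩⟩
  · rw [(hp j).1, fj j hj, constantCoeff_seriesHom]
  · rw [(hp j).2, gj j hj, constantCoeff_seriesHom]
  · rw [← hτU, ← map_toeplitzGamma, (hgam k).1, map_zero]
  · rw [← hτU, ← map_toeplitzGammaTilde, (hgam k).2, map_zero]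

end Transport

/-! ### Specialising a localized polynomial ring -/

section Specialisation

/-- A homomorphism which does not vanish off a prime extends to the localization at the prime. -/
theorem exists_locAt_hom {F L K : Type*} [Field F] [Field L] [Algebra F L] [Field K] [Algebra F K]
    {R : Subalgebra F L} {π : R} (hπ : Prime π) (E : R →ₐ[F] K) (hE : ∀ b, ¬π ∣ b → E b ≠ 0) :
    ∃ ρ : locAt hπ →ₐ[F] K, ∀ (b : R) hm, ρ ⟨b, hm⟩ = E b := by
  choose a b hb hab using fun z : locAt hπ => z.2
  have key : ∀ (z : locAt hπ) (c d : R), ¬π ∣ d → (z : L) = c / d →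
      E (a z) / E (b z) = E c / E d := by
    intro z c d hd hz
    rw [div_eq_div_iff (hE _ (hb z)) (hE _ hd), ← map_mul, ← map_mul]
    refine congrArg E (Subtype.ext ?_)
    rw [hab z, div_eq_div_iff (ne_zero_of_not_dvd (hb z)) (ne_zero_of_not_dvd hd)] at hz
    exact hz
  have h1 : ¬π ∣ 1 := fun h => hπ.not_isUnit (isUnit_of_dvd_one h)
  have hR : ∀ (c : R) (z : locAt hπ), (z : L) = c → E (a z) / E (b z) = E c := by
    intro c z hz
    rw [key z c 1 h1 (by rw [hz]; simp), map_one, div_one]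
  refine ⟨{
    toFun := fun z => E (a z) / E (b z)
    map_one' := by rw [hR 1 1 rfl, map_one]
    map_mul' := fun z w => ?_
    map_zero' := by rw [hR 0 0 rfl, map_zero]
    map_add' := fun z w => ?_
    commutes' := fun c => by rw [hR (algebraMap F R c) _ rfl, AlgHom.commutes] },
    fun c hm => hR c _ rfl⟩
  · rw [key (z * w) (a z * a w) (b z * b w) (hπ.not_dvd_mul (hb z) (hb w)) (by
      push_cast
      rw [← div_mul_div_comm, ← hab, ← hab]), map_mul, map_mul, div_mul_div_comm]
  · rw [key (z + w) (a z * b w + b z * a w) (b z * b w) (hπ.not_dvd_mul (hb z) (hb w)) (by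
      push_cast
      rw [← div_add_div _ _ (ne_zero_of_not_dvd (hb z)) (ne_zero_of_not_dvd (hb w)), ← hab,
        ← hab]), map_mul, map_add, map_mul, map_mul,
      div_add_div _ _ (hE _ (hb z)) (hE _ (hb w))]

variable {F K σ : Type*} [Field F] [Field K]

/-- Specialising one variable to the inverse of another one kills only the multiples of the
obvious relation. -/
theorem aeval_inv_ne_zero [Algebra (MvPolynomial σ F) K] [FaithfulSMul (MvPolynomial σ F) K]
    [Algebra F K] [IsScalarTower F (MvPolynomial σ F) K] (i : σ) {E : MvPolynomial (Option σ) F →ₐ[F] K}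
    (hs : ∀ j, E (MvPolynomial.X (some j)) = algebraMap (MvPolynomial σ F) K (MvPolynomial.X j))
    (hn : E (MvPolynomial.X none) = 1 / algebraMap (MvPolynomial σ F) K (MvPolynomial.X i))
    {f : MvPolynomial (Option σ) F}
    (hf : ¬(1 - MvPolynomial.X (some i) * MvPolynomial.X none) ∣ f) : E f ≠ 0 := by
  set π : MvPolynomial (Option σ) F := 1 - MvPolynomial.X (some i) * MvPolynomial.X none with hπ
  have hinj := FaithfulSMul.algebraMap_injective (MvPolynomial σ F) K
  have hX : algebraMap (MvPolynomial σ F) K (MvPolynomial.X i) ≠ 0 := by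
    rw [Ne, map_eq_zero_iff _ hinj]
    exact MvPolynomial.X_ne_zero i
  have hprime : Prime π := prime_one_sub_X_mul_X (by simp)
  have hEπ : E π = 0 := by
    rw [hπ, map_sub, map_mul, hs, hn, map_one, mul_one_div, div_self hX, sub_self]
  have hEr : ∀ g, E (MvPolynomial.rename some g) = algebraMap (MvPolynomial σ F) K g := by
    intro g
    have : E.comp (MvPolynomial.rename some) = IsScalarTower.toAlgHom F (MvPolynomial σ F) K := by
      apply MvPolynomial.algHom_ext
      intro j
      simp [hs]
    exact DFunLike.congr_fun this g
  -- Modulo `π` the variable `none` is inverse to the variable `i`. A power of the latter eliminates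
  -- it and leaves a polynomial in the other variables, on which `E` is injective.
  have red : ∀ f : MvPolynomial (Option σ) F, ∃ (d : ℕ) (g : MvPolynomial σ F),
      π ∣ MvPolynomial.X (some i) ^ d * f - MvPolynomial.rename some g := by
    intro f
    induction f using MvPolynomial.induction_on with
    | C c => exact ⟨0, MvPolynomial.C c, by simp⟩
    | add p q hp hq =>
      obtain ⟨d, g, hg⟩ := hp
      obtain ⟨d', g', hg'⟩ := hq
      refine ⟨d + d', MvPolynomial.X i ^ d' * g + MvPolynomial.X i ^ d * g', ?_⟩
      have := dvd_add (hg.mul_left (MvPolynomial.X (some i) ^ d'))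
        (hg'.mul_left (MvPolynomial.X (some i) ^ d))
      convert this using 1
      simp only [map_add, map_mul, map_pow, MvPolynomial.rename_X]
      ring
    | mul_X p j hp =>
      obtain ⟨d, g, hg⟩ := hp
      cases j with
      | some j =>
        refine ⟨d, g * MvPolynomial.X j, ?_⟩
        convert hg.mul_right (MvPolynomial.X (some j)) using 1
        simp only [map_mul, MvPolynomial.rename_X]
        ring
      | none =>
        refine ⟨d + 1, g, ?_⟩
        have := dvd_sub (hg.mul_right (MvPolynomial.X (some i) * MvPolynomial.X none))
          (dvd_mul_right π (MvPolynomial.rename some g))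
        convert this using 1
        rw [hπ]
        ring
  intro h0
  obtain ⟨d, g, c, hc⟩ := red f
  have hg : g = 0 := by
    apply hinj
    have := congrArg E hc
    rw [map_sub, map_mul, h0, mul_zero, map_mul, hEπ, zero_mul, hEr, zero_sub, neg_eq_zero] at this
    rw [this, map_zero]
  rw [hg, map_zero, sub_zero] at hc
  rcases hprime.dvd_or_dvd (Dvd.intro _ hc.symm) with h | h
  · obtain ⟨c, hc⟩ := hprime.dvd_of_dvd_pow h
    have := congrArg E hc
    rw [map_mul, hEπ, zero_mul, hs] at this
    exact hX this
  · exact hf h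

end Specialisation

/-! ### The window of initial values; the variable `none` stands for `b_{n-1}` -/

section Window

variable (F : Type*) [Field F] (n : ℤ) (N : ℕ)

/-- Independent variables at the sites `n - 2 N, …, n - 1` for the first sequence. -/
noncomputable def windowX (j : ℤ) : MvPolynomial (Option (FreeParam n N)) F :=
  if h : n - 2 * N ≤ j ∧ j ≤ n - 2 then MvPolynomial.X (some (.a j h))
  else if j = n - 1 then MvPolynomial.X (some .aLeft) else 0

/-- Independent variables at the sites `n - 2 N, …, n - 1` for the second sequence. -/
noncomputable def windowY (j : ℤ) : MvPolynomial (Option (FreeParam n N)) F :=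
  if h : n - 2 * N ≤ j ∧ j ≤ n - 2 then MvPolynomial.X (some (.b j h))
  else if j = n - 1 then MvPolynomial.X none else 0

variable {n N}

theorem windowX_of_mem {j : ℤ} (h : n - 2 * N ≤ j ∧ j ≤ n - 2) :
    windowX F n N j = MvPolynomial.X (some (.a j h)) := dif_pos h

theorem windowY_of_mem {j : ℤ} (h : n - 2 * N ≤ j ∧ j ≤ n - 2) :
    windowY F n N j = MvPolynomial.X (some (.b j h)) := dif_pos h

theorem windowX_last : windowX F n N (n - 1) = MvPolynomial.X (some .aLeft) := by
  rw [windowX, dif_neg (by omega), if_pos rfl]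

theorem windowY_last : windowY F n N (n - 1) = MvPolynomial.X none := by
  rw [windowY, dif_neg (by omega), if_pos rfl]

theorem aeval_zero_window (j : ℤ) :
    MvPolynomial.aeval (0 : Option (FreeParam n N) → F) (windowX F n N j) = 0 ∧
    MvPolynomial.aeval (0 : Option (FreeParam n N) → F) (windowY F n N j) = 0 := by
  constructor
  · rw [windowX]
    split_ifs <;> simp
  · rw [windowY]
    split_ifs <;> simp

/-- The variables all occur at the sites of the window. -/
theorem window_induction (hN : 1 ≤ N) {p : MvPolynomial (Option (FreeParam n N)) F → Prop}
    (h : ∀ j, n - 2 * N ≤ j → j ≤ n - 1 → p (windowX F n N j) ∧ p (windowY F n N j))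
    (i : Option (FreeParam n N)) : p (MvPolynomial.X i) := by
  have hl := h (n - 1) (by omega) le_rfl
  rw [windowX_last, windowY_last] at hl
  rcases i with _ | ⟨j, hj⟩ | ⟨j, hj⟩ | _
  · exact hl.2
  · rw [← windowX_of_mem]
    exact (h j hj.1 (by omega)).1
  · rw [← windowY_of_mem]
    exact (h j hj.1 (by omega)).2
  · exact hl.1

theorem le_card_freeParam (hN : 1 ≤ N) :
    ((4 * N : ℕ) : Cardinal) ≤ Cardinal.mk (Option (FreeParam n N)) := by
  have : NeZero (2 * N) := ⟨by omega⟩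
  have hs : Function.Surjective fun i : Option (FreeParam n N) => match i with
      | none => ((false, Fin.ofNat (2 * N) (2 * N - 1)) : Bool × Fin (2 * N))
      | some .aLeft => (true, Fin.ofNat (2 * N) (2 * N - 1))
      | some (.a j _) => (true, Fin.ofNat (2 * N) (j - (n - 2 * N)).toNat)
      | some (.b j _) => (false, Fin.ofNat (2 * N) (j - (n - 2 * N)).toNat) := by
    rintro ⟨e, i, hi⟩
    by_cases h : i = 2 * N - 1
    · subst h
      cases e
      · exact ⟨none, Prod.ext rfl (Fin.ext (Nat.mod_eq_of_lt hi))⟩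
      · exact ⟨some .aLeft, Prod.ext rfl (Fin.ext (Nat.mod_eq_of_lt hi))⟩
    · have hj : n - 2 * N ≤ n - 2 * N + i ∧ n - 2 * N + i ≤ n - 2 := by omega
      have hm : (n - 2 * N + i - (n - 2 * N)).toNat % (2 * N) = i := by
        rw [add_sub_cancel_left, Int.toNat_natCast, Nat.mod_eq_of_lt hi]
      cases e
      · exact ⟨some (.b _ hj), Prod.ext rfl (Fin.ext hm)⟩
      · exact ⟨some (.a _ hj), Prod.ext rfl (Fin.ext hm)⟩
  have := Cardinal.mk_le_of_surjective hs
  rw [Cardinal.mk_fintype, Fintype.card_prod, Fintype.card_bool, Fintype.card_fin] at this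
  rwa [show 4 * N = 2 * (2 * N) by ring]

end Window

/-! ### The generic solution through the window -/

section WindowSolution

variable {F L : Type*} [Field F] {n : ℤ} {N : ℕ} [Field L]
  [Algebra (MvPolynomial (Option (FreeParam n N)) F) L]
  [Algebra F L] [IsScalarTower F (MvPolynomial (Option (FreeParam n N)) F) L]
  {u : ℤ → F} {x y : ℤ → L⟦X⟧}

/-- The image of the polynomial ring of the window in its field of fractions. -/
noncomputable def windowRing (F L : Type*) [Field F] (n : ℤ) (N : ℕ) [Field L]
    [Algebra (MvPolynomial (Option (FreeParam n N)) F) L]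
    [Algebra F L] [IsScalarTower F (MvPolynomial (Option (FreeParam n N)) F) L] :
    Subalgebra F L :=
  (IsScalarTower.toAlgHom F (MvPolynomial (Option (FreeParam n N)) F) L).range

theorem windowRing_le (hN : 1 ≤ N) {S : Subalgebra F L}
    (h : ∀ j, n - 2 * N ≤ j → j ≤ n - 1 →
      algebraMap (MvPolynomial (Option (FreeParam n N)) F) L (windowX F n N j) ∈ S ∧
      algebraMap (MvPolynomial (Option (FreeParam n N)) F) L (windowY F n N j) ∈ S) :
    windowRing F L n N ≤ S := by
  have h1 : Algebra.adjoin F (Set.range MvPolynomial.X) ≤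
      S.comap (IsScalarTower.toAlgHom F (MvPolynomial (Option (FreeParam n N)) F) L) := by
    refine Algebra.adjoin_le ?_
    rintro _ ⟨i, rfl⟩
    exact window_induction F hN h i
  rw [MvPolynomial.adjoin_range_X] at h1
  rintro _ ⟨f, rfl⟩
  exact h1 (Algebra.mem_top (R := F) (x := f))

variable [IsFractionRing (MvPolynomial (Option (FreeParam n N)) F) L]

theorem isGenericSolution_of_window (hN : 2 ≤ N) (hu : ∀ e, signedU u e (N - 1) ≠ 0)
    (h : IsGammaSolution N u x y)
    (hw : ∀ j, n - 2 * N ≤ j → j ≤ n - 1 →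
      constantCoeff (x j) = algebraMap _ L (windowX F n N j) ∧
      constantCoeff (y j) = algebraMap _ L (windowY F n N j)) :
    IsGenericSolution N u x y := by
  refine { h with two_le := hN, top_ne := hu, gen := fun E hE => ?_, trdeg := ?_ }
  · have h1 : windowRing F L n N ≤ E.toSubalgebra := windowRing_le (by omega) fun j hj hj' => by
      rw [← (hw j hj hj').1, ← (hw j hj hj').2]
      exact hE j
    rw [eq_top_iff]
    intro z _
    obtain ⟨a, b, -, rfl⟩ := IsFractionRing.div_surjective
      (A := MvPolynomial (Option (FreeParam n N)) F) z
    exact E.div_mem (h1 ⟨a, rfl⟩) (h1 ⟨b, rfl⟩)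
  · have h1 := lift_trdeg_le_of_injective
      (IsScalarTower.toAlgHom F (MvPolynomial (Option (FreeParam n N)) F) L)
      (IsFractionRing.injective _ _)
    rw [MvPolynomial.trdeg_of_isDomain, Cardinal.lift_lift] at h1
    have h2 := (Cardinal.lift_le.mpr (le_card_freeParam (n := n) (by omega : 1 ≤ N))).trans h1
    rw [Cardinal.lift_natCast] at h2
    exact Cardinal.nat_le_lift_iff.mp h2

/-- The window ring is a polynomial ring. -/
noncomputable def windowEquiv (F L : Type*) [Field F] (n : ℤ) (N : ℕ) [Field L]
    [Algebra (MvPolynomial (Option (FreeParam n N)) F) L]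
    [IsFractionRing (MvPolynomial (Option (FreeParam n N)) F) L]
    [Algebra F L] [IsScalarTower F (MvPolynomial (Option (FreeParam n N)) F) L] :
    MvPolynomial (Option (FreeParam n N)) F ≃ₐ[F] windowRing F L n N :=
  AlgEquiv.ofInjective (IsScalarTower.toAlgHom F _ L) (IsFractionRing.injective _ _)

theorem windowEquiv_apply (f : MvPolynomial (Option (FreeParam n N)) F) :
    (windowEquiv F L n N f : L) = algebraMap _ L f := rfl

theorem windowRing_prime : Prime (windowEquiv F L n N
    (1 - MvPolynomial.X (some .aLeft) * MvPolynomial.X none)) :=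
  (MulEquiv.prime_iff (windowEquiv F L n N).toMulEquiv).mpr (prime_one_sub_X_mul_X (by simp))

variable [CharZero F]

/-- The solution through the window has its pole specialised at the site following the window. -/
theorem poleRing_eq_of_window (h : IsGenericSolution N u x y)
    (hw : ∀ j, n - 2 * N ≤ j → j ≤ n - 1 →
      constantCoeff (x j) = algebraMap _ L (windowX F n N j) ∧
      constantCoeff (y j) = algebraMap _ L (windowY F n N j))
    (hb : bondAlg F N x y (n - N) ≤ windowRing F L n N)
    (hv : ∀ j, n - 2 * N ≤ j → j ≤ n - 2 →
      ¬windowEquiv F L n N (1 - MvPolynomial.X (some .aLeft) * MvPolynomial.X none) ∣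
        windowEquiv F L n N (1 - windowX F n N j * windowY F n N j)) :
    locAt (windowRing_prime (F := F) (L := L) (n := n) (N := N)) = poleRing h n := by
  have hN := h.two_le
  have hπ := windowRing_prime (F := F) (L := L) (n := n) (N := N)
  have hv0 : ∀ j, n - 2 * N ≤ j → j ≤ n - 1 →
      v0 x y j = windowEquiv F L n N (1 - windowX F n N j * windowY F n N j) := by
    intro j h1 h2
    rw [v0_eq, (hw j h1 h2).1, (hw j h1 h2).2, windowEquiv_apply, map_sub, map_mul, map_one]
  have hvu : ∀ j, n - 2 * N ≤ j → j ≤ n - 2 → IsUnitIn (locAt hπ) (v0 x y j) := by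
    intro j h1 h2
    rw [hv0 j h1 (by omega), isUnitIn_locAt_iff]
    exact hv j h1 h2
  -- From the bond `n - N`, moving `N - 1` bonds to the right and `N` to the left reaches every site
  -- of the window without crossing `n - 1`, the only window site whose `v` is a nonunit.
  have hR : windowRing F L n N ≤ loc (bondAlg F N x y (n - N)) (locAt hπ) := by
    have hk : BondRegular (loc (bondAlg F N x y (n - N)) (locAt hπ)) x y (n - N) :=
      h.bondRegular_iff.mpr le_loc
    have hi : ∀ j, n - 2 * N ≤ j → j ≤ n - 2 →
        x j ∈ regular (loc (bondAlg F N x y (n - N)) (locAt hπ)) →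
        y j ∈ regular (loc (bondAlg F N x y (n - N)) (locAt hπ)) →
        (constantCoeff (toeplitzV x y j))⁻¹ ∈ loc (bondAlg F N x y (n - N)) (locAt hπ) :=
      fun j h1 h2 hx hy => inv_mem_loc
        (constantCoeff_mem (sub_mem (one_mem _) (mul_mem hx hy))) (hvu j h1 h2).2.2
    have hr : ∀ m : ℕ, m ≤ N - 1 →
        BondRegular (loc (bondAlg F N x y (n - N)) (locAt hπ)) x y (n - N + m) := by
      intro m hm
      induction m with
      | zero => simpa using hk
      | succ m ih =>
        have h1 := ih (by omega)
        have := BondRegular.succ h.toIsGammaSolution h1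
          (hi _ (by omega) (by omega) h1.2.1 h1.2.2)
        push_cast
        rwa [← add_assoc]
    have hl : ∀ m : ℕ, m ≤ N →
        BondRegular (loc (bondAlg F N x y (n - N)) (locAt hπ)) x y (n - N - m) := by
      intro m hm
      induction m with
      | zero => simpa using hk
      | succ m ih =>
        have h1 := ih (by omega)
        push_cast
        rw [← sub_sub]
        refine BondRegular.pred h.toIsGammaSolution ?_
          (hi _ (by omega) (by omega) h1.1.1 h1.1.2)
        rwa [sub_add_cancel]
    refine windowRing_le (by omega) fun j h1 h2 => ?_
    rw [← (hw j h1 h2).1, ← (hw j h1 h2).2]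
    rcases le_total (n - N) j with hj | hj
    · have := hr (j - (n - N)).toNat (by omega)
      rw [show n - N + ((j - (n - N)).toNat : ℤ) = j by omega] at this
      exact ⟨constantCoeff_mem this.2.1, constantCoeff_mem this.2.2⟩
    · have := hl (n - N - j).toNat (by omega)
      rw [show n - N - ((n - N - j).toNat : ℤ) = j by omega] at this
      exact ⟨constantCoeff_mem this.2.1, constantCoeff_mem this.2.2⟩
  have hD : Dominates (locAt hπ) (bondAlg F N x y (n - N)) :=
    (dominates_locAt hπ).trans (hb.trans (le_locAt hπ)) hR
  have hD' := hD.add h (N - 1) fun j hj => hvu _ (by omega) (by omega)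
  rw [show n - N + ((N - 1 : ℕ) : ℤ) = n - 1 by omega] at hD'
  have hufd : UniqueFactorizationMonoid (windowRing F L n N) :=
    (windowEquiv F L n N).toMulEquiv.uniqueFactorizationMonoid inferInstance
  refine eq_poleRing h hD' (isArch_locAt hπ) ?_
  rw [hv0 _ (by omega) le_rfl, windowX_last, windowY_last, isUnitIn_locAt_iff, not_not]

end WindowSolution

/-! ### Specialisation to the field of the free parameters -/

section FinalStep

variable {F K : Type*} [Field F] {n : ℤ} {N : ℕ} [Field K]
  [Algebra (MvPolynomial (FreeParam n N) F) K]

/-- The free parameters, with the value forced by the pole for the last variable. -/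
noncomputable def windowValue (F K : Type*) [Field F] {n : ℤ} {N : ℕ} [Field K]
    [Algebra (MvPolynomial (FreeParam n N) F) K] : Option (FreeParam n N) → K
  | some i => algebraMap (MvPolynomial (FreeParam n N) F) K (MvPolynomial.X i)
  | none => 1 / algebraMap (MvPolynomial (FreeParam n N) F) K (MvPolynomial.X .aLeft)

variable [IsFractionRing (MvPolynomial (FreeParam n N) F) K]

theorem algebraMap_aLeft_ne_zero :
    algebraMap (MvPolynomial (FreeParam n N) F) K (MvPolynomial.X .aLeft) ≠ 0 := by
  rw [Ne, map_eq_zero_iff _ (IsFractionRing.injective _ _)]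
  exact MvPolynomial.X_ne_zero _

variable [Algebra F K]

theorem aeval_windowValue_v_ne_zero {j : ℤ} (hj : n - 2 * N ≤ j ∧ j ≤ n - 2) :
    MvPolynomial.aeval (windowValue F K) (1 - windowX F n N j * windowY F n N j) ≠ 0 := by
  have h : MvPolynomial.aeval (windowValue F K) (1 - windowX F n N j * windowY F n N j) =
      algebraMap (MvPolynomial (FreeParam n N) F) K
        (1 - MvPolynomial.X (.a j hj) * MvPolynomial.X (.b j hj)) := by
    rw [windowX_of_mem F hj, windowY_of_mem F hj]
    simp only [map_sub, map_mul, map_one, MvPolynomial.aeval_X]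
    rfl
  rw [h, Ne, map_eq_zero_iff _ (IsFractionRing.injective _ _)]
  exact (prime_one_sub_X_mul_X (by simp)).ne_zero

theorem aeval_windowValue_relation : MvPolynomial.aeval (windowValue F K)
    ((1 : MvPolynomial (Option (FreeParam n N)) F) -
      MvPolynomial.X (some (.aLeft : FreeParam n N)) * MvPolynomial.X none) = 0 := by
  simp [windowValue]

variable [IsScalarTower F (MvPolynomial (FreeParam n N) F) K]

theorem aeval_windowValue_ne_zero {f : MvPolynomial (Option (FreeParam n N)) F}
    (hf : ¬((1 : MvPolynomial (Option (FreeParam n N)) F) -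
      MvPolynomial.X (some .aLeft) * MvPolynomial.X none) ∣ f) :
    MvPolynomial.aeval (windowValue F K) f ≠ 0 := by
  have : FaithfulSMul (MvPolynomial (FreeParam n N) F) K :=
    (faithfulSMul_iff_algebraMap_injective _ _).mpr (IsFractionRing.injective _ _)
  have hs : ∀ j : FreeParam n N, MvPolynomial.aeval (windowValue F K)
      (MvPolynomial.X (some j) : MvPolynomial (Option (FreeParam n N)) F) =
        algebraMap (MvPolynomial (FreeParam n N) F) K (MvPolynomial.X j) := fun j => by
    rw [MvPolynomial.aeval_X]
    rfl
  refine aeval_inv_ne_zero (E := MvPolynomial.aeval (windowValue F K)) FreeParam.aLeft hs ?_ hf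
  rw [MvPolynomial.aeval_X]
  rfl

variable [CharZero F] {L : Type*} [Field L]
  [Algebra (MvPolynomial (Option (FreeParam n N)) F) L]
  [IsFractionRing (MvPolynomial (Option (FreeParam n N)) F) L]
  [Algebra F L] [IsScalarTower F (MvPolynomial (Option (FreeParam n N)) F) L]
  {u : ℤ → F} {x y : ℤ → L⟦X⟧}

/-- The ring of the pole following the window specialises to the field of the free parameters. -/
theorem exists_poleRing_hom_of_window (h : IsGenericSolution N u x y)
    (hw : ∀ j, n - 2 * N ≤ j → j ≤ n - 1 →
      constantCoeff (x j) = algebraMap _ L (windowX F n N j) ∧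
      constantCoeff (y j) = algebraMap _ L (windowY F n N j))
    (hb : bondAlg F N x y (n - N) ≤ windowRing F L n N) :
    ∃ ρ : poleRing h n →ₐ[F] K, ∀ j, n - 2 * N ≤ j → j ≤ n - 1 →
      (∀ hm, ρ ⟨constantCoeff (x j), hm⟩ =
        MvPolynomial.aeval (windowValue F K) (windowX F n N j)) ∧
      ∀ hm, ρ ⟨constantCoeff (y j), hm⟩ =
        MvPolynomial.aeval (windowValue F K) (windowY F n N j) := by
  obtain ⟨E, hE⟩ : ∃ E : windowRing F L n N →ₐ[F] K, ∀ f,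
      E (windowEquiv F L n N f) = MvPolynomial.aeval (windowValue F K) f :=
    ⟨(MvPolynomial.aeval (windowValue F K)).comp (windowEquiv F L n N).symm.toAlgHom, fun f =>
      congrArg (MvPolynomial.aeval (windowValue F K)) ((windowEquiv F L n N).symm_apply_apply f)⟩
  rw [← poleRing_eq_of_window h hw hb fun j h1 h2 ⟨c, hc⟩ => by
    have := congrArg E hc
    rw [map_mul, hE, hE, aeval_windowValue_relation, zero_mul] at this
    exact aeval_windowValue_v_ne_zero ⟨h1, h2⟩ this]
  obtain ⟨ρ, hρ⟩ := exists_locAt_hom (windowRing_prime (F := F) (L := L) (n := n) (N := N)) E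
    (fun b hb => by
      obtain ⟨f, rfl⟩ := (windowEquiv F L n N).surjective b
      rw [hE]
      exact aeval_windowValue_ne_zero fun hd => hb (map_dvd _ hd))
  have hρw : ∀ f hf, ρ ⟨algebraMap _ L f, hf⟩ = MvPolynomial.aeval (windowValue F K) f :=
    fun f hf => (hρ (windowEquiv F L n N f) hf).trans (hE f)
  refine ⟨ρ, fun j h1 h2 => ?_⟩
  rw [(hw j h1 h2).1, (hw j h1 h2).2]
  exact ⟨hρw _, hρw _⟩

theorem exists_laurent_of_window (h : IsGenericSolution N u x y)
    (hw : ∀ j, n - 2 * N ≤ j → j ≤ n - 1 →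
      constantCoeff (x j) = algebraMap _ L (windowX F n N j) ∧
      constantCoeff (y j) = algebraMap _ L (windowY F n N j))
    (hb : bondAlg F N x y (n - N) ≤ windowRing F L n N) :
    ∃ p : LaurentParams K,
      (∀ (k : ℤ) (h : n - 2 * N ≤ k ∧ k ≤ n - 2),
        p.a k = algebraMap (MvPolynomial (FreeParam n N) F) K (MvPolynomial.X (.a k h)) ∧
        p.b k = algebraMap (MvPolynomial (FreeParam n N) F) K (MvPolynomial.X (.b k h))) ∧
      p.a (n - 1) = algebraMap (MvPolynomial (FreeParam n N) F) K (MvPolynomial.X .aLeft) ∧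
      ∃ xl yl : ℤ → LaurentSeries K, IsLaurentSolution n p xl yl ∧ ∀ k,
        toeplitzGamma N (timeU fun i => algebraMap F K (u i)) xl yl k = 0 ∧
        toeplitzGammaTilde N (timeU fun i => algebraMap F K (u i)) xl yl k = 0 := by
  have hN := h.two_le
  obtain ⟨ρ, hρ⟩ := exists_poleRing_hom_of_window (K := K) h hw hb
  have hmem : ∀ j, j ≠ n → constantCoeff (x j) ∈ poleRing h n ∧
      constantCoeff (y j) ∈ poleRing h n := fun j hj =>
    ⟨constantCoeff_mem (regular_poleRing h n hj).1, constantCoeff_mem (regular_poleRing h n hj).2⟩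
  have hl := hρ (n - 1) (by omega) le_rfl
  rw [windowX_last, windowY_last, MvPolynomial.aeval_X, MvPolynomial.aeval_X] at hl
  obtain ⟨p, hp, hsol⟩ := exists_laurent_of_specialisation h n ρ algebraMap_aLeft_ne_zero
    hl.1 hl.2
  refine ⟨p, fun k hk => ?_, ?_, hsol⟩
  · have hk' := hρ k hk.1 (by omega)
    rw [windowX_of_mem F hk, windowY_of_mem F hk, MvPolynomial.aeval_X, MvPolynomial.aeval_X] at hk'
    have hkn : k ≠ n := by omega
    exact ⟨((hp k hkn).1 (hmem k hkn).1).trans (hk'.1 _),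
      ((hp k hkn).2 (hmem k hkn).2).trans (hk'.2 _)⟩
  · have hkn : n - 1 ≠ n := by omega
    exact ((hp _ hkn).1 (hmem _ hkn).1).trans (hl.1 _)

end FinalStep

end ToeplitzFlow

open ToeplitzFlow in
theorem proposition6p5 {F : Type*} [Field F] [CharZero F] (N : ℕ) (hN : 2 ≤ N) (n : ℤ)
    (u : ℤ → F) (hu : u N ≠ 0) (hu' : u (-N) ≠ 0) :
    ∃ p : LaurentParams (RatParam F n N),
      (∀ (k : ℤ) (h : n - 2 * N ≤ k ∧ k ≤ n - 2),
        p.a k = RatParam.var F (FreeParam.a k h) ∧ p.b k = RatParam.var F (FreeParam.b k h)) ∧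
      p.a (n - 1) = RatParam.var F FreeParam.aLeft ∧
      ∃ x y : ℤ → LaurentSeries (RatParam F n N),
        IsLaurentSolution n p x y ∧
        ∀ k : ℤ,
          toeplitzGamma N (timeU fun i => algebraMap F (RatParam F n N) (u i)) x y k = 0 ∧
          toeplitzGammaTilde N (timeU fun i => algebraMap F (RatParam F n N) (u i)) x y k = 0 := by
  have hU : ∀ e, signedU u e (N - 1) ≠ 0 := by
    have e1 : ((N - 1 : ℕ) : ℤ) + 1 = N := by omega
    intro e
    cases e
    · simpa [signedU, e1] using hu
    · simp only [signedU, e1, if_true]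
      exact hu'
  -- The bond `n - N` is chosen because the `2 N` sites determined by its moments are `n - 2 N, …, n
  -- - 1`. The base point sets all variables to zero.
  obtain ⟨x, y, hG, hm, hw⟩ := exists_isGammaSolution
    (L := FractionRing (MvPolynomial (Option (FreeParam n N)) F))
    (MvPolynomial.aeval (0 : Option (FreeParam n N) → F)) hN hU (windowX F n N) (windowY F n N)
    (fun j => (aeval_zero_window F j).1) (fun j => (aeval_zero_window F j).2) (n - N)
  replace hw := fun j (h1 : n - 2 * N ≤ j) (h2 : j ≤ n - 1) =>
    hw j ⟨by omega, by omega⟩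
  refine exists_laurent_of_window (isGenericSolution_of_window hN hU hG hw) hw ?_
  -- The initial moments at this bond are those of the window, hence polynomials in its variables.
  refine Algebra.adjoin_le ?_
  rintro _ ⟨⟨e, f, s⟩, rfl⟩
  exact ⟨_, (hm e f s s.2).symm⟩
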